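/- Let $n\ge 4$ and let $\mathbb Z[\delta]$ be the polynomial ring in one indeterminate. *Diagrams.* The standard $n$-box is a rectangle with nodes $1,\dots,n$ on its north face and $1',\dots,n'$ on its south face, numbered from left to right. A *decorated pseudo $n$-diagram* is, up to isotopy, a finite set of disjoint curves in the box, such that every node is the end of exactly one curve and all other curves are loops; each curve carries a finite number of decorations (all alike), and there are no decorations at all if no edge joins two nodes of the north face. It is *L-decorated* if all decorations can be moved simultaneously to the left wall of the box without crossing any edge. Let $\mathcal P_n^L$ be the free $\mathbb Z[\delta]$-module on the L-decorated pseudo $n$-diagrams, an associative unital algebra under concatenation of diagrams (in $d'd$, $d'$ is placed on top of $d$ and decorations on curves that are joined are put together). Let $\widehat{\mathcal P}_n^L$ be the quotient of $\mathcal P_n^L$ by the relations: (1) an undecorated loop equals $\delta$; (2) two adjacent decorations on the same curve cancel; (3) a curve loses a decoration in the presence of another curve that is a loop with one decoration. *Algebras.* For $1\le i\le n-1$ let $d_i$ be the undecorated diagram with edges $\{i,i+1\}$, $\{i',(i+1)'\}$ and $\{j,j'\}$ for $j\ne i,i+1$, and let $d_{\overline 1}$ be obtained from $d_1$ by putting one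 decoration on each of the edges $\{1,2\}$ and $\{1',2'\}$. Let $\mathbb{D}TL(D_n)$ be the unital $\mathbb Z[\delta]$-subalgebra of $\widehat{\mathcal P}_n^L$ generated by $d_{\overline 1},d_1,\dots,d_{n-1}$, and let $LFD(D_n)$ be its quotient by the additional relation that a loop with one decoration equals $0$. An L-decorated pseudo $n$-diagram is *$D$-admissible of type II* if none of the relations (1)–(3) can be applied to it, it has no loops, and its total number of decorations is even. **Proposition.** Every $D$-admissible diagram of type II represents an element of $\mathbb{D}TL(D_n)$. The images of these diagrams in $LFD(D_n)$, as $d$ runs over the $D$-admissible diagrams of type II, are pairwise distinct and form a basis of $LFD(D_n)$ as a $\mathbb Z[\delta]$-module. -/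

import Mathlib

open Polynomial

namespace DecTL

/-!
# Decorated diagrams

A decorated pseudo-diagram is recorded by its curves: for each curve the multiset of the nodes at
which it ends (two nodes for an edge, none for a loop) and the number of decorations it carries.
Decorations are all alike and adjacent blocks on a curve may be conjoined, so only their number
matters. Up to isotopy the edges of a plane diagram are determined by the nodes they join. The
place of a loop is not recorded: loops without decoration have the same value wherever they lie,
and loops with a decoration all lie in the region next to the left wall.
-/

/-- A curve: the nodes at which it ends, and the number of its decorations. -/
abbrev Strand (V : Type*) := Multiset V × ℕ

/-- All ends of the curves in `M`. -/
def ends {V : Type*} (M : Multiset (Strand V)) : Multiset V := (M.map Prod.fst).sum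

/-- Rename the nodes. -/
def relabel {V W : Type*} (f : V → W) (M : Multiset (Strand V)) : Multiset (Strand W) :=
  M.map (fun e => (e.1.map f, e.2))

/-- Join the curves that meet at the node `v` into a single curve, which carries the decorations of
all of them; the node `v` disappears. If a single curve has both its ends at `v`, it is closed
to a loop. -/
def fuse {V : Type*} [DecidableEq V] (v : V) (M : Multiset (Strand V)) : Multiset (Strand V) :=
  ((M.filter (fun e => v ∈ e.1)).sum.1.filter (fun x => x ≠ v),
    (M.filter (fun e => v ∈ e.1)).sum.2) ::ₘ M.filter (fun e => v ∉ e.1)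

/-- Join curves at each of the nodes in the list `l`. -/
def fuseList {V : Type*} [DecidableEq V] (l : List V) (M : Multiset (Strand V)) :
    Multiset (Strand V) :=
  l.foldr fuse M

/-- A curve is an edge, with two ends, or a loop, without ends. -/
def IsCurve {V : Type*} (e : Strand V) : Prop := Multiset.card e.1 = 0 ∨ Multiset.card e.1 = 2

/-- The nodes of the standard `k`-box: `Sum.inl i` lies on the north face and `Sum.inr i` on the
south face; `i` runs from left to right, starting with `0`. -/
abbrev Node (k : ℕ) := Fin k ⊕ Fin k

/-- Put a `k`-box between the levels `s` (north face) and `t` (south face). -/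
def place {k : ℕ} {Λ : Type*} (s t : Λ) : Node k → Λ × Fin k :=
  Sum.elim (fun i => (s, i)) (fun i => (t, i))

/-- The nodes at level `m`. -/
def level (k : ℕ) {Λ : Type*} (m : Λ) : List (Λ × Fin k) :=
  (List.finRange k).map fun i => (m, i)

/-- Put `d` on top of `d'`, so that the south face of `d` and the north face of `d'` are both at
level `1`. -/
def stack {k : ℕ} (d d' : Multiset (Strand (Node k))) : Multiset (Strand (Fin 3 × Fin k)) :=
  relabel (place 0 1) d + relabel (place 1 2) d'

/-- Level `0` becomes the north face and level `2` the south face. -/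
def unplace {k : ℕ} (x : Fin 3 × Fin k) : Node k := if x.1 = 0 then Sum.inl x.2 else Sum.inr x.2

/-- Concatenation, `d` on top of `d'`. -/
def concat {k : ℕ} (d d' : Multiset (Strand (Node k))) : Multiset (Strand (Node k)) :=
  relabel unplace (fuseList (level k 1) (stack d d'))

/-- Each curve is an edge or a loop, and each node is the end of exactly one edge. -/
def IsDiagram {k : ℕ} (d : Multiset (Strand (Node k))) : Prop :=
  (∀ e ∈ d, IsCurve e) ∧ ∀ v, (ends d).count v = 1

/-- The position of a node on the boundary of the box, read clockwise from the left wall: first the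
north face from left to right, then the south face from right to left. -/
def nodePos {k : ℕ} (v : Node k) : ℕ :=
  Sum.elim (fun i : Fin k => (i : ℕ)) (fun i : Fin k => 2 * k - 1 - i) v

/-- No two edges cross: the ends `a, c` of one edge and `b, x` of another one never occur in
the order `a < b < c < x`. -/
def Planar {V : Type*} (pos : V → ℕ) (M : Multiset (Strand V)) : Prop :=
  ∀ e ∈ M, ∀ f ∈ M, ∀ a ∈ e.1, ∀ b ∈ f.1, ∀ c ∈ e.1, ∀ x ∈ f.1,
    ¬ (pos a < pos b ∧ pos b < pos c ∧ pos c < pos x)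

/-- No edge separates a decorated edge from the left wall. As positions are read from the left wall,
an edge with ends `a < c` separates from the left wall the nodes between `a` and `c`. -/
def LeftExposed {V : Type*} (pos : V → ℕ) (M : Multiset (Strand V)) : Prop :=
  ∀ e ∈ M, e.2 ≠ 0 → ∀ f ∈ M, ∀ a ∈ f.1, ∀ b ∈ e.1, ∀ c ∈ f.1,
    ¬ (pos a < pos b ∧ pos b < pos c)

/-- The number of non-propagating edges in the north face. -/
def aValue {k : ℕ} (d : Multiset (Strand (Node k))) : ℕ :=
  Multiset.card (d.filter fun e => e.1 ≠ 0 ∧ ∀ v ∈ e.1, v.isLeft = true)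

/-- Undecorated vertical edges at the places in `l`. -/
def straight {k : ℕ} (l : List (Fin k)) : Multiset (Strand (Node k)) :=
  (l.map fun i => (({Sum.inl i, Sum.inr i} : Multiset (Node k)), 0) : List (Strand (Node k)))

/-- The curves of the identity diagram. -/
def idStrands (k : ℕ) : Multiset (Strand (Node k)) := straight (List.finRange k)

/-- An edge joining `i` and `j` in the north face and one in the south face, both with `m`
decorations, and undecorated vertical edges elsewhere. -/
def simpleStrands {k : ℕ} (i j : Fin k) (m : ℕ) : Multiset (Strand (Node k)) :=
  (({Sum.inl i, Sum.inl j} : Multiset (Node k)), m) ::ₘ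
    (({Sum.inr i, Sum.inr j} : Multiset (Node k)), m) ::ₘ
      straight ((List.finRange k).filter fun l => l ≠ i ∧ l ≠ j)

/-! Facts needed for the monoid of decorated diagrams. -/

section Gluing

variable {V W : Type*}

theorem ends_add (M N : Multiset (Strand V)) : ends (M + N) = ends M + ends N := by
  simp [ends]

theorem ends_cons (e : Strand V) (N : Multiset (Strand V)) : ends (e ::ₘ N) = e.1 + ends N := by
  simp [ends]

theorem ends_eq (M : Multiset (Strand V)) : ends M = M.sum.1 := by
  induction M using Multiset.induction_on with
  | empty => rfl
  | cons e M ih => simp [ends_cons, ih]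

theorem mem_ends {M : Multiset (Strand V)} {v : V} : v ∈ ends M ↔ ∃ e ∈ M, v ∈ e.1 := by
  induction M using Multiset.induction_on with
  | empty => simp [ends]
  | cons e M ih => simp [ends_cons, ih]

theorem ends_relabel (f : V → W) (M : Multiset (Strand V)) :
    ends (relabel f M) = (ends M).map f := by
  induction M using Multiset.induction_on with
  | empty => simp [ends, relabel]
  | cons e M ih =>
    rw [ends_cons, Multiset.map_add, ← ih]
    simp [relabel, ends]

theorem relabel_add (f : V → W) (M N : Multiset (Strand V)) :
    relabel f (M + N) = relabel f M + relabel f N := by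
  simp [relabel]

theorem relabel_relabel {U : Type*} (g : W → U) (f : V → W) (M : Multiset (Strand V)) :
    relabel g (relabel f M) = relabel (g ∘ f) M := by
  simp [relabel]

theorem relabel_congr {f g : V → W} {M : Multiset (Strand V)}
    (h : ∀ v ∈ ends M, f v = g v) : relabel f M = relabel g M := by
  refine Multiset.map_congr rfl fun e he => ?_
  rw [Multiset.map_congr rfl fun x hx => h x (mem_ends.2 ⟨e, he, hx⟩)]

theorem relabel_id (M : Multiset (Strand V)) : relabel id M = M := by
  simp [relabel]

theorem sum_relabel (f : V → W) (M : Multiset (Strand V)) :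
    (relabel f M).sum = (M.sum.1.map f, M.sum.2) := by
  induction M using Multiset.induction_on with
  | empty => rfl
  | cons e M ih =>
    simp only [relabel] at ih
    simp [relabel, ih]

theorem ends_filter_add_not (p : Strand V → Prop) [DecidablePred p] (M : Multiset (Strand V)) :
    ends (M.filter p) + ends (M.filter fun e => ¬ p e) = ends M := by
  rw [← ends_add, Multiset.filter_add_not]

theorem mem_ends_sum {F : Multiset (Multiset (Strand V))} {v : V} :
    v ∈ ends F.sum ↔ ∃ S ∈ F, v ∈ ends S := by
  induction F using Multiset.induction_on with
  | empty => simp [ends]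
  | cons S F ih => simp [ends_add, ih]

variable [DecidableEq V]

theorem fuse_add_of_notMem {v : V} (M : Multiset (Strand V)) {N : Multiset (Strand V)}
    (h : v ∉ ends N) : fuse v (M + N) = fuse v M + N := by
  have h1 : ∀ e ∈ N, v ∉ e.1 := fun e he hv => h (mem_ends.2 ⟨e, he, hv⟩)
  have h2 : N.filter (fun e => v ∈ e.1) = 0 := Multiset.filter_eq_nil.2 h1
  have h3 : N.filter (fun e => v ∉ e.1) = N := Multiset.filter_eq_self.2 h1
  simp only [fuse, Multiset.filter_add, h2, h3, add_zero, Multiset.cons_add]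

theorem ends_fuse (v : V) (M : Multiset (Strand V)) :
    ends (fuse v M) = (ends M).filter (fun x => x ≠ v) := by
  have h : (ends (M.filter fun e => v ∉ e.1)).filter (fun x => x ≠ v)
      = ends (M.filter fun e => v ∉ e.1) := by
    refine Multiset.filter_eq_self.2 fun x hx => ?_
    rintro rfl
    obtain ⟨e, he, hx⟩ := mem_ends.1 hx
    exact (Multiset.mem_filter.1 he).2 hx
  rw [fuse, ends_cons, ← ends_eq, ← ends_filter_add_not (fun e => v ∈ e.1) M,
    Multiset.filter_add, h]

theorem ends_fuseList (l : List V) (M : Multiset (Strand V)) :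
    ends (fuseList l M) = (ends M).filter (fun x => x ∉ l) := by
  induction l with
  | nil => simp [fuseList]
  | cons v l ih =>
    change ends (fuse v (fuseList l M)) = _
    rw [ends_fuse, ih, Multiset.filter_filter]
    refine Multiset.filter_congr fun x _ => by simp

theorem mem_ends_fuseList {l : List V} {M : Multiset (Strand V)} {x : V} :
    x ∈ ends (fuseList l M) ↔ x ∈ ends M ∧ x ∉ l := by
  rw [ends_fuseList, Multiset.mem_filter]

theorem count_ends_fuseList {l : List V} (M : Multiset (Strand V)) {x : V} (h : x ∉ l) :
    (ends (fuseList l M)).count x = (ends M).count x := by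
  rw [ends_fuseList, Multiset.count_filter, if_pos h]

theorem fuse_comm (v w : V) (M : Multiset (Strand V)) :
    fuse v (fuse w M) = fuse w (fuse v M) := by
  rcases eq_or_ne v w with rfl | hvw
  · rfl
  set A := M.filter (fun e => v ∈ e.1 ∧ w ∈ e.1) with hA
  set B := M.filter (fun e => v ∈ e.1 ∧ w ∉ e.1) with hB
  set C := M.filter (fun e => v ∉ e.1 ∧ w ∈ e.1) with hC
  set D := M.filter (fun e => v ∉ e.1 ∧ w ∉ e.1) with hD
  have e1 : M.filter (fun e => v ∈ e.1) = A + B := by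
    rw [hA, hB, ← Multiset.filter_add_not (fun e => w ∈ e.1) (M.filter (fun e => v ∈ e.1)),
      Multiset.filter_filter, Multiset.filter_filter]
    congr 1 <;> exact Multiset.filter_congr fun x _ => and_comm
  have e2 : M.filter (fun e => w ∈ e.1) = A + C := by
    rw [hA, hC, ← Multiset.filter_add_not (fun e => v ∈ e.1) (M.filter (fun e => w ∈ e.1)),
      Multiset.filter_filter, Multiset.filter_filter]
  have e3 : M.filter (fun e => v ∉ e.1) = C + D := by
    rw [hC, hD, ← Multiset.filter_add_not (fun e => w ∈ e.1) (M.filter (fun e => v ∉ e.1)),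
      Multiset.filter_filter, Multiset.filter_filter]
    congr 1 <;> exact Multiset.filter_congr fun x _ => and_comm
  have e4 : M.filter (fun e => w ∉ e.1) = B + D := by
    rw [hB, hD, ← Multiset.filter_add_not (fun e => v ∈ e.1) (M.filter (fun e => w ∉ e.1)),
      Multiset.filter_filter, Multiset.filter_filter]
  have f1 : B.filter (fun e => v ∈ e.1) = B := Multiset.filter_eq_self.2 fun e he =>
    (Multiset.mem_filter.1 he).2.1
  have f2 : B.filter (fun e => v ∉ e.1) = 0 := Multiset.filter_eq_nil.2 fun e he =>
    not_not.2 (Multiset.mem_filter.1 he).2.1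
  have f3 : D.filter (fun e => v ∈ e.1) = 0 := Multiset.filter_eq_nil.2 fun e he =>
    (Multiset.mem_filter.1 he).2.1
  have f4 : D.filter (fun e => v ∉ e.1) = D := Multiset.filter_eq_self.2 fun e he =>
    (Multiset.mem_filter.1 he).2.1
  have g1 : C.filter (fun e => w ∈ e.1) = C := Multiset.filter_eq_self.2 fun e he =>
    (Multiset.mem_filter.1 he).2.2
  have g2 : C.filter (fun e => w ∉ e.1) = 0 := Multiset.filter_eq_nil.2 fun e he =>
    not_not.2 (Multiset.mem_filter.1 he).2.2
  have g3 : D.filter (fun e => w ∈ e.1) = 0 := Multiset.filter_eq_nil.2 fun e he =>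
    (Multiset.mem_filter.1 he).2.2
  have g4 : D.filter (fun e => w ∉ e.1) = D := Multiset.filter_eq_self.2 fun e he =>
    (Multiset.mem_filter.1 he).2.2
  have hBw : w ∉ B.sum.1 := by
    rw [← ends_eq, mem_ends]; rintro ⟨e, he, h⟩; exact (Multiset.mem_filter.1 he).2.2 h
  have hCv : v ∉ C.sum.1 := by
    rw [← ends_eq, mem_ends]; rintro ⟨e, he, h⟩; exact (Multiset.mem_filter.1 he).2.1 h
  have hFw : fuse w M = ((A + C).sum.1.filter (fun x => x ≠ w), (A + C).sum.2) ::ₘ (B + D) := by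
    rw [fuse, e2, e4]
  have hFv : fuse v M = ((A + B).sum.1.filter (fun x => x ≠ v), (A + B).sum.2) ::ₘ (C + D) := by
    rw [fuse, e1, e3]
  rw [hFw, hFv]
  by_cases hA0 : A = 0
  · simp only [fuse, hA0, zero_add, Multiset.filter_cons, Multiset.filter_add, f1, f2, f3, f4,
      g1, g2, g3, g4, Multiset.mem_filter, hBw, hCv, false_and, if_false, not_false_eq_true,
      if_true, add_zero]
    simp only [← Multiset.singleton_add]
    abel
  · obtain ⟨a, ha⟩ := Multiset.exists_mem_of_ne_zero hA0
    have hav : v ∈ A.sum.1 := by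
      rw [← ends_eq]; exact mem_ends.2 ⟨a, ha, (Multiset.mem_filter.1 ha).2.1⟩
    have haw : w ∈ A.sum.1 := by
      rw [← ends_eq]; exact mem_ends.2 ⟨a, ha, (Multiset.mem_filter.1 ha).2.2⟩
    simp only [fuse, Multiset.filter_cons, Multiset.filter_add, f1, f2, f3, f4,
      g1, g2, g3, g4, Multiset.mem_filter, Multiset.sum_add, Prod.fst_add, Multiset.mem_add, hav,
      haw, hvw, hvw.symm, true_or, ne_eq, not_false_eq_true, and_self, if_true, not_true_eq_false,
      if_false, zero_add, add_zero, Multiset.sum_singleton, Prod.snd_add, Multiset.filter_filter]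
    congr 1
    refine Prod.ext ?_ ?_
    · dsimp only
      have h1 : B.sum.1.filter (fun x => ¬ x = v) =
          B.sum.1.filter (fun x => ¬ x = v ∧ ¬ x = w) := Multiset.filter_congr fun x hx => by
        have : x ≠ w := fun h => hBw (h ▸ hx)
        simp [this]
      have h2 : C.sum.1.filter (fun x => ¬ x = w) =
          C.sum.1.filter (fun x => ¬ x = v ∧ ¬ x = w) := Multiset.filter_congr fun x hx => by
        have : x ≠ v := fun h => hCv (h ▸ hx)
        simp [this]
      simp only [h1, h2, and_comm]
      abel
    · simp only []
      abel

theorem fuseList_append (l l' : List V) (M : Multiset (Strand V)) :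
    fuseList (l ++ l') M = fuseList l (fuseList l' M) :=
  List.foldr_append

theorem fuseList_comm (l l' : List V) (M : Multiset (Strand V)) :
    fuseList l (fuseList l' M) = fuseList l' (fuseList l M) := by
  rw [← fuseList_append, ← fuseList_append]
  have : LeftCommutative (fuse : V → Multiset (Strand V) → Multiset (Strand V)) := ⟨fuse_comm⟩
  exact List.Perm.foldr_eq List.perm_append_comm M

theorem fuseList_add_of_notMem {l : List V} (M : Multiset (Strand V)) {N : Multiset (Strand V)}
    (h : ∀ v ∈ l, v ∉ ends N) : fuseList l (M + N) = fuseList l M + N := by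
  induction l with
  | nil => rfl
  | cons v l ih =>
    change fuse v (fuseList l (M + N)) = fuse v (fuseList l M) + N
    rw [ih fun w hw => h w (List.mem_cons_of_mem _ hw),
      fuse_add_of_notMem _ (h v List.mem_cons_self)]

theorem relabel_fuse [DecidableEq W] {f : V → W} (hf : Function.Injective f) (v : V)
    (M : Multiset (Strand V)) : relabel f (fuse v M) = fuse (f v) (relabel f M) := by
  have h1 : (relabel f M).filter (fun e => f v ∈ e.1) =
      relabel f (M.filter (fun e => v ∈ e.1)) := by
    simp only [relabel, Multiset.filter_map]
    congr 1
    refine Multiset.filter_congr fun e _ => ?_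
    simp [hf.eq_iff]
  have h2 : (relabel f M).filter (fun e => f v ∉ e.1) =
      relabel f (M.filter (fun e => v ∉ e.1)) := by
    simp only [relabel, Multiset.filter_map]
    congr 1
    refine Multiset.filter_congr fun e _ => ?_
    simp [hf.eq_iff]
  have h3 : ∀ t : Multiset V, (t.map f).filter (fun x => x ≠ f v) =
      (t.filter (fun x => x ≠ v)).map f := fun t => by
    rw [Multiset.filter_map]
    congr 1
    refine Multiset.filter_congr fun x _ => ?_
    simp [hf.eq_iff]
  rw [fuse, fuse, h1, h2, sum_relabel, h3]
  simp [relabel]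

theorem relabel_fuseList [DecidableEq W] {f : V → W} (hf : Function.Injective f) (l : List V)
    (M : Multiset (Strand V)) : relabel f (fuseList l M) = fuseList (l.map f) (relabel f M) := by
  induction l with
  | nil => rfl
  | cons v l ih =>
    change relabel f (fuse v (fuseList l M)) = fuse (f v) (fuseList (l.map f) (relabel f M))
    rw [relabel_fuse hf, ih]

theorem isCurve_fuse {v : V} {M : Multiset (Strand V)} (hM : ∀ e ∈ M, IsCurve e)
    (hv : (ends M).count v = 2) : ∀ e ∈ fuse v M, IsCurve e := by
  intro e he
  rw [fuse, Multiset.mem_cons] at he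
  rcases he with rfl | he
  · set A := M.filter (fun e => v ∈ e.1) with hA
    have hc : (ends A).count v = 2 := by
      rw [← hv, ← ends_filter_add_not (fun e => v ∈ e.1) M, Multiset.count_add,
        Multiset.count_eq_zero_of_notMem (s := ends (M.filter fun e => v ∉ e.1)), add_zero]
      rw [mem_ends]
      rintro ⟨e, he, h⟩
      exact (Multiset.mem_filter.1 he).2 h
    have key : ∀ B : Multiset (Strand V), (∀ e ∈ B, v ∈ e.1 ∧ IsCurve e) →
        Multiset.card (ends B) = 2 * Multiset.card B ∧
          Multiset.card B ≤ (ends B).count v := by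
      intro B
      induction B using Multiset.induction_on with
      | empty => simp [ends]
      | cons e B ih =>
        intro h
        obtain ⟨h1, h2⟩ := ih fun e he => h e (Multiset.mem_cons_of_mem he)
        obtain ⟨h3, h4⟩ := h e (Multiset.mem_cons_self e B)
        have h5 := Multiset.one_le_count_iff_mem.2 h3
        have h6 : Multiset.card e.1 ≠ 0 := fun h => by
          rw [Multiset.card_eq_zero] at h; simp [h] at h3
        have h7 : Multiset.card e.1 = 2 := h4.resolve_left h6
        rw [ends_cons, Multiset.card_add, Multiset.count_add, Multiset.card_cons]
        omega
    obtain ⟨h1, h2⟩ := key A fun e he =>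
      ⟨(Multiset.mem_filter.1 he).2, hM e (Multiset.mem_filter.1 he).1⟩
    have h3 : Multiset.card A ≠ 0 := fun h => by
      rw [Multiset.card_eq_zero] at h; simp [h, ends] at hc
    have h4 : Multiset.card ((ends A).filter fun x => x ≠ v) + 2 = Multiset.card (ends A) := by
      have := congrArg Multiset.card (Multiset.filter_add_not (fun x => v = x) (ends A))
      rw [Multiset.card_add, ← Multiset.countP_eq_card_filter] at this
      rw [← this, ← hc, Multiset.count, add_comm]
      congr 2
      exact Multiset.filter_congr fun x _ => ne_comm
    unfold IsCurve
    rw [← ends_eq]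
    dsimp only
    omega
  · exact hM e (Multiset.mem_filter.1 he).1

theorem isCurve_fuseList {l : List V} (hl : l.Nodup) {M : Multiset (Strand V)}
    (hM : ∀ e ∈ M, IsCurve e) (hv : ∀ v ∈ l, (ends M).count v = 2) :
    ∀ e ∈ fuseList l M, IsCurve e := by
  induction l with
  | nil => exact hM
  | cons v l ih =>
    change ∀ e ∈ fuse v (fuseList l M), IsCurve e
    rw [List.nodup_cons] at hl
    refine isCurve_fuse (ih hl.2 fun w hw => hv w (List.mem_cons_of_mem _ hw)) ?_
    rw [ends_fuseList, Multiset.count_filter, if_pos hl.1, hv v List.mem_cons_self]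

/-- Gluing straight strands `{w i, v i}` to `M` along the points `v i` renames `v i` to `w i`. -/
theorem fuseList_straight {ι : Type*} (v w : ι → V) (hv : Function.Injective v)
    (hvw : ∀ i j, w i ≠ v j) (l : List ι) (hl : l.Nodup) (M : Multiset (Strand V))
    (hM : ∀ i, (ends M).count (v i) = 1) :
    ∃ h : V → V, (∀ i ∈ l, h (v i) = w i) ∧ (∀ x, (∀ i ∈ l, x ≠ v i) → h x = x) ∧
      fuseList (l.map v) ((l.map fun i => (({w i, v i} : Multiset V), 0) : List (Strand V)) + M)
        = relabel h M := by
  induction l with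
  | nil => exact ⟨id, by simp, by simp, by simp [fuseList, relabel_id]⟩
  | cons i l ih =>
    rw [List.nodup_cons] at hl
    obtain ⟨h, h1, h2, h3⟩ := ih hl.2
    have hvi : h (v i) = v i := h2 _ fun j hj e => hl.1 (hv e ▸ hj)
    have hcount : (ends (relabel h M)).count (v i) = 1 := by
      rw [ends_relabel, Multiset.count_map, ← hM i, Multiset.count,
        Multiset.countP_eq_card_filter]
      congr 1
      refine Multiset.filter_congr fun x _ => ⟨fun e => ?_, fun e => ?_⟩
      · by_cases hx : ∃ j ∈ l, x = v j
        · obtain ⟨j, hj, rfl⟩ := hx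
          rw [h1 j hj] at e
          exact absurd e.symm (hvw _ _)
        · push Not at hx
          rw [h2 x hx] at e
          exact e
      · rw [← e, hvi]
    refine ⟨fun x => if x = v i then w i else h x, ?_, ?_, ?_⟩
    · intro j hj
      rcases List.mem_cons.1 hj with rfl | hj
      · simp
      · have : v j ≠ v i := fun e => hl.1 (hv e ▸ hj)
        simp [this, h1 j hj]
    · intro x hx
      have : x ≠ v i := hx i List.mem_cons_self
      simp [this, h2 x fun j hj => hx j (List.mem_cons_of_mem _ hj)]
    · change fuse (v i) (fuseList (l.map v) _) = _
      have e1 : (((i :: l).map fun i => (({w i, v i} : Multiset V), 0) : List (Strand V)) :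
          Multiset (Strand V)) + M =
          ((l.map fun i => (({w i, v i} : Multiset V), 0) : List (Strand V)) + M)
            + {(({w i, v i} : Multiset V), 0)} := by
        rw [List.map_cons, ← Multiset.cons_coe, ← Multiset.singleton_add]
        abel
      rw [e1, fuseList_add_of_notMem, h3]
      · set N := relabel h M with hN
        obtain ⟨e, he, hve⟩ := mem_ends.1 (Multiset.one_le_count_iff_mem.1 hcount.ge)
        obtain ⟨N', hN'⟩ := Multiset.exists_cons_of_mem he
        obtain ⟨t, ht⟩ := Multiset.exists_cons_of_mem hve
        have hc : t.count (v i) + (ends N').count (v i) = 0 := by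
          rw [hN', ends_cons, ht, Multiset.count_add, Multiset.count_cons_self] at hcount
          omega
        have ht0 : v i ∉ t := by
          rw [← Multiset.count_eq_zero]; omega
        have hN0 : v i ∉ ends N' := by
          rw [← Multiset.count_eq_zero]; omega
        have e2 : relabel (fun x => if x = v i then w i else h x) M
            = relabel (fun x => if x = v i then w i else x) N := by
          rw [hN, relabel_relabel]
          refine relabel_congr fun x _ => ?_
          by_cases hx : x = v i
          · simp [hx, hvi]
          · simp only [hx, if_false, Function.comp]
            rw [if_neg]
            intro e
            by_cases hx' : ∃ j ∈ l, x = v j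
            · obtain ⟨j, hj, rfl⟩ := hx'
              rw [h1 j hj] at e
              exact hvw _ _ e
            · push Not at hx'
              rw [h2 x hx'] at e
              exact hx e
        rw [e2, hN', Multiset.cons_add, ← Multiset.singleton_add, add_comm N', ← add_assoc,
          fuse_add_of_notMem _ hN0, ← Multiset.singleton_add, relabel_add]
        congr 1
        · have hs : ({e} + {(({w i, v i} : Multiset V), 0)} : Multiset (Strand V)).filter
              (fun e => v i ∈ e.1) = {e} + {(({w i, v i} : Multiset V), 0)} := by
            refine Multiset.filter_eq_self.2 fun a ha => ?_
            simp only [Multiset.mem_add, Multiset.mem_singleton] at ha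
            rcases ha with rfl | rfl
            · exact hve
            · simp
          have hs' : ({e} + {(({w i, v i} : Multiset V), 0)} : Multiset (Strand V)).filter
              (fun e => v i ∉ e.1) = 0 := by
            refine Multiset.filter_eq_nil.2 fun a ha => ?_
            simp only [Multiset.mem_add, Multiset.mem_singleton] at ha
            rcases ha with rfl | rfl
            · exact not_not.2 hve
            · simp
          have ht1 : t.filter (fun x => ¬ x = v i) = t := Multiset.filter_eq_self.2 fun x hx e =>
            ht0 (e ▸ hx)
          have ht2 : t.map (fun x => if x = v i then w i else x) = t := by
            conv_rhs => rw [← Multiset.map_id t]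
            refine Multiset.map_congr rfl fun x hx => ?_
            have hne : x ≠ v i := fun hh => ht0 (hh ▸ hx)
            rw [if_neg hne, id]
          rw [fuse, hs, hs']
          simp only [relabel, Multiset.sum_add, Multiset.sum_singleton, Prod.fst_add, ht,
            Multiset.filter_add, Prod.snd_add, Multiset.map_singleton, Multiset.map_cons, if_true,
            ht2, Multiset.filter_cons, ht1, ne_eq, not_true_eq_false, if_false, zero_add,
            Multiset.insert_eq_cons, Multiset.filter_singleton, hvw, not_false_eq_true, add_zero]
          rw [add_comm t, Multiset.singleton_add]
          simp
        · symm
          conv_rhs => rw [← relabel_id N']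
          refine relabel_congr fun x hx => ?_
          have hne : x ≠ v i := fun hh => hN0 (hh ▸ hx)
          rw [if_neg hne, id]
      · intro x hx
        obtain ⟨j, hj, rfl⟩ := List.mem_map.1 hx
        have hij : v j ≠ v i := fun e => hl.1 (hv e ▸ hj)
        simp [ends, hij, (hvw i j).symm]

def groupStrand (l : List V) (S : Multiset (Strand V)) : Strand V :=
  ((ends S).filter (fun x => x ∉ l), S.sum.2)

theorem groupStrand_fst (l : List V) (S : Multiset (Strand V)) (p : V → Prop) [DecidablePred p]
    (h : ∀ x, x ∉ l ↔ p x) : (groupStrand l S).1 = (ends S).filter p :=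
  Multiset.filter_congr fun x _ => h x

theorem sum_groupStrand (l : List V) (F : Multiset (Multiset (Strand V))) :
    (F.map (groupStrand l)).sum = groupStrand l F.sum := by
  induction F using Multiset.induction_on with
  | empty => simp [groupStrand, ends]; rfl
  | cons S F ih =>
    rw [Multiset.map_cons, Multiset.sum_cons, ih, Multiset.sum_cons]
    simp [groupStrand, ends_add]

theorem mem_fuseList {l : List V} {M : Multiset (Strand V)} {e : Strand V} (he : e ∈ M)
    (h : ∀ x ∈ e.1, x ∉ l) : e ∈ fuseList l M := by
  induction l with
  | nil => exact he
  | cons v l ih =>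
    refine Multiset.mem_cons_of_mem (Multiset.mem_filter.2 ⟨ih fun x hx hl => ?_, fun hv => ?_⟩)
    · exact h x hx (List.mem_cons_of_mem _ hl)
    · exact h v hv List.mem_cons_self

/-- The strands obtained by fusing correspond to groups of the original strands that are
linked to each other at the fused points. -/
theorem exists_groups (l : List V) (hl : l.Nodup) (M : Multiset (Strand V)) :
    ∃ F : Multiset (Multiset (Strand V)), F.sum = M ∧ fuseList l M = F.map (groupStrand l) ∧
      (∀ v ∈ l, ∀ S ∈ F, (ends S).count v = 0 ∨ (ends S).count v = (ends M).count v) ∧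
      (∀ S ∈ F, ∀ g : V → ℕ, (∀ e ∈ S, ∀ x ∈ e.1, ∀ y ∈ e.1, g x = g y) →
        ∀ x ∈ ends S, ∀ y ∈ ends S, g x = g y) ∧
      (∀ S ∈ F, ∀ e ∈ S, e.1 = 0 → S = {e}) := by
  induction l with
  | nil =>
    refine ⟨M.map fun e => {e}, Multiset.sum_map_singleton M, ?_, by simp, ?_, ?_⟩
    · rw [Multiset.map_map]
      conv_lhs => rw [fuseList, List.foldr_nil, ← Multiset.map_id M]
      refine Multiset.map_congr rfl fun e _ => ?_
      simp [groupStrand, ends]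
    · intro S hS g hg x hx y hy
      obtain ⟨e, _, rfl⟩ := Multiset.mem_map.1 hS
      refine hg e (Multiset.mem_singleton_self e) x ?_ y ?_
      · simpa [ends] using hx
      · simpa [ends] using hy
    · intro S hS e he _
      obtain ⟨e', _, rfl⟩ := Multiset.mem_map.1 hS
      rw [Multiset.mem_singleton.1 he]
  | cons v l ih =>
    rw [List.nodup_cons] at hl
    obtain ⟨F, h1, h2, h3, h4, h5⟩ := ih hl.2
    set G := F.filter (fun S => v ∈ ends S) with hG
    set H := F.filter (fun S => v ∉ ends S) with hH
    have hGH : G + H = F := Multiset.filter_add_not _ _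
    have hmem : ∀ S, v ∈ (groupStrand l S).1 ↔ v ∈ ends S := fun S => by
      simp [groupStrand, hl.1]
    have hHsum : v ∉ ends H.sum := by
      rw [mem_ends_sum]
      rintro ⟨S, hS, h⟩
      exact (Multiset.mem_filter.1 hS).2 h
    refine ⟨G.sum ::ₘ H, ?_, ?_, ?_, ?_, ?_⟩
    · rw [Multiset.sum_cons, ← Multiset.sum_add, hGH, h1]
    · change fuse v (fuseList l M) = _
      have e1 : (F.map (groupStrand l)).filter (fun e => v ∈ e.1) = G.map (groupStrand l) := by
        rw [Multiset.filter_map]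
        congr 1
        exact Multiset.filter_congr fun S _ => hmem S
      have e2 : (F.map (groupStrand l)).filter (fun e => v ∉ e.1) = H.map (groupStrand l) := by
        rw [Multiset.filter_map]
        congr 1
        exact Multiset.filter_congr fun S _ => not_congr (hmem S)
      rw [h2, fuse, e1, e2, sum_groupStrand, Multiset.map_cons]
      congr 1
      · refine Prod.ext ?_ rfl
        simp only [groupStrand, Multiset.filter_filter]
        refine Multiset.filter_congr fun x _ => by simp
      · refine Multiset.map_congr rfl fun S hS => Prod.ext ?_ rfl
        have hv : v ∉ ends S := (Multiset.mem_filter.1 hS).2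
        refine Multiset.filter_congr fun x hx => ?_
        have : x ≠ v := fun h => hv (h ▸ hx)
        simp [this]
    · intro w hw S hS
      rw [Multiset.mem_cons] at hS
      rcases List.mem_cons.1 hw with rfl | hw
      · rcases hS with rfl | hS
        · right
          rw [← h1, ← hGH, Multiset.sum_add, ends_add, Multiset.count_add,
            Multiset.count_eq_zero_of_notMem hHsum, add_zero]
        · exact Or.inl (Multiset.count_eq_zero_of_notMem (Multiset.mem_filter.1 hS).2)
      · rcases hS with rfl | hS
        · have hle : (ends G.sum).count w ≤ (ends M).count w := by
            rw [← h1, ← hGH, Multiset.sum_add, ends_add, Multiset.count_add]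
            exact Nat.le_add_right _ _
          have hmul : ∀ K : Multiset (Multiset (Strand V)), (∀ S ∈ K, S ∈ F) →
              ∃ m : ℕ, (ends K.sum).count w = m * (ends M).count w := by
            intro K
            induction K using Multiset.induction_on with
            | empty => exact fun _ => ⟨0, by simp [ends]⟩
            | cons S K ihK =>
              intro hK
              obtain ⟨m, hm⟩ := ihK fun S hS => hK S (Multiset.mem_cons_of_mem hS)
              rw [Multiset.sum_cons, ends_add, Multiset.count_add, hm]
              rcases h3 w hw S (hK S (Multiset.mem_cons_self _ _)) with h | h
              · exact ⟨m, by rw [h, zero_add]⟩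
              · exact ⟨m + 1, by rw [h]; ring⟩
          obtain ⟨m, hm⟩ := hmul G fun S hS => (Multiset.mem_filter.1 hS).1
          rcases m with _ | _ | m
          · left; rw [hm, zero_mul]
          · right; rw [hm, zero_add, one_mul]
          · left
            rw [hm] at hle ⊢
            have : (ends M).count w = 0 := by nlinarith
            rw [this, mul_zero]
        · exact h3 w hw S (Multiset.mem_filter.1 hS).1
    · intro S hS g hg
      rw [Multiset.mem_cons] at hS
      rcases hS with rfl | hS
      · have key : ∀ x ∈ ends G.sum, g x = g v := by
          intro x hx
          obtain ⟨S, hS, hx⟩ := mem_ends_sum.1 hx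
          refine h4 S (Multiset.mem_filter.1 hS).1 g (fun e he => hg e ?_) x hx v
            (Multiset.mem_filter.1 hS).2
          obtain ⟨K, hK⟩ := Multiset.exists_cons_of_mem hS
          rw [hK, Multiset.sum_cons]
          exact Multiset.mem_add.2 (Or.inl he)
        intro x hx y hy
        rw [key x hx, key y hy]
      · exact h4 S (Multiset.mem_filter.1 hS).1 g hg
    · intro S hS e he he0
      rw [Multiset.mem_cons] at hS
      rcases hS with rfl | hS
      · exfalso
        have : ∃ S ∈ G, e ∈ S := by
          clear_value G
          induction G using Multiset.induction_on with
          | empty => simp at he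
          | cons S K ihK => exact (Multiset.mem_join (S := S ::ₘ K)).1 he
        obtain ⟨S, hS, heS⟩ := this
        have h6 := h5 S (Multiset.mem_filter.1 hS).1 e heS he0
        have h7 : v ∈ ends S := (Multiset.mem_filter.1 hS).2
        rw [h6] at h7
        simp [ends, he0] at h7
      · exact h5 S (Multiset.mem_filter.1 hS).1 e he he0

end Gluing

section Concat

variable {k : ℕ}

theorem mem_level {Λ : Type*} {m : Λ} {x : Λ × Fin k} : x ∈ level k m ↔ x.1 = m := by
  rcases x with ⟨l, i⟩
  simp [level, eq_comm]

theorem nodup_level {Λ : Type*} (m : Λ) : (level k m).Nodup :=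
  (List.nodup_finRange k).map fun _ _ h => (Prod.mk.inj h).2

theorem place_injective {Λ : Type*} {s t : Λ} (h : s ≠ t) :
    Function.Injective (place s t : Node k → Λ × Fin k) := by
  rintro (i | i) (j | j) e
  · simpa [place] using e
  · exact absurd (Prod.mk.inj e).1 h
  · exact absurd (Prod.mk.inj e).1.symm h
  · simpa [place] using e

theorem mem_ends_place {Λ : Type*} {s t : Λ} {d : Multiset (Strand (Node k))} {x : Λ × Fin k}
    (h : x ∈ ends (relabel (place s t) d)) : x.1 = s ∨ x.1 = t := by
  rw [ends_relabel, Multiset.mem_map] at h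
  obtain ⟨(i | i), _, rfl⟩ := h
  · exact Or.inl rfl
  · exact Or.inr rfl

theorem relabel_place_concat {Λ : Type*} [DecidableEq Λ] {s m t : Λ} (hsm : s ≠ m) (hmt : m ≠ t)
    (hst : s ≠ t) (d d' : Multiset (Strand (Node k))) :
    relabel (place s t) (concat d d') =
      fuseList (level k m) (relabel (place s m) d + relabel (place m t) d') := by
  have hg : Function.Injective (![s, m, t] : Fin 3 → Λ) := by
    intro i j
    fin_cases i <;> fin_cases j <;> simp [hsm, hmt, hst, hsm.symm, hmt.symm, hst.symm]
  have hg' : Function.Injective (Prod.map ![s, m, t] id : Fin 3 × Fin k → Λ × Fin k) :=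
    hg.prodMap Function.injective_id
  rw [concat, relabel_relabel,
    relabel_congr (g := (Prod.map ![s, m, t] id : Fin 3 × Fin k → Λ × Fin k)),
    relabel_fuseList hg']
  · congr 1
    · simp [level]
    · rw [stack, relabel_add, relabel_relabel, relabel_relabel]
      congr 1 <;> refine relabel_congr ?_ <;> rintro (i | i) _ <;> rfl
  · rintro ⟨l, i⟩ hx
    rw [mem_ends_fuseList, mem_level] at hx
    have h1 : l ≠ 1 := hx.2
    fin_cases l
    · rfl
    · exact absurd rfl h1
    · rfl

theorem relabel_injective {V W : Type*} {f : V → W} (hf : Function.Injective f) :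
    Function.Injective (relabel f) := by
  refine Multiset.map_injective ?_
  rintro ⟨x, m⟩ ⟨y, n⟩ h
  have := Prod.mk.inj h
  exact Prod.ext (Multiset.map_injective hf this.1) this.2

theorem concat_assoc (a b c : Multiset (Strand (Node k))) :
    concat (concat a b) c = concat a (concat b c) := by
  refine relabel_injective (place_injective (k := k) (s := (0 : Fin 4)) (t := 3) (by decide)) ?_
  rw [relabel_place_concat (m := (2 : Fin 4)) (by decide) (by decide) (by decide),
    relabel_place_concat (m := (1 : Fin 4)) (by decide) (by decide) (by decide),
    relabel_place_concat (m := (1 : Fin 4)) (by decide) (by decide) (by decide),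
    relabel_place_concat (m := (2 : Fin 4)) (by decide) (by decide) (by decide),
    ← fuseList_add_of_notMem, fuseList_comm, add_assoc, add_comm (relabel (place 0 1) a),
    fuseList_add_of_notMem, add_comm]
  · intro v hv h
    rw [mem_level] at hv
    rcases mem_ends_place h with h | h <;> rw [hv] at h <;> revert h <;> decide
  · intro v hv h
    rw [mem_level] at hv
    rcases mem_ends_place h with h | h <;> rw [hv] at h <;> revert h <;> decide

theorem count_ends_relabel {V W : Type*} [DecidableEq V] [DecidableEq W] {f : V → W}
    (hf : Function.Injective f) (M : Multiset (Strand V)) (v : V) :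
    (ends (relabel f M)).count (f v) = (ends M).count v := by
  rw [ends_relabel, Multiset.count_map_eq_count' f _ hf]

theorem id_concat (d : Multiset (Strand (Node k))) (hd : ∀ v, (ends d).count v = 1) :
    concat (idStrands k) d = d := by
  have hi : Function.Injective (place 1 2 : Node k → Fin 3 × Fin k) :=
    place_injective (by decide)
  obtain ⟨h, h1, h2, h3⟩ := fuseList_straight (V := Fin 3 × Fin k) (fun i : Fin k => (1, i))
    (fun i => (0, i)) (fun _ _ h => (Prod.mk.inj h).2) (fun i j => by simp) (List.finRange k)
    (List.nodup_finRange k) (relabel (place 1 2) d)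
    (fun i => (count_ends_relabel hi d (Sum.inl i)).trans (hd _))
  have e1 : stack (idStrands k) d = (((List.finRange k).map fun i =>
      (({(0, i), (1, i)} : Multiset (Fin 3 × Fin k)), 0) : List (Strand (Fin 3 × Fin k))) :
        Multiset (Strand (Fin 3 × Fin k))) + relabel (place 1 2) d := by
    rw [stack]
    congr 1
    simp only [relabel, idStrands, straight, place, Multiset.map_coe, List.map_map]
    congr 1
  rw [concat, e1, level, h3, relabel_relabel, relabel_relabel]
  conv_rhs => rw [← relabel_id d]
  refine relabel_congr ?_
  rintro (i | i) _
  · change unplace (h (1, i)) = _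
    rw [h1 i (List.mem_finRange i)]
    rfl
  · change unplace (h (2, i)) = _
    rw [h2 _ fun j _ => by simp]
    rfl

theorem concat_id (d : Multiset (Strand (Node k))) (hd : ∀ v, (ends d).count v = 1) :
    concat d (idStrands k) = d := by
  have hi : Function.Injective (place 0 1 : Node k → Fin 3 × Fin k) :=
    place_injective (by decide)
  obtain ⟨h, h1, h2, h3⟩ := fuseList_straight (V := Fin 3 × Fin k) (fun i : Fin k => (1, i))
    (fun i => (2, i)) (fun _ _ h => (Prod.mk.inj h).2) (fun i j => by simp) (List.finRange k)
    (List.nodup_finRange k) (relabel (place 0 1) d)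
    (fun i => (count_ends_relabel hi d (Sum.inr i)).trans (hd _))
  have e1 : stack d (idStrands k) = (((List.finRange k).map fun i =>
      (({(2, i), (1, i)} : Multiset (Fin 3 × Fin k)), 0) : List (Strand (Fin 3 × Fin k))) :
        Multiset (Strand (Fin 3 × Fin k))) + relabel (place 0 1) d := by
    rw [stack, add_comm]
    congr 1
    simp only [relabel, idStrands, straight, place, Multiset.map_coe, List.map_map]
    congr 1
    refine List.map_congr_left fun i _ => ?_
    exact Prod.ext (Multiset.pair_comm _ _) rfl
  rw [concat, e1, level, h3, relabel_relabel, relabel_relabel]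
  conv_rhs => rw [← relabel_id d]
  refine relabel_congr ?_
  rintro (i | i) _
  · change unplace (h (0, i)) = _
    rw [h2 _ fun j _ => by simp]
    rfl
  · change unplace (h (1, i)) = _
    rw [h1 i (List.mem_finRange i)]
    rfl

theorem count_stack {d d' : Multiset (Strand (Node k))} (hd : ∀ v, (ends d).count v = 1)
    (hd' : ∀ v, (ends d').count v = 1) (x : Fin 3 × Fin k) :
    (ends (stack d d')).count x = if x.1 = 1 then 2 else 1 := by
  have hi : Function.Injective (place 0 1 : Node k → Fin 3 × Fin k) :=
    place_injective (by decide)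
  have hi' : Function.Injective (place 1 2 : Node k → Fin 3 × Fin k) :=
    place_injective (by decide)
  rw [stack, ends_add, Multiset.count_add]
  rcases x with ⟨l, i⟩
  fin_cases l
  · have h1 := (count_ends_relabel hi d (Sum.inl i)).trans (hd _)
    have h2 : (ends (relabel (place 1 2) d')).count ((0 : Fin 3), i) = 0 :=
      Multiset.count_eq_zero.2 fun h => by
        rcases mem_ends_place h with h | h <;> revert h <;> simp
    simpa [place] using (congrArg₂ (· + ·) h1 h2)
  · have h1 := (count_ends_relabel hi d (Sum.inr i)).trans (hd _)
    have h2 := (count_ends_relabel hi' d' (Sum.inl i)).trans (hd' _)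
    simpa [place] using (congrArg₂ (· + ·) h1 h2)
  · have h1 : (ends (relabel (place 0 1) d)).count ((2 : Fin 3), i) = 0 :=
      Multiset.count_eq_zero.2 fun h => by
        rcases mem_ends_place h with h | h <;> revert h <;> simp
    have h2 := (count_ends_relabel hi' d' (Sum.inr i)).trans (hd' _)
    simpa [place] using (congrArg₂ (· + ·) h1 h2)

theorem isCurve_relabel {V W : Type*} {f : V → W} {M : Multiset (Strand V)}
    (h : ∀ e ∈ M, IsCurve e) : ∀ e ∈ relabel f M, IsCurve e := by
  intro e he
  obtain ⟨e', he', rfl⟩ := Multiset.mem_map.1 he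
  simpa [IsCurve] using h e' he'

theorem isCurve_concat {d d' : Multiset (Strand (Node k))} (hd : ∀ v, (ends d).count v = 1)
    (hd' : ∀ v, (ends d').count v = 1) (h : ∀ e ∈ d, IsCurve e) (h' : ∀ e ∈ d', IsCurve e) :
    ∀ e ∈ concat d d', IsCurve e := by
  refine isCurve_relabel (isCurve_fuseList (nodup_level _) ?_ ?_)
  · intro e he
    rcases Multiset.mem_add.1 he with he | he
    · exact isCurve_relabel h e he
    · exact isCurve_relabel h' e he
  · intro v hv
    rw [count_stack hd hd', if_pos (mem_level.1 hv)]

theorem count_concat {d d' : Multiset (Strand (Node k))} (hd : ∀ v, (ends d).count v = 1)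
    (hd' : ∀ v, (ends d').count v = 1) (v : Node k) : (ends (concat d d')).count v = 1 := by
  have hi : Function.Injective (place 0 2 : Node k → Fin 3 × Fin k) :=
    place_injective (by decide)
  rw [← count_ends_relabel hi, relabel_place_concat (m := (1 : Fin 3)) (by decide) (by decide)
    (by decide), count_ends_fuseList]
  · have := count_stack hd hd' (place 0 2 v)
    rw [stack] at this
    rw [this]
    rcases v with i | i <;> simp [place]
  · rw [mem_level]
    rcases v with i | i <;> simp [place]

def boxPos {Λ : Type*} [DecidableEq Λ] (s : Λ) (x : Λ × Fin k) : ℕ :=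
  if x.1 = s then (x.2 : ℕ) else 2 * k - 1 - x.2

theorem boxPos_place {Λ : Type*} [DecidableEq Λ] {s t : Λ} (h : s ≠ t) (v : Node k) :
    boxPos s (place s t v) = nodePos v := by
  rcases v with i | i
  · simp [boxPos, place, nodePos]
  · simp [boxPos, place, nodePos, h.symm]

theorem planar_relabel {V W : Type*} {pos : V → ℕ} {pos' : W → ℕ} {f : V → W}
    (h : ∀ v, pos' (f v) = pos v) (M : Multiset (Strand V)) :
    Planar pos' (relabel f M) ↔ Planar pos M := by
  simp only [Planar, relabel, Multiset.forall_mem_map_iff, h]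

theorem leftExposed_relabel {V W : Type*} {pos : V → ℕ} {pos' : W → ℕ} {f : V → W}
    (h : ∀ v, pos' (f v) = pos v) (M : Multiset (Strand V)) :
    LeftExposed pos' (relabel f M) ↔ LeftExposed pos M := by
  simp only [LeftExposed, relabel, Multiset.forall_mem_map_iff, h]

def below {V : Type*} (pos : V → ℕ) (A : Multiset V) (y : V) : ℕ :=
  A.countP fun x => pos x < pos y

theorem exists_pair {V : Type*} {e : Strand V} (h : IsCurve e) :
    e.1 = 0 ∨ ∃ a b, e.1 = {a, b} := by
  rcases h with h | h
  · exact Or.inl (Multiset.card_eq_zero.1 h)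
  · exact Or.inr (Multiset.card_eq_two.1 h)

theorem below_strand {V : Type*} {pos : V → ℕ} {M : Multiset (Strand V)} (hM : Planar pos M)
    {e f : Strand V} (he : e ∈ M) (hf : f ∈ M) (hc : IsCurve e) {y z : V} (hy : y ∈ f.1)
    (hz : z ∈ f.1) (hne : ∀ x ∈ e.1, pos x ≠ pos y ∧ pos x ≠ pos z) :
    below pos e.1 y % 2 = below pos e.1 z % 2 := by
  rcases exists_pair hc with h | ⟨a, b, h⟩
  · simp [below, h]
  · have ha : a ∈ e.1 := by simp [h]
    have hb : b ∈ e.1 := by simp [h]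
    have h1 := hM e he f hf a ha y hy b hb z hz
    have h2 := hM e he f hf a ha z hz b hb y hy
    have h3 := hM e he f hf b hb y hy a ha z hz
    have h4 := hM e he f hf b hb z hz a ha y hy
    have h5 := hM f hf e he y hy a ha z hz b hb
    have h6 := hM f hf e he z hz a ha y hy b hb
    have h7 := hM f hf e he y hy b hb z hz a ha
    have h8 := hM f hf e he z hz b hb y hy a ha
    obtain ⟨n1, n2⟩ := hne a ha
    obtain ⟨n3, n4⟩ := hne b hb
    simp only [below, h, Multiset.insert_eq_cons, Multiset.countP_cons, ← Multiset.cons_zero,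
      Multiset.countP_zero]
    split_ifs <;> omega

theorem below_add {V : Type*} (pos : V → ℕ) (A B : Multiset V) (y : V) :
    below pos (A + B) y = below pos A y + below pos B y := Multiset.countP_add _ _ _

theorem below_ends {V : Type*} {pos : V → ℕ} {M S : Multiset (Strand V)} (hM : Planar pos M)
    {f : Strand V} (hf : f ∈ M) {y z : V} (hy : y ∈ f.1) (hz : z ∈ f.1) (hS : ∀ e ∈ S, e ∈ M)
    (hc : ∀ e ∈ S, IsCurve e) (hne : ∀ x ∈ ends S, pos x ≠ pos y ∧ pos x ≠ pos z) :
    below pos (ends S) y % 2 = below pos (ends S) z % 2 := by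
  induction S using Multiset.induction_on with
  | empty => simp [below, ends]
  | cons e S ih =>
    rw [ends_cons, below_add, below_add, Nat.add_mod, Nat.add_mod (below pos e.1 z),
      below_strand hM (hS e (Multiset.mem_cons_self _ _)) hf (hc e (Multiset.mem_cons_self _ _))
        hy hz fun x hx => hne x (by rw [ends_cons]; exact Multiset.mem_add.2 (Or.inl hx)),
      ih (fun e he => hS e (Multiset.mem_cons_of_mem he))
        (fun e he => hc e (Multiset.mem_cons_of_mem he))
        fun x hx => hne x (by rw [ends_cons]; exact Multiset.mem_add.2 (Or.inr hx))]

theorem below_ends_exposed {V : Type*} {pos : V → ℕ} {M S : Multiset (Strand V)}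
    (hM : LeftExposed pos M) {f : Strand V} (hf : f ∈ M) (hf2 : f.2 ≠ 0) {y : V} (hy : y ∈ f.1)
    (hS : ∀ e ∈ S, e ∈ M) (hc : ∀ e ∈ S, IsCurve e) (hne : ∀ x ∈ ends S, pos x ≠ pos y) :
    below pos (ends S) y % 2 = 0 := by
  induction S using Multiset.induction_on with
  | empty => simp [below, ends]
  | cons e S ih =>
    have h1 : below pos e.1 y % 2 = 0 := by
      rcases exists_pair (hc e (Multiset.mem_cons_self _ _)) with h | ⟨a, b, h⟩
      · simp [below, h]
      · have ha : a ∈ e.1 := by simp [h]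
        have hb : b ∈ e.1 := by simp [h]
        have he := hS e (Multiset.mem_cons_self _ _)
        have h1 := hM f hf hf2 e he a ha y hy b hb
        have h2 := hM f hf hf2 e he b hb y hy a ha
        have n1 := hne a (by rw [ends_cons]; exact Multiset.mem_add.2 (Or.inl ha))
        have n2 := hne b (by rw [ends_cons]; exact Multiset.mem_add.2 (Or.inl hb))
        simp only [below, h, Multiset.insert_eq_cons, Multiset.countP_cons, ← Multiset.cons_zero,
          Multiset.countP_zero]
        split_ifs <;> omega
    rw [ends_cons, below_add, Nat.add_mod, h1,
      ih (fun e he => hS e (Multiset.mem_cons_of_mem he))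
        (fun e he => hc e (Multiset.mem_cons_of_mem he))
        fun x hx => hne x (by rw [ends_cons]; exact Multiset.mem_add.2 (Or.inr hx))]

theorem exists_split {α : Type*} [DecidableEq α] {S T A B : Multiset α} (h : S + T ≤ A + B) :
    ∃ S₁ S₂ T₁ T₂, S = S₁ + S₂ ∧ T = T₁ + T₂ ∧ S₁ + T₁ ≤ A ∧ S₂ + T₂ ≤ B := by
  refine ⟨S ∩ A, S - A, T ∩ (A - S), T - (A - S), ?_, ?_, ?_, ?_⟩
  · ext x; simp only [Multiset.count_add, Multiset.count_inter, Multiset.count_sub]; omega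
  · ext x; simp only [Multiset.count_add, Multiset.count_inter, Multiset.count_sub]; omega
  · rw [Multiset.le_iff_count]; intro x
    simp only [Multiset.count_add, Multiset.count_inter, Multiset.count_sub]; omega
  · rw [Multiset.le_iff_count] at h ⊢; intro x
    have := h x
    simp only [Multiset.count_add, Multiset.count_sub] at this ⊢; omega

theorem even_card_ends {V : Type*} {S : Multiset (Strand V)} (h : ∀ e ∈ S, IsCurve e) :
    Multiset.card (ends S) % 2 = 0 := by
  induction S using Multiset.induction_on with
  | empty => simp [ends]
  | cons e S ih =>
    have h1 := ih fun e he => h e (Multiset.mem_cons_of_mem he)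
    have h2 := h e (Multiset.mem_cons_self _ _)
    rw [ends_cons, Multiset.card_add]
    unfold IsCurve at h2
    omega

theorem countP_add_countP {α : Type*} (p q : α → Prop) [DecidablePred p] [DecidablePred q]
    {A : Multiset α} (h : ∀ x ∈ A, (q x ↔ ¬ p x)) :
    A.countP p + A.countP q = Multiset.card A := by
  rw [Multiset.card_eq_countP_add_countP p, Multiset.countP_congr (s := A) rfl fun x hx => propext (h x hx)]

theorem exists_concat_groups {d d' : Multiset (Strand (Node k))} (hd : IsDiagram d)
    (hd' : IsDiagram d') {p q : Strand (Fin 3 × Fin k)}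
    (hp : p ∈ fuseList (level k 1) (stack d d')) (hq : q ∈ fuseList (level k 1) (stack d d'))
    (hpq : p ≠ q) :
    ∃ S₁ S₂ T₁ T₂ : Multiset (Strand (Fin 3 × Fin k)),
      p = groupStrand (level k 1) (S₁ + S₂) ∧ q = groupStrand (level k 1) (T₁ + T₂) ∧
      S₁ + T₁ ≤ relabel (place 0 1) d ∧ S₂ + T₂ ≤ relabel (place 1 2) d' ∧
      (∀ i : Fin k, (ends (S₁ + S₂)).count (1, i) ≠ 1) ∧
      (∀ i : Fin k, (ends (S₁ + S₂)).count (1, i) ≠ 0 → (ends (T₁ + T₂)).count (1, i) = 0) ∧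
      (∀ g : Fin 3 × Fin k → ℕ, (∀ e ∈ T₁ + T₂, ∀ x ∈ e.1, ∀ y ∈ e.1, g x = g y) →
        ∀ x ∈ ends (T₁ + T₂), ∀ y ∈ ends (T₁ + T₂), g x = g y) ∧
      (∀ e ∈ T₁ + T₂, e.1 = 0 → T₁ + T₂ = {e}) := by
  obtain ⟨F, h1, h2, h3, h4, h5⟩ := exists_groups (level k (1 : Fin 3)) (nodup_level _) (stack d d')
  rw [h2] at hp hq
  obtain ⟨S, hS, rfl⟩ := Multiset.mem_map.1 hp
  obtain ⟨T, hT, rfl⟩ := Multiset.mem_map.1 hq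
  have hne : T ≠ S := fun h => hpq (by rw [h])
  obtain ⟨F', rfl⟩ := Multiset.exists_cons_of_mem hS
  obtain ⟨F'', rfl⟩ := Multiset.exists_cons_of_mem ((Multiset.mem_cons.1 hT).resolve_left hne)
  have hle : S + T ≤ stack d d' := by
    rw [← h1, Multiset.sum_cons, Multiset.sum_cons, ← add_assoc]
    exact Multiset.le_add_right _ _
  have hcle : ∀ x, (ends S).count x + (ends T).count x ≤ (ends (stack d d')).count x := by
    intro x
    rw [← h1, Multiset.sum_cons, Multiset.sum_cons, ends_add, ends_add, Multiset.count_add,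
      Multiset.count_add]
    omega
  obtain ⟨S₁, S₂, T₁, T₂, rfl, rfl, hle₁, hle₂⟩ := exists_split hle
  have hc : ∀ i : Fin k, (ends (stack d d')).count ((1 : Fin 3), i) = 2 := fun i => by
    rw [count_stack hd.2 hd'.2]; simp
  refine ⟨S₁, S₂, T₁, T₂, rfl, rfl, hle₁, hle₂, fun i h => ?_, fun i h => ?_, h4 _ hT, h5 _ hT⟩
  · have := h3 (1, i) (mem_level.2 rfl) _ hS
    rw [hc, h] at this
    omega
  · have h6 := h3 (1, i) (mem_level.2 rfl) _ hS
    have h7 := hcle (1, i)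
    rw [hc] at h6 h7
    omega

theorem concat_parity {d d' : Multiset (Strand (Node k))} (hd : IsDiagram d)
    (hd' : IsDiagram d') (hP : Planar nodePos d) (hP' : Planar nodePos d')
    {p q : Strand (Fin 3 × Fin k)} (hp : p ∈ fuseList (level k 1) (stack d d'))
    (hq : q ∈ fuseList (level k 1) (stack d d')) (hpq : p ≠ q) :
    (∀ y ∈ q.1, ∀ z ∈ q.1, below (boxPos 0) p.1 y % 2 = below (boxPos 0) p.1 z % 2) ∧
      (LeftExposed nodePos d → LeftExposed nodePos d' → q.2 ≠ 0 →
        ∀ y ∈ q.1, below (boxPos 0) p.1 y % 2 = 0) := by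
  obtain ⟨S₁, S₂, T₁, T₂, rfl, rfl, hle₁, hle₂, hS1, hST, hg, hT0⟩ :=
    exists_concat_groups hd hd' hp hq hpq
  set M₁ := relabel (place (0 : Fin 3) 1) d with hM₁
  set M₂ := relabel (place (1 : Fin 3) 2) d' with hM₂
  have hi₁ : Function.Injective (place 0 1 : Node k → Fin 3 × Fin k) :=
    place_injective (by decide)
  have hi₂ : Function.Injective (place 1 2 : Node k → Fin 3 × Fin k) :=
    place_injective (by decide)
  have hPM₁ : Planar (boxPos 0) M₁ := (planar_relabel (boxPos_place (by decide)) d).2 hP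
  have hPM₂ : Planar (boxPos 1) M₂ := (planar_relabel (boxPos_place (by decide)) d').2 hP'
  have hS₁M : ∀ e ∈ S₁, e ∈ M₁ := fun e he =>
    Multiset.mem_of_le hle₁ (Multiset.mem_add.2 (Or.inl he))
  have hT₁M : ∀ e ∈ T₁, e ∈ M₁ := fun e he =>
    Multiset.mem_of_le hle₁ (Multiset.mem_add.2 (Or.inr he))
  have hS₂M : ∀ e ∈ S₂, e ∈ M₂ := fun e he =>
    Multiset.mem_of_le hle₂ (Multiset.mem_add.2 (Or.inl he))
  have hT₂M : ∀ e ∈ T₂, e ∈ M₂ := fun e he =>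
    Multiset.mem_of_le hle₂ (Multiset.mem_add.2 (Or.inr he))
  have hcM₁ : ∀ e ∈ M₁, IsCurve e := isCurve_relabel hd.1
  have hcM₂ : ∀ e ∈ M₂, IsCurve e := isCurve_relabel hd'.1
  have hcS₁ : ∀ e ∈ S₁, IsCurve e := fun e he => hcM₁ e (hS₁M e he)
  have hcS₂ : ∀ e ∈ S₂, IsCurve e := fun e he => hcM₂ e (hS₂M e he)
  have hlev₁ : ∀ x ∈ ends M₁, x.1 = 0 ∨ x.1 = 1 := fun x hx => mem_ends_place hx
  have hlev₂ : ∀ x ∈ ends M₂, x.1 = 1 ∨ x.1 = 2 := fun x hx => mem_ends_place hx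
  have hsub : ∀ {A B : Multiset (Strand (Fin 3 × Fin k))}, (∀ e ∈ A, e ∈ B) →
      ∀ x ∈ ends A, x ∈ ends B := fun h x hx => by
    obtain ⟨e, he, hx⟩ := mem_ends.1 hx
    exact mem_ends.2 ⟨e, h e he, hx⟩
  have hone₁ : ∀ x, (ends M₁).count x ≤ 1 := by
    intro x
    by_cases hx : x ∈ ends M₁
    · rw [hM₁, ends_relabel] at hx ⊢
      obtain ⟨v, _, rfl⟩ := Multiset.mem_map.1 hx
      rw [Multiset.count_map_eq_count' _ _ hi₁, hd.2]
    · rw [Multiset.count_eq_zero_of_notMem hx]; exact Nat.zero_le 1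
  have hone₂ : ∀ x, (ends M₂).count x ≤ 1 := by
    intro x
    by_cases hx : x ∈ ends M₂
    · rw [hM₂, ends_relabel] at hx ⊢
      obtain ⟨v, _, rfl⟩ := Multiset.mem_map.1 hx
      rw [Multiset.count_map_eq_count' _ _ hi₂, hd'.2]
    · rw [Multiset.count_eq_zero_of_notMem hx]; exact Nat.zero_le 1
  have hcount : ∀ {A B : Multiset (Strand (Fin 3 × Fin k))}, A ≤ B → ∀ x,
      (ends A).count x ≤ (ends B).count x := by
    intro A B h x
    obtain ⟨C, rfl⟩ := Multiset.le_iff_exists_add.1 h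
    rw [ends_add, Multiset.count_add]
    exact Nat.le_add_right _ _
  have hST₁ : ∀ x, (ends S₁).count x + (ends T₁).count x ≤ 1 := fun x => by
    have := (hcount hle₁ x).trans (hone₁ x)
    rwa [ends_add, Multiset.count_add] at this
  have hST₂ : ∀ x, (ends S₂).count x + (ends T₂).count x ≤ 1 := fun x => by
    have := (hcount hle₂ x).trans (hone₂ x)
    rwa [ends_add, Multiset.count_add] at this
  -- the two sides of a cut through the middle level agree on `S`
  have hmid : (ends S₁).filter (fun x => x.1 = 1) = (ends S₂).filter (fun x => x.1 = 1) := by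
    ext ⟨l, i⟩
    rw [Multiset.count_filter, Multiset.count_filter]
    split_ifs with h
    · simp only at h
      subst h
      have h1 := hST₁ (1, i)
      have h2 := hST₂ (1, i)
      have h3 := hS1 i
      rw [ends_add, Multiset.count_add] at h3
      omega
    · rfl
  have hcS : ∀ x ∈ ends (T₁ + T₂), x.1 = 1 → x ∉ ends S₁ ∧ x ∉ ends S₂ := by
    rintro ⟨l, i⟩ hx h
    simp only at h
    subst h
    have h1 := Multiset.one_le_count_iff_mem.2 hx
    have h2 := hST i
    rw [ends_add, Multiset.count_add] at h2
    rw [← Multiset.count_eq_zero, ← Multiset.count_eq_zero]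
    omega
  have hlt : ∀ i : Fin k, (i : ℕ) < k := fun i => i.2
  -- positions in a box are distinct
  have hpos : ∀ (s : Fin 3) (x y : Fin 3 × Fin k), boxPos s x = boxPos s y →
      (x.1 = s ↔ y.1 = s) ∧ x.2 = y.2 := by
    intro s x y h
    have h1 := hlt x.2
    have h2 := hlt y.2
    rw [Fin.ext_iff]
    unfold boxPos at h
    split_ifs at h with h3 h4 h4 <;> simp [h3, h4] <;> omega
  have hposne₁ : ∀ x ∈ ends S₁, ∀ y ∈ ends T₁, boxPos 0 x ≠ boxPos 0 y := by
    intro x hx y hy h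
    obtain ⟨h1, h2⟩ := hpos 0 x y h
    have h3 := hlev₁ x (hsub hS₁M x hx)
    have h4 := hlev₁ y (hsub hT₁M y hy)
    have h5 : x = y := by
      refine Prod.ext ?_ h2
      rcases h3 with h3 | h3 <;> rcases h4 with h4 | h4 <;> simp [h3, h4] at h1 ⊢
    subst h5
    have h6 := hST₁ x
    have h7 := Multiset.one_le_count_iff_mem.2 hx
    have h8 := Multiset.one_le_count_iff_mem.2 hy
    omega
  have hposne₂ : ∀ x ∈ ends S₂, ∀ y ∈ ends T₂, boxPos 1 x ≠ boxPos 1 y := by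
    intro x hx y hy h
    obtain ⟨h1, h2⟩ := hpos 1 x y h
    have h3 := hlev₂ x (hsub hS₂M x hx)
    have h4 := hlev₂ y (hsub hT₂M y hy)
    have h5 : x = y := by
      refine Prod.ext ?_ h2
      rcases h3 with h3 | h3 <;> rcases h4 with h4 | h4 <;> simp [h3, h4] at h1 ⊢
    subst h5
    have h6 := hST₂ x
    have h7 := Multiset.one_le_count_iff_mem.2 hx
    have h8 := Multiset.one_le_count_iff_mem.2 hy
    omega
  -- the parity function that is constant along `T`
  have hlink : ∀ y ∈ ends (T₁ + T₂), y.1 = 1 →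
      below (boxPos 0) (ends S₁) y % 2 = below (boxPos 1) (ends S₂) y % 2 := by
    intro y hy hy1
    obtain ⟨hn1, hn2⟩ := hcS y hy hy1
    have h1 : below (boxPos 1) (ends S₂) y =
        (ends S₁).countP fun x => x.1 = 1 ∧ x.2 < y.2 := by
      have e1 : (ends S₁).countP (fun x => x.1 = 1 ∧ x.2 < y.2) =
          ((ends S₁).filter fun x => x.1 = 1).countP fun x => x.2 < y.2 := by
        rw [Multiset.countP_filter]
        exact Multiset.countP_congr rfl fun x _ => by rw [and_comm]
      rw [e1, hmid, Multiset.countP_filter]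
      refine Multiset.countP_congr rfl fun x hx => propext ?_
      have h2 := hlt x.2
      have h3 := hlt y.2
      rw [Fin.lt_def]
      rcases hlev₂ x (hsub hS₂M x hx) with h | h
      · simp [boxPos, h, hy1]
      · simp [boxPos, h, hy1]; omega
    rw [h1]
    have h2 : below (boxPos 0) (ends S₁) y + (ends S₁).countP (fun x => x.1 = 1 ∧ x.2 < y.2)
        = Multiset.card (ends S₁) := by
      refine countP_add_countP _ _ fun x hx => ?_
      have h2 := hlt x.2
      have h3 := hlt y.2
      have h4 : x.1 = 1 → (x.2 : ℕ) ≠ y.2 := fun h h' =>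
        hn1 ((Prod.ext (h.trans hy1.symm) (Fin.ext h') : x = y) ▸ hx)
      rw [Fin.lt_def]
      rcases hlev₁ x (hsub hS₁M x hx) with h | h
      · simp [boxPos, h, hy1]; omega
      · have h5 := h4 h
        simp [boxPos, h, hy1]; omega
    have h3 := even_card_ends hcS₁
    omega
  set g : Fin 3 × Fin k → ℕ := fun y =>
    if y.1 = 0 then below (boxPos 0) (ends S₁) y % 2 else below (boxPos 1) (ends S₂) y % 2 with hgdef
  have hg₁ : ∀ y ∈ ends T₁, g y = below (boxPos 0) (ends S₁) y % 2 := by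
    intro y hy
    rcases hlev₁ y (hsub hT₁M y hy) with h | h
    · simp [hgdef, h]
    · rw [hlink y (by rw [ends_add]; exact Multiset.mem_add.2 (Or.inl hy)) h]
      simp [hgdef, h]
  have hg₂ : ∀ y ∈ ends T₂, g y = below (boxPos 1) (ends S₂) y % 2 := by
    intro y hy
    rcases hlev₂ y (hsub hT₂M y hy) with h | h
    · simp [hgdef, h]
    · simp [hgdef, h]
  have hconst : ∀ x ∈ ends (T₁ + T₂), ∀ y ∈ ends (T₁ + T₂), g x = g y := by
    refine hg g fun e he x hx y hy => ?_
    rcases Multiset.mem_add.1 he with he | he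
    · have hx' := mem_ends.2 ⟨e, he, hx⟩
      have hy' := mem_ends.2 ⟨e, he, hy⟩
      rw [hg₁ x hx', hg₁ y hy']
      exact below_ends hPM₁ (hT₁M e he) hx hy hS₁M hcS₁ fun z hz =>
        ⟨hposne₁ z hz x hx', hposne₁ z hz y hy'⟩
    · have hx' := mem_ends.2 ⟨e, he, hx⟩
      have hy' := mem_ends.2 ⟨e, he, hy⟩
      rw [hg₂ x hx', hg₂ y hy']
      exact below_ends hPM₂ (hT₂M e he) hx hy hS₂M hcS₂ fun z hz =>
        ⟨hposne₂ z hz x hx', hposne₂ z hz y hy'⟩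
  have hgs : ∀ S, (groupStrand (level k (1 : Fin 3)) S).1 = (ends S).filter fun x => x.1 ≠ 1 :=
    fun S => groupStrand_fst _ S _ fun x => not_congr mem_level
  have hout : ∀ y ∈ ends (T₁ + T₂), y.1 ≠ 1 →
      below (boxPos 0) (groupStrand (level k (1 : Fin 3)) (S₁ + S₂)).1 y % 2 = g y := by
    intro y hy hy1
    rw [hgs]
    have h3 := hlt y.2
    rw [ends_add, Multiset.filter_add, below_add, below, below, Multiset.countP_filter,
      Multiset.countP_filter]
    by_cases hy0 : y.1 = 0
    · have e1 : (ends S₁).countP (fun x => boxPos 0 x < boxPos 0 y ∧ x.1 ≠ 1) =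
          below (boxPos 0) (ends S₁) y := by
        refine Multiset.countP_congr rfl fun x hx => propext ?_
        have h2 := hlt x.2
        rcases hlev₁ x (hsub hS₁M x hx) with h | h
        · simp [boxPos, h, hy0]
        · simp [boxPos, h, hy0]; omega
      have e2 : (ends S₂).countP (fun x => boxPos 0 x < boxPos 0 y ∧ x.1 ≠ 1) =
          0 := by
        refine Multiset.countP_eq_zero.2 fun x hx => ?_
        have h2 := hlt x.2
        rcases hlev₂ x (hsub hS₂M x hx) with h | h
        · simp [h]
        · simp [boxPos, h, hy0]; omega
      rw [e1, e2, add_zero, hgdef]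
      simp [hy0]
    · have hy2 : y.1 = 2 := by
        have : ∀ l : Fin 3, l ≠ 1 → l ≠ 0 → l = 2 := by decide
        exact this _ hy1 hy0
      have e1 : (ends S₁).countP (fun x => boxPos 0 x < boxPos 0 y ∧ x.1 ≠ 1) +
          (ends S₁).countP (fun x => x.1 = 1) = Multiset.card (ends S₁) := by
        refine countP_add_countP _ _ fun x hx => ?_
        have h2 := hlt x.2
        rcases hlev₁ x (hsub hS₁M x hx) with h | h
        · simp [boxPos, h, hy2]; omega
        · simp [h]
      have e2 : (ends S₂).countP (fun x => boxPos 0 x < boxPos 0 y ∧ x.1 ≠ 1) +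
          (ends S₂).countP (fun x => x.1 = 1) = below (boxPos 1) (ends S₂) y := by
        rw [below, Multiset.countP_eq_countP_filter_add (ends S₂)
          (fun x => boxPos 1 x < boxPos 1 y) (fun x => ¬ x.1 = 1), Multiset.countP_filter,
          Multiset.countP_filter]
        congr 1
        · refine Multiset.countP_congr rfl fun x hx => propext ?_
          rcases hlev₂ x (hsub hS₂M x hx) with h | h
          · simp [h]
          · simp [boxPos, h, hy2]
        · refine Multiset.countP_congr rfl fun x hx => propext ?_
          have h2 := hlt x.2
          rcases hlev₂ x (hsub hS₂M x hx) with h | h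
          · simp [boxPos, h, hy2]; omega
          · simp [h]
      have e3 : (ends S₁).countP (fun x => x.1 = 1) = (ends S₂).countP (fun x => x.1 = 1) := by
        rw [Multiset.countP_eq_card_filter, hmid, Multiset.countP_eq_card_filter]
      have e4 := even_card_ends hcS₁
      have e5 : g y = below (boxPos 1) (ends S₂) y % 2 := by simp [hgdef, hy0]
      omega
  have hmemq : ∀ y ∈ (groupStrand (level k (1 : Fin 3)) (T₁ + T₂)).1,
      y ∈ ends (T₁ + T₂) ∧ y.1 ≠ 1 := by
    intro y hy
    rw [hgs] at hy
    exact Multiset.mem_filter.1 hy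
  refine ⟨fun y hy z hz => ?_, fun hE hE' hq2 y hy => ?_⟩
  · obtain ⟨hy, hy1⟩ := hmemq y hy
    obtain ⟨hz, hz1⟩ := hmemq z hz
    exact (hout y hy hy1).trans ((hconst y hy z hz).trans (hout z hz hz1).symm)
  · obtain ⟨hy, hy1⟩ := hmemq y hy
    refine (hout y hy hy1).trans ?_
    have hEM₁ : LeftExposed (boxPos 0) M₁ :=
      (leftExposed_relabel (boxPos_place (by decide)) d).2 hE
    have hEM₂ : LeftExposed (boxPos 1) M₂ :=
      (leftExposed_relabel (boxPos_place (by decide)) d').2 hE'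
    have hex : ∃ f ∈ T₁ + T₂, f.2 ≠ 0 := by
      by_contra hcon
      push Not at hcon
      refine hq2 ?_
      change (T₁ + T₂).sum.2 = 0
      have : ∀ A : Multiset (Strand (Fin 3 × Fin k)), (∀ f ∈ A, f.2 = 0) → A.sum.2 = 0 := by
        intro A
        induction A using Multiset.induction_on with
        | empty => exact fun _ => rfl
        | cons e A ih =>
          intro h
          rw [Multiset.sum_cons, Prod.snd_add, h e (Multiset.mem_cons_self _ _),
            ih fun f hf => h f (Multiset.mem_cons_of_mem hf)]
      exact this _ hcon
    obtain ⟨f, hf, hf2⟩ := hex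
    have hf0 : f.1 ≠ 0 := by
      intro h0
      rw [hT0 f hf h0] at hy
      simp [ends, h0] at hy
    obtain ⟨x, hx⟩ := Multiset.exists_mem_of_ne_zero hf0
    rw [hconst y hy x (mem_ends.2 ⟨f, hf, hx⟩)]
    rcases Multiset.mem_add.1 hf with hf | hf
    · have hx' := mem_ends.2 ⟨f, hf, hx⟩
      rw [hg₁ x hx']
      exact below_ends_exposed hEM₁ (hT₁M f hf) hf2 hx hS₁M hcS₁ fun z hz => hposne₁ z hz x hx'
    · have hx' := mem_ends.2 ⟨f, hf, hx⟩
      rw [hg₂ x hx']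
      exact below_ends_exposed hEM₂ (hT₂M f hf) hf2 hx hS₂M hcS₂ fun z hz => hposne₂ z hz x hx'

theorem isDiagram_concat {d d' : Multiset (Strand (Node k))} (hd : IsDiagram d)
    (hd' : IsDiagram d') : IsDiagram (concat d d') :=
  ⟨isCurve_concat hd.2 hd'.2 hd.1 hd'.1, count_concat hd.2 hd'.2⟩

theorem planar_concat {d d' : Multiset (Strand (Node k))} (hd : IsDiagram d)
    (hd' : IsDiagram d') (hP : Planar nodePos d) (hP' : Planar nodePos d') :
    Planar nodePos (concat d d') := by
  have hc := isCurve_relabel (f := (place 0 2 : Node k → Fin 3 × Fin k))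
    (isDiagram_concat hd hd').1
  rw [← planar_relabel (boxPos_place (k := k) (s := (0 : Fin 3)) (t := 2) (by decide))]
  rw [relabel_place_concat (m := (1 : Fin 3)) (by decide) (by decide) (by decide)] at hc ⊢
  intro p hp q hq a ha b hb c hc' x hx ⟨h1, h2, h3⟩
  rcases exists_pair (hc p hp) with h | ⟨u, v, h⟩
  · simp [h] at ha
  rw [h] at ha hc'
  simp only [Multiset.insert_eq_cons, Multiset.mem_cons, Multiset.mem_singleton] at ha hc'
  by_cases hpq : p = q
  · rw [← hpq, h] at hb hx
    simp only [Multiset.insert_eq_cons, Multiset.mem_cons, Multiset.mem_singleton] at hb hx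
    rcases ha with rfl | rfl <;> rcases hb with rfl | rfl <;> rcases hc' with rfl | rfl <;> omega
  · have := (concat_parity hd hd' hP hP' hp hq hpq).1 b hb x hx
    simp only [below, h, Multiset.insert_eq_cons, Multiset.countP_cons, ← Multiset.cons_zero,
      Multiset.countP_zero] at this
    rcases ha with rfl | rfl <;> rcases hc' with rfl | rfl <;> split_ifs at this <;> omega

theorem leftExposed_concat {d d' : Multiset (Strand (Node k))} (hd : IsDiagram d)
    (hd' : IsDiagram d') (hP : Planar nodePos d) (hP' : Planar nodePos d')
    (hE : LeftExposed nodePos d) (hE' : LeftExposed nodePos d') :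
    LeftExposed nodePos (concat d d') := by
  have hc := isCurve_relabel (f := (place 0 2 : Node k → Fin 3 × Fin k))
    (isDiagram_concat hd hd').1
  rw [← leftExposed_relabel (boxPos_place (k := k) (s := (0 : Fin 3)) (t := 2) (by decide))]
  rw [relabel_place_concat (m := (1 : Fin 3)) (by decide) (by decide) (by decide)] at hc ⊢
  intro q hq hq2 p hp a ha b hb c hc' ⟨h1, h2⟩
  rcases exists_pair (hc p hp) with h | ⟨u, v, h⟩
  · simp [h] at ha
  rw [h] at ha hc'
  simp only [Multiset.insert_eq_cons, Multiset.mem_cons, Multiset.mem_singleton] at ha hc'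
  by_cases hpq : p = q
  · rw [← hpq, h] at hb
    simp only [Multiset.insert_eq_cons, Multiset.mem_cons, Multiset.mem_singleton] at hb
    rcases ha with rfl | rfl <;> rcases hb with rfl | rfl <;> rcases hc' with rfl | rfl <;> omega
  · have := (concat_parity hd hd' hP hP' hp hq hpq).2 hE hE' hq2 b hb
    simp only [below, h, Multiset.insert_eq_cons, Multiset.countP_cons, ← Multiset.cons_zero,
      Multiset.countP_zero] at this
    rcases ha with rfl | rfl <;> rcases hc' with rfl | rfl <;> split_ifs at this <;> omega

theorem aValue_eq_zero {d : Multiset (Strand (Node k))} :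
    aValue d = 0 ↔ ∀ e ∈ d, e.1 ≠ 0 → ∃ v ∈ e.1, v.isLeft = false := by
  rw [aValue, Multiset.card_eq_zero, Multiset.filter_eq_nil]
  simp

theorem countP_ends_le (b : Bool) (S : Multiset (Strand (Node k))) (hc : ∀ e ∈ S, IsCurve e)
    (h : ∀ e ∈ S, e.1 ≠ 0 → ∃ v ∈ e.1, v.isLeft = !b) :
    (ends S).countP (fun v => v.isLeft = b) ≤ (ends S).countP (fun v => v.isLeft = !b) ∧
      ((∃ e ∈ S, e.1 ≠ 0 ∧ ∀ v ∈ e.1, v.isLeft = !b) →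
        (ends S).countP (fun v => v.isLeft = b) < (ends S).countP (fun v => v.isLeft = !b)) := by
  induction S using Multiset.induction_on with
  | empty => simp [ends]
  | cons e S ih =>
    obtain ⟨h1, h2⟩ := ih (fun e he => hc e (Multiset.mem_cons_of_mem he))
      fun e he => h e (Multiset.mem_cons_of_mem he)
    have h3 := h e (Multiset.mem_cons_self _ _)
    have h4 : e.1.countP (fun v => v.isLeft = b) ≤ e.1.countP (fun v => v.isLeft = !b) ∧
        ((e.1 ≠ 0 ∧ ∀ v ∈ e.1, v.isLeft = !b) →
          e.1.countP (fun v => v.isLeft = b) < e.1.countP (fun v => v.isLeft = !b)) := by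
      rcases exists_pair (hc e (Multiset.mem_cons_self _ _)) with h0 | ⟨x, y, h0⟩
      · simp [h0]
      · rw [h0] at h3 ⊢
        have h5 := h3 (by simp)
        simp only [Multiset.insert_eq_cons, Multiset.mem_cons,
          exists_eq_or_imp, exists_eq_left, forall_eq_or_imp, forall_eq,
          Multiset.countP_cons, ← Multiset.cons_zero, Multiset.countP_zero, Multiset.notMem_zero,
          or_false] at h5 ⊢
        revert h5
        cases b <;> rcases x with x | x <;> rcases y with y | y <;> simp
    rw [ends_cons, Multiset.countP_add, Multiset.countP_add]
    refine ⟨by omega, ?_⟩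
    rintro ⟨f, hf, hf'⟩
    rcases Multiset.mem_cons.1 hf with rfl | hf
    · have := h4.2 hf'; omega
    · have := h2 ⟨f, hf, hf'⟩; omega

theorem ends_eq_univ {d : Multiset (Strand (Node k))} (hd : IsDiagram d) :
    ends d = (Finset.univ : Finset (Node k)).val := by
  ext v
  rw [hd.2, Multiset.count_univ]

theorem arcs_symm {d : Multiset (Strand (Node k))} (hd : IsDiagram d) (b : Bool)
    (h : ∀ e ∈ d, e.1 ≠ 0 → ∃ v ∈ e.1, v.isLeft = !b) :
    ∀ e ∈ d, e.1 ≠ 0 → ∃ v ∈ e.1, v.isLeft = b := by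
  by_contra hcon
  push Not at hcon
  obtain ⟨e, he, he0, h1⟩ := hcon
  have h2 := (countP_ends_le b d hd.1 h).2 ⟨e, he, he0, fun v hv => by
    have := h1 v hv
    revert this
    cases v.isLeft <;> cases b <;> decide⟩
  have key : ∀ c : Bool, (ends d).countP (fun v => v.isLeft = c) = k := by
    intro c
    rw [ends_eq_univ hd, ← Finset.univ_disjSum_univ, Finset.val_disjSum, Multiset.disjSum,
      Multiset.countP_add, Multiset.countP_map, Multiset.countP_map]
    cases c <;> simp
  rw [key, key] at h2
  exact lt_irrefl _ h2

theorem bare_concat {d d' : Multiset (Strand (Node k))} (hd : IsDiagram d) (hd' : IsDiagram d')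
    (h : aValue d = 0 → ∀ e ∈ d, e.2 = 0) (h' : aValue d' = 0 → ∀ e ∈ d', e.2 = 0)
    (ha : aValue (concat d d') = 0) : ∀ e ∈ concat d d', e.2 = 0 := by
  have hN := aValue_eq_zero.1 ha
  have hS := arcs_symm (isDiagram_concat hd hd') true hN
  have h1 : aValue d = 0 := by
    rw [aValue_eq_zero]
    by_contra hcon
    push Not at hcon
    obtain ⟨e, he, he0, h1⟩ := hcon
    have h2 : (e.1.map (place (0 : Fin 3) 1), e.2) ∈ fuseList (level k 1) (stack d d') := by
      refine mem_fuseList (Multiset.mem_add.2 (Or.inl (Multiset.mem_map_of_mem _ he))) ?_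
      intro x hx
      obtain ⟨v, hv, rfl⟩ := Multiset.mem_map.1 hx
      have := h1 v hv
      rw [mem_level]
      rcases v with i | i <;> simp [place] at this ⊢
    obtain ⟨x, hx, hx'⟩ := hN _ (Multiset.mem_map_of_mem _ h2) (by simpa using he0)
    simp only [Multiset.map_map, Multiset.mem_map] at hx
    obtain ⟨v, hv, rfl⟩ := hx
    have := h1 v hv
    rcases v with i | i <;> simp [place, unplace] at this hx'
  have h2 : aValue d' = 0 := by
    rw [aValue_eq_zero]
    refine arcs_symm hd' false ?_
    by_contra hcon
    push Not at hcon
    obtain ⟨e, he, he0, h1⟩ := hcon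
    have h2 : (e.1.map (place (1 : Fin 3) 2), e.2) ∈ fuseList (level k 1) (stack d d') := by
      refine mem_fuseList (Multiset.mem_add.2 (Or.inr (Multiset.mem_map_of_mem _ he))) ?_
      intro x hx
      obtain ⟨v, hv, rfl⟩ := Multiset.mem_map.1 hx
      have := h1 v hv
      rw [mem_level]
      rcases v with i | i <;> simp [place] at this ⊢
    obtain ⟨x, hx, hx'⟩ := hS _ (Multiset.mem_map_of_mem _ h2) (by simpa using he0)
    simp only [Multiset.map_map, Multiset.mem_map] at hx
    obtain ⟨v, hv, rfl⟩ := hx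
    have := h1 v hv
    rcases v with i | i <;> simp [place, unplace] at this hx'
  intro e he
  obtain ⟨F, hF, hF', -⟩ :=
    exists_groups (level k (1 : Fin 3)) (nodup_level _) (stack d d')
  rw [concat, hF'] at he
  obtain ⟨p, hp, rfl⟩ := Multiset.mem_map.1 he
  obtain ⟨S, hS, rfl⟩ := Multiset.mem_map.1 hp
  obtain ⟨F', rfl⟩ := Multiset.exists_cons_of_mem hS
  have hz : ∀ f ∈ S, f.2 = 0 := by
    intro f hf
    have hf' : f ∈ stack d d' := by
      rw [← hF, Multiset.sum_cons]
      exact Multiset.mem_add.2 (Or.inl hf)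
    rcases Multiset.mem_add.1 hf' with hf' | hf'
    · obtain ⟨f', hf₀, rfl⟩ := Multiset.mem_map.1 hf'
      exact h h1 f' hf₀
    · obtain ⟨f', hf₀, rfl⟩ := Multiset.mem_map.1 hf'
      exact h' h2 f' hf₀
  change S.sum.2 = 0
  clear hp hF hF' he hS
  induction S using Multiset.induction_on with
  | empty => rfl
  | cons f S ih =>
    rw [Multiset.sum_cons, Prod.snd_add, hz f (Multiset.mem_cons_self _ _),
      ih fun f hf => hz f (Multiset.mem_cons_of_mem hf)]

theorem ends_straight (l : List (Fin k)) :
    ends (straight l) = (l.map Sum.inl : List (Node k)) + (l.map Sum.inr : List (Node k)) := by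
  induction l with
  | nil => rfl
  | cons i l ih =>
    have : straight (i :: l) = (({Sum.inl i, Sum.inr i} : Multiset (Node k)), 0) ::ₘ straight l :=
      rfl
    rw [this, ends_cons, ih, List.map_cons, List.map_cons, ← Multiset.cons_coe,
      ← Multiset.cons_coe, ← Multiset.singleton_add, ← Multiset.singleton_add (Sum.inr i),
      Multiset.insert_eq_cons, ← Multiset.singleton_add]
    exact add_add_add_comm _ _ _ _

theorem mem_straight {l : List (Fin k)} {e : Strand (Node k)} :
    e ∈ straight l ↔ ∃ i ∈ l, (({Sum.inl i, Sum.inr i} : Multiset (Node k)), 0) = e := by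
  simp [straight]

theorem count_straight {l : List (Fin k)} (hl : l.Nodup) (i : Fin k) :
    (ends (straight l)).count (Sum.inl i) = (if i ∈ l then 1 else 0) ∧
      (ends (straight l)).count (Sum.inr i) = (if i ∈ l then 1 else 0) := by
  rw [ends_straight]
  have h1 : ((l.map Sum.inl : List (Node k)) : Multiset (Node k)).Nodup :=
    Multiset.coe_nodup.2 (hl.map Sum.inl_injective)
  have h2 : ((l.map Sum.inr : List (Node k)) : Multiset (Node k)).Nodup :=
    Multiset.coe_nodup.2 (hl.map Sum.inr_injective)
  simp only [Multiset.count_add, Multiset.count_eq_of_nodup h1, Multiset.count_eq_of_nodup h2]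
  simp

theorem isDiagram_id : IsDiagram (idStrands k) := by
  refine ⟨fun e he => ?_, ?_⟩
  · obtain ⟨i, _, rfl⟩ := mem_straight.1 he
    exact Or.inr rfl
  · rintro (i | i)
    · rw [idStrands, (count_straight (List.nodup_finRange k) i).1, if_pos (List.mem_finRange i)]
    · rw [idStrands, (count_straight (List.nodup_finRange k) i).2, if_pos (List.mem_finRange i)]

theorem planar_straight (l : List (Fin k)) : Planar nodePos (straight l) := by
  intro e he f hf a ha b hb c hc x hx
  obtain ⟨i, _, rfl⟩ := mem_straight.1 he
  obtain ⟨j, _, rfl⟩ := mem_straight.1 hf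
  have hi := i.2
  have hj := j.2
  simp only [Multiset.insert_eq_cons, Multiset.mem_cons, Multiset.mem_singleton] at ha hb hc hx
  rcases ha with rfl | rfl <;> rcases hb with rfl | rfl <;> rcases hc with rfl | rfl <;>
    rcases hx with rfl | rfl <;> simp only [nodePos, Sum.elim_inl, Sum.elim_inr] <;> omega

theorem isDiagram_simple {i j : Fin k} (hij : i ≠ j) (m : ℕ) :
    IsDiagram (simpleStrands i j m) := by
  refine ⟨fun e he => ?_, ?_⟩
  · rw [simpleStrands, Multiset.mem_cons, Multiset.mem_cons] at he
    rcases he with rfl | rfl | he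
    · exact Or.inr rfl
    · exact Or.inr rfl
    · obtain ⟨i, _, rfl⟩ := mem_straight.1 he
      exact Or.inr rfl
  · have hn : ((List.finRange k).filter fun l => l ≠ i ∧ l ≠ j).Nodup :=
      (List.nodup_finRange k).filter _
    rintro (l | l) <;>
    · simp only [simpleStrands, ends_cons, Multiset.count_add, (count_straight hn l).1,
        (count_straight hn l).2, Multiset.insert_eq_cons, Multiset.count_cons,
        Multiset.count_singleton, List.mem_filter, List.mem_finRange, true_and, Sum.inl.injEq,
        Sum.inr.injEq, decide_eq_true_eq, reduceCtorEq, if_false]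
      by_cases h1 : l = i <;> by_cases h2 : l = j
      · exact absurd (h1.symm.trans h2) hij
      · simp [h1, hij]
      · simp [h2, hij.symm]
      · simp [h1, h2]

theorem planar_simple {i j : Fin k} (hij : (j : ℕ) = i + 1) (m : ℕ) :
    Planar nodePos (simpleStrands i j m) := by
  intro e he f hf a ha b hb c hc x hx
  have hi := i.2
  have hj := j.2
  have hmem : ∀ {e : Strand (Node k)}, e ∈ simpleStrands i j m →
      (e.1 = {Sum.inl i, Sum.inl j} ∨ e.1 = {Sum.inr i, Sum.inr j} ∨
        ∃ l : Fin k, (l : ℕ) ≠ i ∧ (l : ℕ) ≠ j ∧ e.1 = {Sum.inl l, Sum.inr l}) := by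
    intro e he
    rw [simpleStrands, Multiset.mem_cons, Multiset.mem_cons] at he
    rcases he with rfl | rfl | he
    · exact Or.inl rfl
    · exact Or.inr (Or.inl rfl)
    · obtain ⟨l, hl, rfl⟩ := mem_straight.1 he
      simp only [List.mem_filter, List.mem_finRange, true_and, decide_eq_true_eq, ne_eq,
        Fin.ext_iff] at hl
      exact Or.inr (Or.inr ⟨l, hl.1, hl.2, rfl⟩)
  rcases hmem he with h1 | h1 | ⟨l, hl1, hl2, h1⟩ <;>
  rcases hmem hf with h2 | h2 | ⟨l', hl1', hl2', h2⟩ <;>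
  rw [h1] at ha hc <;> rw [h2] at hb hx <;>
  simp only [Multiset.insert_eq_cons, Multiset.mem_cons, Multiset.mem_singleton] at ha hb hc hx <;>
  rcases ha with rfl | rfl <;> rcases hb with rfl | rfl <;> rcases hc with rfl | rfl <;>
    rcases hx with rfl | rfl <;> simp only [nodePos, Sum.elim_inl, Sum.elim_inr] <;> omega

theorem leftExposed_simple {i j : Fin k} (hij : (j : ℕ) = i + 1) (m : ℕ) (hm : m = 0 ∨ (i : ℕ) = 0) :
    LeftExposed nodePos (simpleStrands i j m) := by
  intro e he he2 f hf a ha b hb c hc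
  have hi := i.2
  have hj := j.2
  rw [simpleStrands, Multiset.mem_cons, Multiset.mem_cons] at he hf
  have hb' : (i : ℕ) = 0 ∧ (b = Sum.inl i ∨ b = Sum.inl j ∨ b = Sum.inr i ∨ b = Sum.inr j) := by
    rcases he with rfl | rfl | he
    · simp only [Multiset.insert_eq_cons, Multiset.mem_cons, Multiset.mem_singleton] at hb
      exact ⟨hm.resolve_left he2, by tauto⟩
    · simp only [Multiset.insert_eq_cons, Multiset.mem_cons, Multiset.mem_singleton] at hb
      exact ⟨hm.resolve_left he2, by tauto⟩
    · obtain ⟨l, _, rfl⟩ := mem_straight.1 he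
      exact absurd rfl he2
  obtain ⟨hi0, hb'⟩ := hb'
  rcases hf with rfl | rfl | hf
  · simp only [Multiset.insert_eq_cons, Multiset.mem_cons, Multiset.mem_singleton] at ha hc
    rcases ha with rfl | rfl <;> rcases hc with rfl | rfl <;> rcases hb' with rfl | rfl | rfl | rfl <;>
      simp only [nodePos, Sum.elim_inl, Sum.elim_inr] <;> omega
  · simp only [Multiset.insert_eq_cons, Multiset.mem_cons, Multiset.mem_singleton] at ha hc
    rcases ha with rfl | rfl <;> rcases hc with rfl | rfl <;> rcases hb' with rfl | rfl | rfl | rfl <;>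
      simp only [nodePos, Sum.elim_inl, Sum.elim_inr] <;> omega
  · obtain ⟨l, hl, rfl⟩ := mem_straight.1 hf
    simp only [List.mem_filter, List.mem_finRange, true_and, decide_eq_true_eq, ne_eq,
      Fin.ext_iff] at hl
    have hl' := l.2
    simp only [Multiset.insert_eq_cons, Multiset.mem_cons, Multiset.mem_singleton] at ha hc
    rcases ha with rfl | rfl <;> rcases hc with rfl | rfl <;> rcases hb' with rfl | rfl | rfl | rfl <;>
      simp only [nodePos, Sum.elim_inl, Sum.elim_inr] <;> omega

end Concat

/-- L-decorated pseudo `k`-diagrams. -/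
@[ext]
structure LDiagram (k : ℕ) where
  /-- the curves -/
  strands : Multiset (Strand (Node k))
  isDiagram : IsDiagram strands
  planar : Planar nodePos strands
  /-- A diagram all of whose edges propagate carries no decorations. -/
  bare : aValue strands = 0 → ∀ e ∈ strands, e.2 = 0
  leftExposed : LeftExposed nodePos strands

/-- The product `d * d'` is concatenation with `d` on top of `d'`. -/
instance (k : ℕ) : Monoid (LDiagram k) where
  mul d d' :=
    { strands := concat d.strands d'.strands
      isDiagram := isDiagram_concat d.isDiagram d'.isDiagram
      planar := planar_concat d.isDiagram d'.isDiagram d.planar d'.planar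
      bare := bare_concat d.isDiagram d'.isDiagram d.bare d'.bare
      leftExposed := leftExposed_concat d.isDiagram d'.isDiagram d.planar d'.planar
        d.leftExposed d'.leftExposed }
  one :=
    { strands := idStrands k
      isDiagram := isDiagram_id
      planar := planar_straight _
      bare := fun _ e he => by
        obtain ⟨i, _, rfl⟩ := mem_straight.1 he
        rfl
      leftExposed := fun e he he2 => by
        obtain ⟨i, _, rfl⟩ := mem_straight.1 he
        exact absurd rfl he2 }
  mul_assoc a b c := LDiagram.ext (concat_assoc a.strands b.strands c.strands)
  one_mul d := LDiagram.ext (id_concat d.strands d.isDiagram.2)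
  mul_one d := LDiagram.ext (concat_id d.strands d.isDiagram.2)

/-- The diagram that joins the nodes `i` and `i + 1` (counted from `0`) in both faces by edges
with `m` decorations, with vertical edges elsewhere. Decorations are possible only for `i = 0`. -/
def simpleDiagram {n : ℕ} (i : ℕ) (hi : i + 1 < n) (m : ℕ) (hm : m = 0 ∨ i = 0) : LDiagram n where
  strands := simpleStrands ⟨i, by omega⟩ ⟨i + 1, hi⟩ m
  isDiagram := isDiagram_simple (by simp) m
  planar := planar_simple rfl m
  bare := fun h => by
    rw [aValue_eq_zero] at h
    obtain ⟨v, hv, hv'⟩ := h _ (Multiset.mem_cons_self _ _) (by simp)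
    simp only [Multiset.insert_eq_cons, Multiset.mem_cons, Multiset.mem_singleton] at hv
    rcases hv with rfl | rfl <;> simp at hv'
  leftExposed := leftExposed_simple rfl m hm

/-- The free `ℤ[δ]`-module on the L-decorated pseudo `k`-diagrams, with concatenation as the product;
the variable `X` of the polynomial ring is `δ`. -/
abbrev LDiagramAlgebra (k : ℕ) := MonoidAlgebra ℤ[X] (LDiagram k)

/-- The local relations, read as replacements of a diagram: an undecorated loop is replaced by `δ`;
two decorations on the same curve cancel; a curve loses a decoration in the presence of a
decorated loop. -/
inductive DiagramRel {k : ℕ} : LDiagram k → LDiagramAlgebra k → Prop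
  | loop (d d' : LDiagram k) (h : d.strands = (0, 0) ::ₘ d'.strands) :
      DiagramRel d ((X : ℤ[X]) • MonoidAlgebra.of ℤ[X] (LDiagram k) d')
  | cancel (d d' : LDiagram k) (e : Multiset (Node k)) (m : ℕ) (R : Multiset (Strand (Node k)))
      (h : d.strands = (e, m + 2) ::ₘ R) (h' : d'.strands = (e, m) ::ₘ R) :
      DiagramRel d (MonoidAlgebra.of ℤ[X] (LDiagram k) d')
  | absorb (d d' : LDiagram k) (e : Multiset (Node k)) (m : ℕ) (R : Multiset (Strand (Node k)))
      (h : d.strands = (0, 1) ::ₘ (e, m + 1) ::ₘ R) (h' : d'.strands = (0, 1) ::ₘ (e, m) ::ₘ R) :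
      DiagramRel d (MonoidAlgebra.of ℤ[X] (LDiagram k) d')

/-- The relations as relations between elements of the diagram algebra. -/
def AlgebraRel (k : ℕ) (x y : LDiagramAlgebra k) : Prop :=
  ∃ d : LDiagram k, x = MonoidAlgebra.of ℤ[X] (LDiagram k) d ∧ DiagramRel d y

/-- The quotient of the diagram algebra by the local relations. -/
abbrev HatAlgebra (k : ℕ) := RingQuot (AlgebraRel k)

/-- The image of a diagram in the quotient by the local relations. -/
noncomputable def diagramClass {k : ℕ} (d : LDiagram k) : HatAlgebra k :=
  RingQuot.mkAlgHom ℤ[X] (AlgebraRel k) (MonoidAlgebra.of ℤ[X] (LDiagram k) d)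

/-- The diagram algebra `DTL(D_n)`: the unital subalgebra generated by the simple diagrams
`d_1, …, d_{n-1}` (without decorations) and the decorated one, which joins the first two nodes in
both faces by edges with one decoration. -/
noncomputable def DTL (n : ℕ) : Subalgebra ℤ[X] (HatAlgebra n) :=
  Algebra.adjoin ℤ[X]
    {x | (∃ (i : ℕ) (hi : i + 1 < n), x = diagramClass (simpleDiagram i hi 0 (Or.inl rfl))) ∨
      ∃ h : 0 + 1 < n, x = diagramClass (simpleDiagram 0 h 1 (Or.inr rfl))}

/-- The relation that a decorated loop is zero: an element of `DTL(D_n)` that is represented by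
a diagram with a decorated loop is set to zero. -/
def LoopRel (n : ℕ) (x y : DTL n) : Prop :=
  y = 0 ∧ ∃ d : LDiagram n, ((0, 1) : Strand (Node n)) ∈ d.strands ∧ (x : HatAlgebra n) = diagramClass d

/-- The loop-free diagram algebra `LFD(D_n)`. -/
abbrev LFD (n : ℕ) := RingQuot (LoopRel n)

/-- No local relation applies. -/
def IsIrreducible {k : ℕ} (d : LDiagram k) : Prop := ∀ y, ¬ DiagramRel d y

/-- `D`-admissible diagrams of type II: irreducible, without loops, and with an even total number of
decorations. -/
structure IsTypeII {k : ℕ} (d : LDiagram k) : Prop where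
  irreducible : IsIrreducible d
  loopless : ∀ e ∈ d.strands, e.1 ≠ 0
  even : Even (d.strands.map Prod.snd).sum

end DecTL

/-!
Linear independence. Discarding the loops of a diagram and counting decorations modulo two turns the
stacking of diagrams into an action of the free diagram algebra on the free module on the reduced
diagrams, if each undecorated loop contributes `δ` and each decorated loop `0`. Relations (1)–(3)
and the vanishing of decorated loops hold for this action, and the orbit map of the identity diagram
sends the class of a reduced diagram to the corresponding basis vector.

Spanning. Concatenation adds up decorations and the generators have an even number of them, so every
product of generators is a diagram with an even number of decorations; the relations reduce it to a
multiple of a diagram of type II, unless a decorated loop appears, which is zero in `LFD`.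

Membership. A diagram of type II other than the identity is a product of a simple diagram and a
diagram of type II with smaller total horizontal length, up to cancelling two decorations. Indeed,
the northern edge that is the first to close, from left to right, joins neighbours `i` and `i + 1`,
and the simple diagram at `i` is split off by exchanging its ends with those of an adjacent edge.
-/

namespace DecTL

section Reduction

variable {V W : Type*}

/-- The curves of `M` with their decorations counted modulo two. -/
def parity (M : Multiset (Strand V)) : Multiset (Strand V) := M.map fun e => (e.1, e.2 % 2)

/-- Curves to which no local relation applies: edges with at most one decoration. -/
def IsReduced (M : Multiset (Strand V)) : Prop := ∀ e ∈ M, e.1 ≠ 0 ∧ e.2 < 2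

theorem parity_add (M N : Multiset (Strand V)) : parity (M + N) = parity M + parity N :=
  Multiset.map_add _ _ _

theorem parity_relabel (f : V → W) (M : Multiset (Strand V)) :
    parity (relabel f M) = relabel f (parity M) := by
  simp [parity, relabel]

theorem parity_parity (M : Multiset (Strand V)) : parity (parity M) = parity M := by
  simp [parity]

theorem parity_eq_self {M : Multiset (Strand V)} (h : ∀ e ∈ M, e.2 < 2) : parity M = M := by
  conv_rhs => rw [← Multiset.map_id M]
  exact Multiset.map_congr rfl fun e he => Prod.ext rfl (Nat.mod_eq_of_lt (h e he))

theorem ends_parity (M : Multiset (Strand V)) : ends (parity M) = ends M := by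
  simp [parity, ends]

theorem filter_parity (p : Multiset V → Prop) [DecidablePred p] (M : Multiset (Strand V)) :
    (parity M).filter (fun e => p e.1) = parity (M.filter fun e => p e.1) := by
  rw [parity, Multiset.filter_map]
  rfl

theorem snd_sum (M : Multiset (Strand V)) : M.sum.2 = (M.map Prod.snd).sum :=
  map_multiset_sum (AddMonoidHom.snd (Multiset V) ℕ) M

theorem snd_sum_parity_mod_two (M : Multiset (Strand V)) : (parity M).sum.2 % 2 = M.sum.2 % 2 := by
  rw [snd_sum, snd_sum, Multiset.sum_nat_mod, Multiset.sum_nat_mod (M.map Prod.snd)]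
  simp [parity]

theorem ends_eq_zero {M : Multiset (Strand V)} (h : ∀ e ∈ M, e.1 = 0) : ends M = 0 :=
  Multiset.sum_eq_zero fun _ hx => by
    obtain ⟨e, he, rfl⟩ := Multiset.mem_map.1 hx
    exact h e he

variable [DecidableEq V]

theorem parity_fuse_parity (v : V) (M : Multiset (Strand V)) :
    parity (fuse v (parity M)) = parity (fuse v M) := by
  rw [fuse, fuse, filter_parity (fun s => v ∈ s), filter_parity (fun s => v ∉ s), ← ends_eq,
    ends_parity, ← ends_eq]
  simp only [parity, Multiset.map_cons, Multiset.map_map, Function.comp_def, Nat.mod_mod]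
  congr 2
  exact snd_sum_parity_mod_two _

theorem parity_fuseList_parity (l : List V) (M : Multiset (Strand V)) :
    parity (fuseList l (parity M)) = parity (fuseList l M) := by
  induction l with
  | nil => exact parity_parity M
  | cons v l ih =>
    change parity (fuse v (fuseList l (parity M))) = parity (fuse v (fuseList l M))
    rw [← parity_fuse_parity, ih, parity_fuse_parity]

theorem snd_sum_fuse (v : V) (M : Multiset (Strand V)) : (fuse v M).sum.2 = M.sum.2 := by
  conv_rhs => rw [← Multiset.filter_add_not (fun e => v ∈ e.1) M]
  simp [fuse]

theorem snd_sum_fuseList (l : List V) (M : Multiset (Strand V)) :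
    (fuseList l M).sum.2 = M.sum.2 := by
  induction l with
  | nil => rfl
  | cons v l ih => exact (snd_sum_fuse v _).trans ih

/-- The loops among the curves of `M`. -/
def loops (M : Multiset (Strand V)) : Multiset (Strand V) := M.filter fun e => e.1 = 0

/-- The edges among the curves of `M`. -/
def edges (M : Multiset (Strand V)) : Multiset (Strand V) := M.filter fun e => e.1 ≠ 0

/-- The result of removing all loops and cancelling decorations. -/
def reduce (M : Multiset (Strand V)) : Multiset (Strand V) := parity (edges M)

/-- The factor by which `reduce M` has to be multiplied: `δ` for each loop with an even number of
decorations and `0` for each loop with an odd number. -/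
noncomputable def loopValue (M : Multiset (Strand V)) : ℤ[X] :=
  (M.map fun e => if e.1 = 0 then (if e.2 % 2 = 0 then X else 0) else (1 : ℤ[X])).prod

theorem edges_add_loops (M : Multiset (Strand V)) : edges M + loops M = M := by
  rw [add_comm]
  exact Multiset.filter_add_not _ M

theorem fst_eq_zero_of_mem_loops {M : Multiset (Strand V)} : ∀ e ∈ loops M, e.1 = 0 :=
  fun _ he => (Multiset.mem_filter.1 he).2

theorem edges_eq_self {M : Multiset (Strand V)} (h : ∀ e ∈ M, e.1 ≠ 0) : edges M = M :=
  Multiset.filter_eq_self.2 h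

theorem edges_eq_zero {M : Multiset (Strand V)} (h : ∀ e ∈ M, e.1 = 0) : edges M = 0 :=
  Multiset.filter_eq_nil.2 fun e he => not_not.2 (h e he)

theorem ends_edges (M : Multiset (Strand V)) : ends (edges M) = ends M := by
  conv_rhs => rw [← edges_add_loops M, ends_add, ends_eq_zero fst_eq_zero_of_mem_loops, add_zero]

theorem isReduced_reduce (M : Multiset (Strand V)) : IsReduced (reduce M) := by
  intro e he
  obtain ⟨e', he', rfl⟩ := Multiset.mem_map.1 he
  exact ⟨(Multiset.mem_filter.1 he').2, Nat.mod_lt _ two_pos⟩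

theorem IsReduced.reduce_eq {M : Multiset (Strand V)} (h : IsReduced M) : reduce M = M := by
  rw [reduce, edges_eq_self fun e he => (h e he).1, parity_eq_self fun e he => (h e he).2]

theorem reduce_add (M N : Multiset (Strand V)) : reduce (M + N) = reduce M + reduce N := by
  simp [reduce, edges, parity_add]

theorem reduce_parity (M : Multiset (Strand V)) : reduce (parity M) = reduce M :=
  (congrArg parity (filter_parity (· ≠ 0) M)).trans (parity_parity (edges M))

theorem reduce_eq_zero {M : Multiset (Strand V)} (h : ∀ e ∈ M, e.1 = 0) : reduce M = 0 := by
  rw [reduce, edges_eq_zero h]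
  rfl

theorem loopValue_add (M N : Multiset (Strand V)) :
    loopValue (M + N) = loopValue M * loopValue N := by
  simp [loopValue]

theorem loopValue_parity (M : Multiset (Strand V)) : loopValue (parity M) = loopValue M := by
  simp [loopValue, parity]

theorem loopValue_eq_one {M : Multiset (Strand V)} (h : ∀ e ∈ M, e.1 ≠ 0) : loopValue M = 1 := by
  refine Multiset.prod_eq_one fun x hx => ?_
  obtain ⟨e, he, rfl⟩ := Multiset.mem_map.1 hx
  rw [if_neg (h e he)]

theorem loopValue_eq_zero {M : Multiset (Strand V)} (h : (0, 1) ∈ M) : loopValue M = 0 :=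
  Multiset.prod_eq_zero (Multiset.mem_map.2 ⟨(0, 1), h, by simp⟩)

theorem loopValue_loops (M : Multiset (Strand V)) : loopValue (loops M) = loopValue M := by
  have hedges : loopValue (edges M) = 1 := loopValue_eq_one fun _ he => (Multiset.mem_filter.1 he).2
  conv_rhs => rw [← edges_add_loops M, loopValue_add, hedges, one_mul]

end Reduction

section Concat

variable {k : ℕ}

theorem parity_concat_parity (d d' : Multiset (Strand (Node k))) :
    parity (concat (parity d) (parity d')) = parity (concat d d') := by
  have hstack : stack (parity d) (parity d') = parity (stack d d') := by
    simp only [stack, parity_add, parity_relabel]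
  rw [concat, concat, parity_relabel, parity_relabel, hstack, parity_fuseList_parity]

theorem snd_sum_concat (d d' : Multiset (Strand (Node k))) :
    (concat d d').sum.2 = d.sum.2 + d'.sum.2 := by
  simp only [concat, stack, sum_relabel, snd_sum_fuseList, Multiset.sum_add, Prod.snd_add]

theorem concat_add_loops (d d' : Multiset (Strand (Node k))) {N N' : Multiset (Strand (Node k))}
    (h : ∀ e ∈ N, e.1 = 0) (h' : ∀ e ∈ N', e.1 = 0) :
    concat (d + N) (d' + N') = concat d d' + (N + N') := by
  have hends : ends (N + N') = 0 := by rw [ends_add, ends_eq_zero h, ends_eq_zero h', add_zero]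
  have hrelabel {P : Multiset (Strand (Node k))} (hP : ∀ e ∈ P, e.1 = 0) (s t : Fin 3) :
      relabel (place s t) P = relabel (place 0 2) P :=
    relabel_congr fun v hv => by simp [ends_eq_zero hP] at hv
  have hstack : stack (d + N) (d' + N') = stack d d' + relabel (place 0 2) (N + N') := by
    simp only [stack, relabel_add, hrelabel h, hrelabel h']
    abel
  have hid : relabel unplace (relabel (place (0 : Fin 3) 2) (N + N')) = N + N' := by
    rw [relabel_relabel]
    conv_rhs => rw [← relabel_id (N + N')]
    exact relabel_congr fun v hv => by simp [hends] at hv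
  rw [concat, hstack, fuseList_add_of_notMem _ fun v _ => by simp [ends_relabel, hends],
    relabel_add, hid, concat]

theorem parity_concat (d d' : Multiset (Strand (Node k))) :
    parity (concat d d') =
      parity (concat (reduce d) (reduce d')) + parity (loops d + loops d') := by
  rw [reduce, reduce, parity_concat_parity, ← parity_add,
    ← concat_add_loops _ _ fst_eq_zero_of_mem_loops fst_eq_zero_of_mem_loops, edges_add_loops,
    edges_add_loops]

theorem reduce_concat (d d' : Multiset (Strand (Node k))) :
    reduce (concat d d') = reduce (concat (reduce d) (reduce d')) := by
  have hloops : ∀ e ∈ loops d + loops d', e.1 = 0 := fun e he =>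
    (Multiset.mem_add.1 he).elim (fst_eq_zero_of_mem_loops e) (fst_eq_zero_of_mem_loops e)
  rw [← reduce_parity, parity_concat, reduce_add, reduce_parity, reduce_parity,
    reduce_eq_zero hloops, add_zero]

theorem loopValue_concat (d d' : Multiset (Strand (Node k))) :
    loopValue (concat d d') =
      loopValue d * loopValue d' * loopValue (concat (reduce d) (reduce d')) := by
  rw [← loopValue_parity, parity_concat, loopValue_add, loopValue_parity, loopValue_parity,
    loopValue_add, loopValue_loops, loopValue_loops, mul_comm]

end Concat

section Reduced

variable {k : ℕ}

theorem IsDiagram.eq_of_mem {M : Multiset (Strand (Node k))} (hM : IsDiagram M)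
    {e f : Strand (Node k)} (he : e ∈ M) (hf : f ∈ M) {v : Node k} (hve : v ∈ e.1)
    (hvf : v ∈ f.1) : e = f := by
  obtain ⟨R, rfl⟩ := Multiset.exists_cons_of_mem he
  refine (Multiset.mem_cons.1 hf).elim Eq.symm fun hfR => absurd (hM.2 v) ?_
  have hve : 1 ≤ e.1.count v := Multiset.one_le_count_iff_mem.2 hve
  have hvR : 1 ≤ (ends R).count v := Multiset.one_le_count_iff_mem.2 (mem_ends.2 ⟨f, hfR, hvf⟩)
  rw [ends_cons, Multiset.count_add]
  omega

/-- The diagram with curves `M`, obtained from `d` by removing loops and decorations. -/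
def LDiagram.simplify (d : LDiagram k) (M : Multiset (Strand (Node k)))
    (hM : ∀ e ∈ M, ∃ e' ∈ d.strands, e.1 = e'.1 ∧ (e.2 ≠ 0 → e'.2 ≠ 0))
    (hends : ends M = ends d.strands) : LDiagram k where
  strands := M
  isDiagram := by
    refine ⟨fun e he => ?_, fun v => hends ▸ d.isDiagram.2 v⟩
    obtain ⟨e', he', h, -⟩ := hM e he
    rw [IsCurve, h]
    exact d.isDiagram.1 e' he'
  planar := by
    intro e he f hf
    obtain ⟨e', he', h, -⟩ := hM e he
    obtain ⟨f', hf', h', -⟩ := hM f hf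
    rw [h, h']
    exact d.planar e' he' f' hf'
  bare := by
    intro hbare e he
    obtain ⟨e', he', -, h⟩ := hM e he
    refine not_imp_not.1 h (d.bare (aValue_eq_zero.2 fun f hf hf0 => ?_) e' he')
    obtain ⟨v, hv⟩ := Multiset.exists_mem_of_ne_zero hf0
    obtain ⟨g, hg, hvg⟩ := mem_ends.1 (hends ▸ mem_ends.2 ⟨f, hf, hv⟩ : v ∈ ends M)
    obtain ⟨g', hg', hgg', -⟩ := hM g hg
    obtain rfl := d.isDiagram.eq_of_mem hf hg' hv (hgg' ▸ hvg)
    rw [← hgg'] at hf0 ⊢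
    exact aValue_eq_zero.1 hbare g hg hf0
  leftExposed := by
    intro e he he2 f hf
    obtain ⟨e', he', h, h0⟩ := hM e he
    obtain ⟨f', hf', h', -⟩ := hM f hf
    rw [h, h']
    exact d.leftExposed e' he' (h0 he2) f' hf'

/-- The diagram without loops whose edges are those of `d`, with decorations counted modulo two. -/
def LDiagram.reduced (d : LDiagram k) : LDiagram k :=
  d.simplify (reduce d.strands)
    (fun e he => by
      obtain ⟨e', he', rfl⟩ := Multiset.mem_map.1 he
      exact ⟨e', (Multiset.mem_filter.1 he').1, rfl, fun h h' => h (by simp [h'])⟩)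
    (by rw [reduce, ends_parity, ends_edges])

theorem LDiagram.reduced_eq {d : LDiagram k} (hd : IsReduced d.strands) : d.reduced = d :=
  LDiagram.ext hd.reduce_eq

theorem LDiagram.reduced_mul (d d' : LDiagram k) :
    (d * d').reduced = (d.reduced * d'.reduced).reduced :=
  LDiagram.ext (reduce_concat d.strands d'.strands)

theorem loopValue_mul (d d' : LDiagram k) :
    loopValue (d * d').strands =
      loopValue d.strands * loopValue d'.strands * loopValue (d.reduced * d'.reduced).strands :=
  loopValue_concat d.strands d'.strands

theorem LDiagram.isReduced_reduced (d : LDiagram k) : IsReduced d.reduced.strands :=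
  isReduced_reduce d.strands

theorem LDiagram.loopValue_reduced (d : LDiagram k) : loopValue d.reduced.strands = 1 :=
  loopValue_eq_one fun e he => (d.isReduced_reduced e he).1

end Reduced

section Representation

variable {k : ℕ}

/-- The reduced diagrams, which will index a basis of the module on which the diagram algebra acts;
compared with the diagrams of type II, the number of decorations may be odd. -/
abbrev ReducedDiagram (k : ℕ) := {d : LDiagram k // IsReduced d.strands}

/-- The value of `d` in the free module on the reduced diagrams. -/
noncomputable def normalForm (d : LDiagram k) : ReducedDiagram k →₀ ℤ[X] :=
  Finsupp.single ⟨d.reduced, d.isReduced_reduced⟩ (loopValue d.strands)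

theorem normalForm_eq_smul {d d' : LDiagram k} {c : ℤ[X]} (hreduced : d.reduced = d'.reduced)
    (hvalue : loopValue d.strands = c * loopValue d'.strands) :
    normalForm d = c • normalForm d' := by
  rw [normalForm, normalForm, Finsupp.smul_single, smul_eq_mul, hvalue]
  congr 1
  exact Subtype.ext hreduced

theorem normalForm_of_isReduced {d : LDiagram k} (hd : IsReduced d.strands) :
    normalForm d = Finsupp.single ⟨d, hd⟩ 1 := by
  rw [normalForm, loopValue_eq_one fun e he => (hd e he).1]
  congr 1
  exact Subtype.ext (LDiagram.reduced_eq hd)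

theorem normalForm_mul (d d' : LDiagram k) :
    normalForm (d * d') =
      (loopValue d.strands * loopValue d'.strands) • normalForm (d.reduced * d'.reduced) :=
  normalForm_eq_smul (LDiagram.reduced_mul d d') (loopValue_mul d d')

theorem normalForm_mul_eq_smul_reduced (a d : LDiagram k) :
    normalForm (a * d) = loopValue d.strands • normalForm (a * d.reduced) := by
  rw [normalForm_mul, normalForm_mul a, LDiagram.reduced_eq d.isReduced_reduced,
    d.loopValue_reduced, mul_one, mul_comm, mul_smul]

/-- The action of the diagram `a` on the free module on the reduced diagrams: stack, then
reduce. -/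
noncomputable def leftMul (a : LDiagram k) : Module.End ℤ[X] (ReducedDiagram k →₀ ℤ[X]) :=
  Finsupp.linearCombination ℤ[X] fun d => normalForm (a * d.1)

theorem leftMul_normalForm (a d : LDiagram k) : leftMul a (normalForm d) = normalForm (a * d) := by
  rw [normalForm_mul_eq_smul_reduced, normalForm, leftMul, Finsupp.linearCombination_single]

theorem end_ext {f g : Module.End ℤ[X] (ReducedDiagram k →₀ ℤ[X])}
    (h : ∀ d : LDiagram k, IsReduced d.strands → f (normalForm d) = g (normalForm d)) : f = g :=
  Finsupp.lhom_ext' fun d => LinearMap.ext_ring <| by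
    simpa [normalForm_of_isReduced d.2] using h _ d.2

theorem leftMul_eq_smul {a b : LDiagram k} {c : ℤ[X]} (hreduced : a.reduced = b.reduced)
    (hvalue : loopValue a.strands = c * loopValue b.strands) : leftMul a = c • leftMul b :=
  end_ext fun d _ => by
    rw [LinearMap.smul_apply, leftMul_normalForm, leftMul_normalForm, normalForm_mul,
      normalForm_mul b, hreduced, hvalue, smul_smul, mul_assoc]

theorem leftMul_eq_zero {a : LDiagram k} (ha : (0, 1) ∈ a.strands) : leftMul a = 0 := by
  rw [leftMul_eq_smul (c := 0) (b := a) rfl (by rw [loopValue_eq_zero ha, zero_mul]), zero_smul]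

/-- The representation of the diagram algebra on the free module on the reduced diagrams. -/
noncomputable def representation (k : ℕ) :
    LDiagramAlgebra k →ₐ[ℤ[X]] Module.End ℤ[X] (ReducedDiagram k →₀ ℤ[X]) :=
  MonoidAlgebra.lift ℤ[X] _ (LDiagram k)
    { toFun := leftMul
      map_one' := end_ext fun d _ => by rw [leftMul_normalForm, one_mul, Module.End.one_apply]
      map_mul' := fun a b => end_ext fun d _ => by
        rw [Module.End.mul_apply, leftMul_normalForm, leftMul_normalForm, leftMul_normalForm,
          mul_assoc] }

theorem representation_of (d : LDiagram k) :
    representation k (MonoidAlgebra.of ℤ[X] (LDiagram k) d) = leftMul d := by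
  rw [representation, MonoidAlgebra.lift_of]
  rfl

theorem representation_eq_of_diagramRel {d : LDiagram k} {y : LDiagramAlgebra k}
    (h : DiagramRel d y) : leftMul d = representation k y := by
  cases h with
  | loop d' h =>
    rw [map_smul, representation_of]
    exact leftMul_eq_smul (LDiagram.ext (by simp [LDiagram.reduced, LDiagram.simplify, h, reduce,
      edges])) (by simp [h, loopValue])
  | cancel d' e m R h h' =>
    have hparity : parity d.strands = parity d'.strands := by simp [h, h', parity]
    have hreduced : d.reduced = d'.reduced := LDiagram.ext <| by
      change reduce d.strands = reduce d'.strands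
      rw [← reduce_parity, hparity, reduce_parity]
    rw [representation_of, leftMul_eq_smul (c := 1) hreduced, one_smul]
    rw [one_mul, ← loopValue_parity, hparity, loopValue_parity]
  | absorb d' e m R h h' =>
    rw [representation_of, leftMul_eq_zero (by simp [h]), leftMul_eq_zero (by simp [h'])]

/-- The action of the quotient by the local relations on the free module on the reduced
diagrams. -/
noncomputable def hatRepresentation (k : ℕ) :
    HatAlgebra k →ₐ[ℤ[X]] Module.End ℤ[X] (ReducedDiagram k →₀ ℤ[X]) :=
  RingQuot.liftAlgHom ℤ[X] ⟨representation k, fun x y h => by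
    obtain ⟨d, rfl, h⟩ := h
    rw [representation_of, representation_eq_of_diagramRel h]⟩

theorem hatRepresentation_diagramClass (d : LDiagram k) :
    hatRepresentation k (diagramClass d) = leftMul d := by
  rw [hatRepresentation, diagramClass, RingQuot.liftAlgHom_mkAlgHom_apply, representation_of]

/-- The quotient map from `DTL(D_k)` to `LFD(D_k)`. -/
noncomputable abbrev toLFD (k : ℕ) : DTL k →ₐ[ℤ[X]] LFD k := RingQuot.mkAlgHom ℤ[X] (LoopRel k)

/-- The action of `LFD(D_k)` on the free module on the reduced diagrams. -/
noncomputable def loopFreeRepresentation (k : ℕ) :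
    LFD k →ₐ[ℤ[X]] Module.End ℤ[X] (ReducedDiagram k →₀ ℤ[X]) :=
  RingQuot.liftAlgHom ℤ[X] ⟨(hatRepresentation k).comp (DTL k).val, fun x y h => by
    obtain ⟨rfl, d, hd, hx⟩ := h
    rw [map_zero, AlgHom.comp_apply, Subalgebra.coe_val, hx, hatRepresentation_diagramClass,
      leftMul_eq_zero hd]⟩

theorem loopFreeRepresentation_toLFD (x : DTL k) :
    loopFreeRepresentation k (toLFD k x) = hatRepresentation k x := by
  rw [loopFreeRepresentation, toLFD, RingQuot.liftAlgHom_mkAlgHom_apply]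
  rfl

/-- The orbit map of the identity diagram, which recovers a combination of reduced diagrams from
its image in `LFD(D_k)`. -/
noncomputable def coordinates (k : ℕ) : LFD k →ₗ[ℤ[X]] (ReducedDiagram k →₀ ℤ[X]) :=
  (LinearMap.applyₗ (normalForm 1)).comp (loopFreeRepresentation k).toLinearMap

theorem coordinates_toLFD_diagramClass {d : LDiagram k} (h : diagramClass d ∈ DTL k) :
    coordinates k (toLFD k ⟨diagramClass d, h⟩) = normalForm d := by
  rw [coordinates, LinearMap.comp_apply, AlgHom.toLinearMap_apply, loopFreeRepresentation_toLFD,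
    hatRepresentation_diagramClass, LinearMap.applyₗ_apply_apply, leftMul_normalForm, mul_one]

end Representation

section Arcs

/-- Noncrossing arcs on the positions `0, …, 2 * n - 1`, where `A a c m` says that `a` and `c` are
joined by an arc with `m` decorations. This is a diagram of type II read along the boundary of the
box, the positions below `n` being the north face. -/
structure IsArcSystem (n : ℕ) (A : ℕ → ℕ → ℕ → Prop) : Prop where
  symm : ∀ {a c m}, A a c m → A c a m
  lt : ∀ {a c m}, A a c m → a < 2 * n
  total : ∀ {a}, a < 2 * n → ∃ c m, A a c m
  unique : ∀ {a c c' m m'}, A a c m → A a c' m' → c = c' ∧ m = m'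
  planar : ∀ {a c b x m m'}, A a c m → A b x m' → ¬ (a < b ∧ b < c ∧ c < x)
  exposed : ∀ {a c b x m m'}, A a c m → A b x m' → m' ≠ 0 → ¬ (a < b ∧ b < c)
  lt_two : ∀ {a c m}, A a c m → m < 2
  odd : ∀ {a c m}, A a c m → (a + c) % 2 = 1
  balanced : (∀ a c m, A a c m → a < n → n ≤ c) → ∀ a c m, A a c m → n ≤ a → c < n

/-- The column of a position on the boundary of the box. -/
def column (n p : ℕ) : ℕ := min p (2 * n - 1 - p)

/-- The horizontal length of an arc; a decorated arc passes along the left wall. -/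
def arcLength (n a c m : ℕ) : ℕ :=
  if m = 0 then (column n a - column n c) + (column n c - column n a)
  else column n a + column n c + 1

/-- The position `a` lies strictly between `p` and `q`. -/
def Between (p q a : ℕ) : Prop := (p < a ∧ a < q) ∨ (q < a ∧ a < p)

/-- The cup `{i, i + 1}` and the arc `{x, y}` can be replaced by the arcs `{i, x}` and
`{i + 1, y}`, where the first one receives all decorations, and this makes the arcs shorter. -/
structure IsMove (n : ℕ) (A : ℕ → ℕ → ℕ → Prop) (i x y m m' : ℕ) : Prop where
  cup : A i (i + 1) m
  arc : A x y m'
  top : i + 1 < n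
  bare : m = 0 ∨ i = 0
  ne : x ≠ i ∧ x ≠ i + 1
  planar_self : Between i x (i + 1) ↔ Between i x y
  planar : ∀ {a c l}, A a c l → a ≠ i → a ≠ i + 1 → a ≠ x → a ≠ y →
    (Between i x a → Between i x c) ∧ (Between (i + 1) y a → Between (i + 1) y c)
  exposed : ∀ {a c l}, A a c l → l ≠ 0 → a ≠ i → a ≠ i + 1 → a ≠ x → a ≠ y →
    ¬ Between i x a ∧ ¬ Between (i + 1) y a
  exposed_self : (m + m') % 2 ≠ 0 → ¬ Between (i + 1) y i ∧ ¬ Between (i + 1) y x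
  exposed_new : (m + m') % 2 ≠ 0 →
    ∀ {a c l}, A a c l → a ≠ i → a ≠ i + 1 → a ≠ x → a ≠ y → ¬ Between a c i ∧ ¬ Between a c x
  length_lt : arcLength n i x ((m + m') % 2) + arcLength n (i + 1) y 0 <
    arcLength n i (i + 1) m + arcLength n x y m'

variable {n : ℕ} {A : ℕ → ℕ → ℕ → Prop}

namespace IsArcSystem

theorem ne (hA : IsArcSystem n A) {a c m : ℕ} (h : A a c m) : a ≠ c := by
  have := hA.odd h
  omega

theorem eq_of_arc (hA : IsArcSystem n A) {a b c m m' : ℕ} (h : A a c m) (h' : A b c m') : a = b :=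
  (hA.unique (hA.symm h) (hA.symm h')).1

theorem ne_of_arc_of_ne (hA : IsArcSystem n A) {a c l x y m : ℕ} (h : A a c l) (hxy : A x y m)
    (hx : a ≠ x) (hy : a ≠ y) : c ≠ x ∧ c ≠ y := by
  constructor
  · rintro rfl
    exact hy (hA.eq_of_arc h (hA.symm hxy))
  · rintro rfl
    exact hx (hA.eq_of_arc h hxy)

theorem mem_Icc_of_vertical (hA : IsArcSystem n A) {j : ℕ}
    (hvert : ∀ k < j, ∃ m, A k (2 * n - 1 - k) m) {a c m : ℕ} (h : A a c m)
    (ha : a ∈ Set.Icc j (2 * n - 1 - j)) : c ∈ Set.Icc j (2 * n - 1 - j) := by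
  obtain ⟨hja, haj⟩ := ha
  have hc := hA.lt (hA.symm h)
  constructor
  · by_contra hlt
    obtain ⟨m', hm'⟩ := hvert c (by omega)
    have := (hA.unique (hA.symm h) hm').1
    omega
  · by_contra hlt
    obtain ⟨m', hm'⟩ := hvert (2 * n - 1 - c) (by omega)
    rw [Nat.sub_sub_self (by omega)] at hm'
    have := hA.eq_of_arc h hm'
    omega

theorem exists_first_cup (hA : IsArcSystem n A) (hn : 0 < n) :
    ∃ i m, A i (i + 1) m ∧ ∀ k ≤ i, ∀ c l, A k c l → k < c := by
  classical
  have hclosing : ∃ q, ∃ p m, p < q ∧ A p q m := by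
    obtain ⟨c, m, h⟩ := hA.total (a := 0) (by omega)
    exact ⟨c, 0, m, Nat.pos_of_ne_zero (hA.ne h).symm, h⟩
  obtain ⟨p, m, hpq, hp⟩ := Nat.find_spec hclosing
  have hopen : ∀ k < Nat.find hclosing, ∀ c l, A k c l → k < c := by
    intro k hk c l h
    refine (hA.ne h).lt_or_gt.resolve_right fun hck => Nat.find_min hclosing hk ?_
    exact ⟨c, l, hck, hA.symm h⟩
  generalize Nat.find hclosing = q at hpq hp hopen
  obtain rfl : p + 1 = q := by
    by_contra hne
    obtain ⟨r, l, hr⟩ := hA.total (a := q - 1) (by have := hA.lt (hA.symm hp); omega)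
    have hqr := hopen (q - 1) (by omega) r l hr
    have hrq := hA.ne_of_arc_of_ne hr hp (by omega) (by omega)
    exact hA.planar hp hr (by omega)
  exact ⟨p, m, hp, fun k hk => hopen k (by omega)⟩

theorem not_propagating (hA : IsArcSystem n A) {j : ℕ} (hj : j < n)
    (hj' : ∀ m, ¬ A j (2 * n - 1 - j) m) (hvert : ∀ k < j, ∃ m, A k (2 * n - 1 - k) m) :
    ¬ ∀ a c m, A a c m → a < n → n ≤ c := by
  intro hprop
  obtain ⟨c, l, hc⟩ := hA.total (a := j) (by omega)
  obtain ⟨c', l', hc'⟩ := hA.total (a := 2 * n - 1 - j) (by omega)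
  have hnc := hprop j c l hc hj
  have hcn := hA.balanced hprop _ _ _ hc' (by omega)
  have hcj := hA.mem_Icc_of_vertical hvert hc ⟨le_rfl, by omega⟩
  have hcj' := hA.mem_Icc_of_vertical hvert hc' ⟨by omega, le_rfl⟩
  have hne : c ≠ 2 * n - 1 - j := fun e => hj' l (e ▸ hc)
  have hne' := hA.ne_of_arc_of_ne hc' hc (by omega) hne.symm
  rw [Set.mem_Icc] at hcj hcj'
  exact hA.planar hc (hA.symm hc') (by omega)

theorem exists_cup (hA : IsArcSystem n A) {j : ℕ} (hj : j < n)
    (hj' : ∀ m, ¬ A j (2 * n - 1 - j) m) (hvert : ∀ k < j, ∃ m, A k (2 * n - 1 - k) m) :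
    ∃ i m, j ≤ i ∧ i + 1 < n ∧ A i (i + 1) m ∧ ∀ k ≤ i, ∀ c l, A k c l → k < c := by
  obtain ⟨i, m, hcup, hopen⟩ := hA.exists_first_cup (Nat.zero_lt_of_lt hj)
  have hin : i + 1 < n := by
    by_contra hin
    refine hA.not_propagating hj hj' hvert fun a c l h ha => ?_
    by_contra hc
    have hac := hopen a (by omega) c l h
    have hca := hopen c (by omega) a l (hA.symm h)
    omega
  refine ⟨i, m, ?_, hin, hcup, hopen⟩
  by_contra hlt
  obtain ⟨l, hl⟩ := hvert i (by omega)
  have := (hA.unique hl hcup).1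
  omega

theorem eq_zero_of_decorated (hA : IsArcSystem n A) {j : ℕ}
    (hvert : ∀ k < j, ∃ m, A k (2 * n - 1 - k) m) {a c l : ℕ} (h : A a c l) (hl : l ≠ 0)
    (ha : 0 < a) (ha' : a < 2 * n - 1) : j = 0 := by
  by_contra hj
  obtain ⟨m, hwall⟩ := hvert 0 (Nat.pos_of_ne_zero hj)
  exact hA.exposed hwall h hl ⟨ha, ha'⟩

end IsArcSystem

theorem arcLength_lt_of_left {i y m : ℕ} (hi : i + 2 < n) (hy : i + 2 < y)
    (hy' : y ≤ 2 * n - 3 - i) (hm : m < 2) :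
    arcLength n (i + 1) i ((0 + m) % 2) + arcLength n (i + 1 + 1) y 0 <
      arcLength n (i + 1) (i + 1 + 1) 0 + arcLength n i y m := by
  obtain rfl | rfl : m = 0 ∨ m = 1 := by omega
  all_goals
    simp only [arcLength, column]
    norm_num
    omega

theorem arcLength_lt_of_right {i x y m m' : ℕ} (hi : i + 1 < n) (hy : i + 1 < y) (hyx : y < x)
    (hx : x < 2 * n) (hx' : m' ≠ 0 ∨ x = 2 * n - 1 - i) (hm : m < 2) (hm' : m' < 2)
    (hmi : m = 0 ∨ i = 0) (hmi' : m' = 0 ∨ i = 0) :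
    arcLength n i x ((m + m') % 2) + arcLength n (i + 1) y 0 <
      arcLength n i (i + 1) m + arcLength n x y m' := by
  have hm : m = 0 ∨ m = 1 := by omega
  have hm' : m' = 0 ∨ m' = 1 := by omega
  rcases hm with rfl | rfl <;> rcases hm' with rfl | rfl
  all_goals
    simp only [arcLength, column]
    norm_num
    omega

namespace IsArcSystem

theorem isMove_left (hA : IsArcSystem n A) {i y m m' : ℕ} (hi : i + 2 < n)
    (hcup : A (i + 1) (i + 1 + 1) m) (harc : A i y m') (hy : i + 2 < y)
    (hy' : y ≤ 2 * n - 3 - i) : IsMove n A (i + 1) i y m m' := by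
  obtain rfl : m = 0 := by
    by_contra hm
    exact hA.exposed harc hcup hm (by omega)
  refine ⟨hcup, harc, hi, Or.inl rfl, by omega, by unfold Between; omega, ?_, ?_, ?_, ?_,
    arcLength_lt_of_left hi hy hy' (hA.lt_two harc)⟩
  · intro a c l h hi₁ hi₂ hx hy
    have hci := hA.ne_of_arc_of_ne h hcup hi₁ hi₂
    have hcy := hA.ne_of_arc_of_ne h harc hx hy
    have hcross := hA.planar harc h
    have hcross' := hA.planar (hA.symm h) harc
    unfold Between
    omega
  · intro a c l h hl _ _ _ _
    have hcover := hA.exposed harc h hl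
    unfold Between
    omega
  · unfold Between
    omega
  · intro hm a c l h hi₁ hi₂ hx hy
    have hci := hA.ne_of_arc_of_ne h harc hx hy
    have hcover := hA.exposed h harc (by omega)
    have hcover' := hA.exposed (hA.symm h) harc (by omega)
    unfold Between
    omega

theorem planar_of_isMove_right (hA : IsArcSystem n A) {i x y m m' : ℕ}
    (hvert : ∀ k < i, ∃ m, A k (2 * n - 1 - k) m) (hcup : A i (i + 1) m) (harc : A x y m')
    (hy : i + 1 < y) (hyx : y < x) (hxi : x ≤ 2 * n - 1 - i)
    (hx : m' ≠ 0 ∨ x = 2 * n - 1 - i) {a c l : ℕ} (h : A a c l) (hai : a ≠ i) (hai' : a ≠ i + 1)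
    (hax : a ≠ x) (hay : a ≠ y) :
    (Between i x a → Between i x c) ∧ (Between (i + 1) y a → Between (i + 1) y c) := by
  have hci := hA.ne_of_arc_of_ne h hcup hai hai'
  have hcx := hA.ne_of_arc_of_ne h harc hax hay
  have hcross := hA.planar h (hA.symm harc)
  have hcross' := hA.planar (hA.symm harc) h
  have hcross'' := hA.planar (hA.symm h) (hA.symm harc)
  have hinside : i < a → a < x → i ≤ c ∧ c ≤ 2 * n - 1 - i := fun ha ha' =>
    hA.mem_Icc_of_vertical hvert h ⟨ha.le, by omega⟩
  have hcover : i < a → a < x → ¬ x < c := fun ha ha' hc => by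
    rcases hx with hx | hx
    · exact hA.exposed h harc hx ⟨ha', hc⟩
    · have := hinside ha ha'
      omega
  unfold Between
  omega

theorem isMove_right (hA : IsArcSystem n A) {i x y m m' : ℕ} (hi : i + 1 < n)
    (hvert : ∀ k < i, ∃ m, A k (2 * n - 1 - k) m) (hcup : A i (i + 1) m) (harc : A x y m')
    (hy : i + 1 < y) (hyx : y < x) (hx : m' ≠ 0 ∨ x = 2 * n - 1 - i)
    (hmin : ∀ a c l, A a c l → i + 1 < a → a < y → a < c → l = 0) :
    IsMove n A i x y m m' := by
  have hx2n := hA.lt harc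
  have hm : m = 0 ∨ i = 0 := or_iff_not_imp_left.2 fun hm => by
    by_contra hi0
    exact hi0 (hA.eq_zero_of_decorated hvert hcup hm (by omega) (by omega))
  have hm' : m' = 0 ∨ i = 0 := or_iff_not_imp_left.2 fun hm' =>
    hA.eq_zero_of_decorated hvert (hA.symm harc) hm' (by omega) (by omega)
  have hplanar {a c l : ℕ} := hA.planar_of_isMove_right (a := a) (c := c) (l := l) hvert hcup harc
    hy hyx (by omega) hx
  refine ⟨hcup, harc, hi, hm, by omega, by unfold Between; omega, hplanar, ?_, ?_, ?_,
    arcLength_lt_of_right hi hy hyx hx2n hx (hA.lt_two hcup) (hA.lt_two harc) hm hm'⟩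
  · intro a c l h hl hai hai' hax hay
    have hcover := hA.exposed (hA.symm harc) h hl
    have hac := hplanar h hai hai' hax hay
    have hca := hA.ne_of_arc_of_ne h hcup hai hai'
    have hopen : i + 1 < a → a < y → ¬ a < c := fun h₁ h₂ h₃ => hl (hmin a c l h h₁ h₂ h₃)
    have hopen' : i + 1 < c → c < y → ¬ c < a := fun h₁ h₂ h₃ =>
      hl (hmin c a l (hA.symm h) h₁ h₂ h₃)
    have hne := hA.ne h
    unfold Between at hac ⊢
    omega
  · unfold Between
    omega
  · intro hmm a c l h _ _ _ _
    have hcover : m' ≠ 0 → ¬ (a < x ∧ x < c) ∧ ¬ (c < x ∧ x < a) := fun hm' =>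
      ⟨hA.exposed h harc hm', hA.exposed (hA.symm h) harc hm'⟩
    have ha := hA.lt h
    have hc := hA.lt (hA.symm h)
    unfold Between
    omega

theorem lt_of_nested (hA : IsArcSystem n A) {i j : ℕ} (hin : i + 1 < n)
    (hj' : ∀ m, ¬ A j (2 * n - 1 - j) m) (hvert : ∀ k < j, ∃ m, A k (2 * n - 1 - k) m)
    (hopen : ∀ k ≤ i, ∀ c l, A k c l → k < c) {a : ℕ} (hja : j ≤ a) :
    a < i → ∀ y l, A a y l → y < 2 * n - 1 - a := by
  induction a, hja using Nat.le_induction with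
  | base =>
    intro _ y l hy
    have hjy := (hA.mem_Icc_of_vertical hvert hy ⟨le_rfl, by omega⟩).2
    have hne : y ≠ 2 * n - 1 - j := fun e => hj' l (e ▸ hy)
    omega
  | succ a _ ih =>
    intro hai y l hy
    obtain ⟨z, l', hz⟩ := hA.total (a := a) (by omega)
    have hzn := ih (by omega) z l' hz
    have haz := hopen a (by omega) z l' hz
    have hay := hopen (a + 1) (by omega) y l hy
    have hcross := hA.planar hz hy
    have hne : a + 1 ≠ z := fun e => by
      have := hopen (a + 1) (by omega) _ _ (hA.symm (e ▸ hz))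
      omega
    have hyz := hA.ne_of_arc_of_ne hy hz (by omega) hne
    omega

theorem exists_isMove_right (hA : IsArcSystem n A) {j m : ℕ}
    (hvert : ∀ k < j, ∃ m, A k (2 * n - 1 - k) m) (hjn : j + 1 < n) (hcup : A j (j + 1) m) :
    ∃ x y m', IsMove n A j x y m m' := by
  classical
  have hclosing : ∃ y x m', A x y m' ∧ j + 1 < y ∧ y < x ∧ (m' ≠ 0 ∨ x = 2 * n - 1 - j) := by
    obtain ⟨w, l, hw⟩ := hA.total (a := 2 * n - 1 - j) (by omega)
    have hjw := hA.mem_Icc_of_vertical hvert hw ⟨by omega, le_rfl⟩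
    have hne := hA.ne hw
    have hne' := hA.ne_of_arc_of_ne hw hcup (by omega) (by omega)
    rw [Set.mem_Icc] at hjw
    exact ⟨w, _, l, hw, by omega, by omega, Or.inr rfl⟩
  obtain ⟨x, m', harc, hy, hyx, hx⟩ := Nat.find_spec hclosing
  refine ⟨x, _, m', hA.isMove_right hjn hvert hcup harc hy hyx hx fun a c l h hja hay hac => ?_⟩
  by_contra hl
  exact Nat.find_min hclosing hay ⟨c, l, hA.symm h, hja, hac, Or.inl hl⟩

theorem exists_isMove (hA : IsArcSystem n A) (h : ¬ ∀ j < n, ∃ m, A j (2 * n - 1 - j) m) :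
    ∃ i x y m m', IsMove n A i x y m m' := by
  classical
  push Not at h
  obtain ⟨hj, hj'⟩ := Nat.find_spec h
  have hvert : ∀ k < Nat.find h, ∃ m, A k (2 * n - 1 - k) m := fun k hk => by
    simpa [hk.trans hj] using Nat.find_min h hk
  generalize Nat.find h = j at hj hj' hvert
  obtain ⟨i, m, hji, hin, hcup, hopen⟩ := hA.exists_cup hj hj' hvert
  obtain rfl | hlt := hji.eq_or_lt
  · obtain ⟨x, y, m', hmove⟩ := hA.exists_isMove_right hvert hin hcup
    exact ⟨j, x, y, m, m', hmove⟩
  · obtain ⟨i, rfl⟩ := Nat.exists_eq_add_one_of_ne_zero (Nat.ne_zero_of_lt hlt)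
    obtain ⟨y, m', hy⟩ := hA.total (a := i) (by omega)
    have hyn := hA.lt_of_nested hin hj' hvert hopen (Nat.le_of_lt_succ hlt) (by omega) y m' hy
    have hiy := hopen i (by omega) y m' hy
    have hodd := hA.odd hy
    have hne := hA.ne_of_arc_of_ne hy hcup (by omega) (by omega)
    exact ⟨i + 1, i, y, m, m', hA.isMove_left hin hcup hy (by omega) (by omega)⟩

end IsArcSystem

end Arcs

section SimpleConcat

theorem fuse_pair {V : Type*} [DecidableEq V] {v u w : V} (hu : u ≠ v) (hw : w ≠ v) (p q : ℕ)
    {N : Multiset (Strand V)} (hN : v ∉ ends N) :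
    fuse v (({v, u}, p) ::ₘ ({v, w}, q) ::ₘ N) = (({u, w} : Multiset V), p + q) ::ₘ N := by
  have hout : ∀ e ∈ N, v ∉ e.1 := fun e he hv => hN (mem_ends.2 ⟨e, he, hv⟩)
  have hnil : N.filter (fun e => v ∈ e.1) = 0 := Multiset.filter_eq_nil.2 hout
  have hself : N.filter (fun e => v ∉ e.1) = N := Multiset.filter_eq_self.2 hout
  simp [fuse, Multiset.filter_singleton, hnil, hself, hu, hw]

theorem fuse_fuse_path {V : Type*} [DecidableEq V] {a b u w : V} (hab : a ≠ b) (hua : u ≠ a)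
    (hub : u ≠ b) (hwa : w ≠ a) (hwb : w ≠ b) (m p q : ℕ) {N : Multiset (Strand V)}
    (ha : a ∉ ends N) (hb : b ∉ ends N) :
    fuse a (fuse b (({a, b}, m) ::ₘ ({a, u}, p) ::ₘ ({b, w}, q) ::ₘ N)) =
      (({u, w} : Multiset V), m + p + q) ::ₘ N := by
  have hb' : b ∉ ends ((({a, u} : Multiset V), p) ::ₘ N) := by
    simp [ends_cons, hab.symm, hub.symm, hb]
  rw [Multiset.cons_swap (({a, u} : Multiset V), p), Multiset.pair_comm a b,
    fuse_pair hab hwb m q hb', Multiset.cons_swap, fuse_pair hua hwa p (m + q) ha,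
    add_left_comm, ← add_assoc]

theorem fuseList_perm {V : Type*} [DecidableEq V] {l l' : List V} (h : l.Perm l')
    (M : Multiset (Strand V)) : fuseList l M = fuseList l' M := by
  have : LeftCommutative (fuse : V → Multiset (Strand V) → Multiset (Strand V)) := ⟨fuse_comm⟩
  exact h.foldr_eq M

variable {k : ℕ}

/-- The places other than `i` and `j`. -/
def otherPlaces (i j : Fin k) : List (Fin k) := (List.finRange k).filter fun l => l ≠ i ∧ l ≠ j

theorem mem_otherPlaces {i j l : Fin k} : l ∈ otherPlaces i j ↔ l ≠ i ∧ l ≠ j := by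
  simp [otherPlaces]

theorem nodup_otherPlaces (i j : Fin k) : (otherPlaces i j).Nodup :=
  (List.nodup_finRange k).filter _

theorem level_perm_cons_cons {Λ : Type*} (s : Λ) {i j : Fin k} (hij : i ≠ j) :
    (level k s).Perm ((s, i) :: (s, j) ::
      (otherPlaces i j).map fun l => (s, l)) := by
  have hperm : (List.finRange k).Perm (i :: j :: otherPlaces i j) := by
    refine (List.perm_ext_iff_of_nodup (List.nodup_finRange k) ?_).2 fun l => ?_
    · simp [hij, mem_otherPlaces, nodup_otherPlaces]
    · simp only [List.mem_finRange, List.mem_cons, mem_otherPlaces]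
      tauto
  exact hperm.map fun l => (s, l)

/-- Where a node of the lower of two stacked boxes is moved when vertical edges of the upper box are
attached at the places in `l`. -/
def pullUp (l : List (Fin k)) : Node k → Fin 3 × Fin k :=
  Sum.elim (fun i => (if i ∈ l then 0 else 1, i)) (fun i => (2, i))

theorem fuseList_relabel_straight {l : List (Fin k)} (hl : l.Nodup)
    {D : Multiset (Strand (Node k))} (hD : ∀ v, (ends D).count v = 1) :
    fuseList (l.map fun i => ((1 : Fin 3), i))
      (relabel (place 0 1) (straight l) + relabel (place 1 2) D) = relabel (pullUp l) D := by
  have hinj : Function.Injective (place 1 2 : Node k → Fin 3 × Fin k) :=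
    place_injective (by decide)
  obtain ⟨g, hmem, hnot, h⟩ := fuseList_straight (V := Fin 3 × Fin k) (fun i : Fin k => (1, i))
    (fun i => (0, i)) (fun _ _ h => (Prod.mk.inj h).2) (fun a b => by simp) l hl
    (relabel (place 1 2) D) (fun i => (count_ends_relabel hinj D (Sum.inl i)).trans (hD _))
  have hstraight : relabel (place (0 : Fin 3) 1) (straight l) =
      (l.map fun i => (({(0, i), (1, i)} : Multiset (Fin 3 × Fin k)), 0) :
        List (Strand (Fin 3 × Fin k))) := by
    simp [straight, relabel, place, Function.comp_def]
  rw [hstraight, h, relabel_relabel]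
  refine relabel_congr fun v _ => ?_
  rcases v with i | i
  · by_cases hi : i ∈ l
    · simpa [pullUp, place, hi] using hmem i hi
    · simpa [pullUp, place, hi] using hnot (1, i) fun a ha e => hi ((Prod.mk.inj e).2 ▸ ha)
  · simpa [pullUp, place] using hnot (2, i) fun a _ e => by simp at e

theorem stack_simpleStrands (i j : Fin k) (m : ℕ) (D : Multiset (Strand (Node k))) :
    stack (simpleStrands i j m) D =
      (relabel (place 0 1) (straight (otherPlaces i j)) + relabel (place 1 2) D) +
        (({(1, i), (1, j)}, m) ::ₘ {({(0, i), (0, j)}, m)}) := by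
  have hsimple : simpleStrands i j m = straight (otherPlaces i j) +
      (({Sum.inr i, Sum.inr j}, m) ::ₘ {({Sum.inl i, Sum.inl j}, m)}) := by
    simp only [simpleStrands, otherPlaces, ← Multiset.singleton_add]
    abel
  rw [stack, hsimple, relabel_add, add_right_comm]
  rfl

theorem fuseList_stack_simpleStrands {i j : Fin k} (hij : i ≠ j) (m : ℕ)
    {D : Multiset (Strand (Node k))} (hD : ∀ v, (ends D).count v = 1) :
    fuseList (level k 1) (stack (simpleStrands i j m) D) =
      fuse (1, i) (fuse (1, j) (({(1, i), (1, j)}, m) ::ₘ ({(0, i), (0, j)}, m) ::ₘ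
        relabel (pullUp (otherPlaces i j)) D)) := by
  have hnot : ∀ x ∈ (otherPlaces i j).map fun a => ((1 : Fin 3), a),
      x ∉ ends (({(1, i), (1, j)}, m) ::ₘ {({((0 : Fin 3), i), (0, j)}, m)}) := by
    intro x hx
    obtain ⟨a, ha, rfl⟩ := List.mem_map.1 hx
    obtain ⟨hai, haj⟩ := mem_otherPlaces.1 ha
    simp [ends, hai, haj]
  rw [fuseList_perm (level_perm_cons_cons 1 hij)]
  change fuse (1, i) (fuse (1, j) (fuseList ((otherPlaces i j).map fun a => (1, a)) _)) = _
  rw [stack_simpleStrands, fuseList_add_of_notMem _ hnot,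
    fuseList_relabel_straight (nodup_otherPlaces i j) hD, add_comm, Multiset.cons_add,
    Multiset.singleton_add]

theorem concat_simpleStrands {i j : Fin k} (hij : i ≠ j) (m q r : ℕ) {x y : Node k}
    {R : Multiset (Strand (Node k))}
    (hD : ∀ v, (ends (({Sum.inl i, x}, q) ::ₘ ({Sum.inl j, y}, r) ::ₘ R)).count v = 1) :
    concat (simpleStrands i j m) (({Sum.inl i, x}, q) ::ₘ ({Sum.inl j, y}, r) ::ₘ R) =
      (({Sum.inl i, Sum.inl j} : Multiset (Node k)), m) ::ₘ ({x, y}, m + q + r) ::ₘ R := by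
  have hnodup := Multiset.nodup_iff_count_le_one.2 fun v => (hD v).le
  simp only [ends_cons, Multiset.insert_eq_cons, Multiset.cons_add, Multiset.singleton_add,
    Multiset.nodup_cons, Multiset.mem_cons, not_or] at hnodup
  obtain ⟨⟨hxi, -, hyi, hiR⟩, ⟨hxj, -, -⟩, ⟨hyj, hjR⟩, -, -⟩ := hnodup
  rw [eq_comm] at hxi hyi hyj
  set g := pullUp (otherPlaces i j) with hg
  have hi : g (Sum.inl i) = (1, i) := by simp [hg, pullUp, mem_otherPlaces]
  have hj : g (Sum.inl j) = (1, j) := by simp [hg, pullUp, mem_otherPlaces]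
  have hlevel : ∀ {v} l, v ≠ Sum.inl i → v ≠ Sum.inl j → g v ≠ (1, l) := by
    rintro (a | a) <;> simp +contextual [hg, pullUp, mem_otherPlaces]
  have hunplace : ∀ {v}, v ≠ Sum.inl i → v ≠ Sum.inl j → unplace (g v) = v := by
    rintro (a | a) <;> simp +contextual [hg, pullUp, mem_otherPlaces, unplace]
  have hR : ∀ v ∈ ends R, v ≠ Sum.inl i ∧ v ≠ Sum.inl j := fun v hv =>
    ⟨fun e => hiR (e ▸ hv), fun e => hjR (e ▸ hv)⟩
  have hRg : ∀ l, (1, l) ∉ ends ((({(0, i), (0, j)} : Multiset _), m) ::ₘ relabel g R) := by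
    intro l hl
    have hl' : (1, l) ∈ ends (relabel g R) := by simpa [ends_cons] using hl
    obtain ⟨v, hv, hvl⟩ := Multiset.mem_map.1 (ends_relabel g R ▸ hl')
    exact hlevel l (hR v hv).1 (hR v hv).2 hvl
  have hrelabel : relabel g (({Sum.inl i, x}, q) ::ₘ ({Sum.inl j, y}, r) ::ₘ R) =
      ({(1, i), g x}, q) ::ₘ ({(1, j), g y}, r) ::ₘ relabel g R := by
    simp [relabel, hi, hj]
  have hunplaceR : relabel unplace (relabel g R) = R := by
    rw [relabel_relabel]
    exact (relabel_congr fun v hv => hunplace (hR v hv).1 (hR v hv).2).trans (relabel_id R)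
  rw [concat, fuseList_stack_simpleStrands hij m hD, hrelabel, Multiset.cons_swap _ (_, q),
    Multiset.cons_swap _ (_, r),
    fuse_fuse_path (by simp [hij]) (hlevel i hxi hxj) (hlevel j hxi hxj) (hlevel i hyi hyj)
      (hlevel j hyi hyj) m q r (hRg i) (hRg j), Multiset.cons_swap]
  conv_rhs => rw [← hunplaceR, ← hunplace hxi hxj, ← hunplace hyi hyj]
  simp [relabel, unplace]

end SimpleConcat

section Nodes

variable {k : ℕ}

theorem nodePos_injective : Function.Injective (nodePos : Node k → ℕ) := by
  rintro (i | i) (j | j) h <;> simp only [nodePos, Sum.elim_inl, Sum.elim_inr] at h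
  · rw [Fin.ext h]
  · omega
  · omega
  · rw [Fin.ext (show (i : ℕ) = j by omega)]

theorem nodePos_lt (v : Node k) : nodePos v < 2 * k := by
  rcases v with i | i <;> simp only [nodePos, Sum.elim_inl, Sum.elim_inr] <;> omega

theorem nodePos_lt_iff {v : Node k} : nodePos v < k ↔ v.isLeft = true := by
  rcases v with i | i
  · simp [nodePos]
  · simp only [nodePos, Sum.elim_inr, Sum.isLeft_inr, Bool.false_eq_true, iff_false]
    omega

theorem le_nodePos_iff {v : Node k} : k ≤ nodePos v ↔ v.isLeft = false := by
  rw [← not_lt, nodePos_lt_iff, Bool.not_eq_true]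

theorem exists_nodePos_eq {p : ℕ} (hp : p < 2 * k) : ∃ v : Node k, nodePos v = p := by
  by_cases h : p < k
  · exact ⟨Sum.inl ⟨p, h⟩, rfl⟩
  · refine ⟨Sum.inr ⟨2 * k - 1 - p, by omega⟩, ?_⟩
    simp only [nodePos, Sum.elim_inr]
    omega

theorem below_univ (v : Node k) :
    below nodePos (Finset.univ : Finset (Node k)).val v = nodePos v := by
  have himage : {w : Node k | nodePos w < nodePos v}.image nodePos = Set.Iio (nodePos v) := by
    ext p
    constructor
    · rintro ⟨w, hw, rfl⟩
      exact hw
    · intro hp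
      obtain ⟨w, rfl⟩ := exists_nodePos_eq ((Set.mem_Iio.1 hp).trans (nodePos_lt v))
      exact ⟨w, hp, rfl⟩
  have hcard := Set.ncard_image_of_injective {w : Node k | nodePos w < nodePos v} nodePos_injective
  rw [himage, Set.ncard_Iio_nat] at hcard
  rw [hcard, below, Multiset.countP_eq_card_filter, Set.ncard_eq_toFinset_card',
    Set.toFinset_ofPred]
  rfl

end Nodes

section ArcsOfDiagram

variable {k : ℕ}

/-- The positions `a` and `c` are joined by an edge with `m` decorations. -/
def Arc (M : Multiset (Strand (Node k))) (a c m : ℕ) : Prop :=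
  ∃ v w : Node k, (({v, w} : Multiset (Node k)), m) ∈ M ∧ nodePos v = a ∧ nodePos w = c

namespace IsDiagram

variable {M : Multiset (Strand (Node k))}

theorem notMem_ends_of_mem {e : Strand (Node k)} (hM : IsDiagram (e ::ₘ M)) {v : Node k}
    (hv : v ∈ e.1) : v ∉ ends M := by
  intro hvM
  have hcount := hM.2 v
  rw [ends_cons, Multiset.count_add] at hcount
  have := Multiset.one_le_count_iff_mem.2 hv
  have := Multiset.one_le_count_iff_mem.2 hvM
  omega

theorem ne_of_pair_mem (hM : IsDiagram M) {v w : Node k} {m : ℕ}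
    (h : (({v, w} : Multiset (Node k)), m) ∈ M) : v ≠ w := by
  rintro rfl
  obtain ⟨R, rfl⟩ := Multiset.exists_cons_of_mem h
  have hcount := hM.2 v
  simp [ends_cons] at hcount

theorem exists_pair_of_mem (hM : IsDiagram M) {e : Strand (Node k)} (he : e ∈ M) {v : Node k}
    (hv : v ∈ e.1) : ∃ w, e.1 = {v, w} := by
  rcases exists_pair (hM.1 e he) with h | ⟨a, b, h⟩
  · simp [h] at hv
  · rw [h] at hv
    rcases Multiset.mem_cons.1 hv with rfl | hv
    · exact ⟨b, h⟩
    · rw [Multiset.mem_singleton.1 hv]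
      exact ⟨a, h.trans (Multiset.pair_comm a b)⟩

theorem exists_mem (hM : IsDiagram M) (v : Node k) : ∃ e ∈ M, v ∈ e.1 :=
  mem_ends.1 (Multiset.one_le_count_iff_mem.1 (hM.2 v).ge)

theorem nodePos_eq_below (hM : IsDiagram M) (v : Node k) :
    nodePos v = below nodePos (ends M) v := by
  rw [ends_eq_univ hM, below_univ]

theorem odd_of_pair_mem (hM : IsDiagram M) (hP : Planar nodePos M) {v w : Node k} {m : ℕ}
    (h : (({v, w} : Multiset (Node k)), m) ∈ M) : (nodePos v + nodePos w) % 2 = 1 := by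
  have hne : nodePos v ≠ nodePos w := fun e => hM.ne_of_pair_mem h (nodePos_injective e)
  obtain ⟨R, rfl⟩ := Multiset.exists_cons_of_mem h
  have hR : ∀ u ∈ ends R, nodePos u ≠ nodePos v ∧ nodePos u ≠ nodePos w := fun u hu =>
    ⟨nodePos_injective.ne fun e => hM.notMem_ends_of_mem (by simp) (e ▸ hu),
      nodePos_injective.ne fun e => hM.notMem_ends_of_mem (by simp) (e ▸ hu)⟩
  have hparity := below_ends hP h (y := v) (z := w) (S := R) (by simp) (by simp)
    (fun e he => Multiset.mem_cons_of_mem he) (fun e he => hM.1 e (Multiset.mem_cons_of_mem he)) hR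
  have hv := hM.nodePos_eq_below v
  have hw := hM.nodePos_eq_below w
  have hpair : below nodePos {v, w} v + below nodePos {v, w} w = 1 := by
    simp only [below, Multiset.insert_eq_cons, Multiset.countP_cons, ← Multiset.cons_zero,
      Multiset.countP_zero, lt_irrefl, if_false]
    split_ifs <;> omega
  simp only [ends_cons, below_add] at hv hw
  omega

theorem lt_of_vertical (hM : IsDiagram M)
    (hvert : ∀ a c m, Arc M a c m → a < k → k ≤ c) :
    ∀ a c m, Arc M a c m → k ≤ a → c < k := by
  have hsouth : ∀ e ∈ M, e.1 ≠ 0 → ∃ v ∈ e.1, v.isLeft = !true := by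
    intro e he he0
    obtain ⟨v, hv⟩ := Multiset.exists_mem_of_ne_zero he0
    obtain ⟨w, hw⟩ := hM.exists_pair_of_mem he hv
    have hvw : (({v, w} : Multiset (Node k)), e.2) ∈ M := by rwa [← hw]
    by_cases hvk : nodePos v < k
    · exact ⟨w, by simp [hw], le_nodePos_iff.1 (hvert _ _ _ ⟨v, w, hvw, rfl, rfl⟩ hvk)⟩
    · exact ⟨v, hv, le_nodePos_iff.1 (not_lt.1 hvk)⟩
  rintro _ _ m ⟨v, w, h, rfl, rfl⟩ hv
  obtain ⟨u, hu, hul⟩ := arcs_symm hM true hsouth _ h (by simp)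
  rw [← nodePos_lt_iff] at hul
  simp only [Multiset.insert_eq_cons, Multiset.mem_cons, Multiset.mem_singleton] at hu
  rcases hu with rfl | rfl
  · omega
  · exact hul

theorem mem_of_nodePos_eq_zero (hM : IsDiagram M) (hE : LeftExposed nodePos M)
    (ha : aValue M = 0) {e : Strand (Node k)} (he : e ∈ M) (he0 : e.1 ≠ 0) (hdec : e.2 ≠ 0)
    (hloops : ∀ f ∈ M, f.1 ≠ 0) {v : Node k} (hv : nodePos v = 0) : v ∈ e.1 := by
  have hsouth := aValue_eq_zero.1 ha
  obtain ⟨u, hu, hul⟩ := arcs_symm hM true hsouth e he he0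
  obtain ⟨f, hf, hvf⟩ := hM.exists_mem v
  obtain ⟨b, hb, hbl⟩ := hsouth f hf (hloops f hf)
  have huncovered := hE e he hdec f hf v hvf u hu b hb
  rw [← nodePos_lt_iff] at hul
  rw [← le_nodePos_iff] at hbl
  have huv : nodePos u = nodePos v := by omega
  rwa [← nodePos_injective huv]

theorem bare_of_even (hM : IsDiagram M) (hE : LeftExposed nodePos M) (hred : IsReduced M)
    (heven : Even M.sum.2) (ha : aValue M = 0) : ∀ e ∈ M, e.2 = 0 := by
  intro e he
  by_contra hdec
  have hfirst := fun f hf hf0 v hv => hM.mem_of_nodePos_eq_zero (v := v) hE ha (e := f) hf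
    (hred f hf).1 hf0 (fun g hg => (hred g hg).1) hv
  obtain ⟨u, -⟩ := Multiset.exists_mem_of_ne_zero (hred e he).1
  obtain ⟨v, hv⟩ := exists_nodePos_eq (k := k) (p := 0) (by have := nodePos_lt u; omega)
  have hve := hfirst e he hdec v hv
  obtain ⟨R, rfl⟩ := Multiset.exists_cons_of_mem he
  have hR : R.sum.2 = 0 := by
    rw [snd_sum]
    refine Multiset.sum_eq_zero fun x hx => ?_
    obtain ⟨f, hf, rfl⟩ := Multiset.mem_map.1 hx
    by_contra hf0
    exact hM.notMem_ends_of_mem hve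
      (mem_ends.2 ⟨f, hf, hfirst f (Multiset.mem_cons_of_mem hf) hf0 v hv⟩)
  have hlt := (hred e he).2
  rw [Multiset.sum_cons, Prod.snd_add, hR, Nat.even_iff] at heven
  omega

end IsDiagram

theorem isArcSystem (d : LDiagram k) (hd : ∀ e ∈ d.strands, e.2 < 2) :
    IsArcSystem k (Arc d.strands) where
  symm := by
    rintro _ _ m ⟨v, w, h, rfl, rfl⟩
    exact ⟨w, v, Multiset.pair_comm v w ▸ h, rfl, rfl⟩
  lt := by
    rintro _ _ _ ⟨v, _, _, rfl, _⟩
    exact nodePos_lt v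
  total := by
    intro a ha
    obtain ⟨v, rfl⟩ := exists_nodePos_eq ha
    obtain ⟨⟨e, m⟩, he, hv⟩ := d.isDiagram.exists_mem v
    obtain ⟨w, rfl : e = _⟩ := d.isDiagram.exists_pair_of_mem he hv
    exact ⟨nodePos w, m, v, w, he, rfl, rfl⟩
  unique := by
    rintro _ _ _ m m' ⟨v, w, h, rfl, rfl⟩ ⟨v', w', h', e, rfl⟩
    obtain rfl := nodePos_injective e
    obtain ⟨hvw, hm⟩ :=
      Prod.mk.inj (d.isDiagram.eq_of_mem h h' (v := v') (by simp) (by simp))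
    simp only [Multiset.insert_eq_cons, Multiset.cons_inj_right, Multiset.singleton_inj] at hvw
    exact ⟨by rw [hvw], hm⟩
  planar := by
    rintro _ _ _ _ m m' ⟨v, w, h, rfl, rfl⟩ ⟨v', w', h', rfl, rfl⟩
    exact d.planar _ h _ h' v (by simp) v' (by simp) w (by simp) w' (by simp)
  exposed := by
    rintro _ _ _ _ m m' ⟨v, w, h, rfl, rfl⟩ ⟨v', w', h', rfl, rfl⟩ hm
    exact d.leftExposed _ h' hm _ h v (by simp) v' (by simp) w (by simp)
  lt_two := by
    rintro _ _ m ⟨v, w, h, rfl, rfl⟩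
    exact hd _ h
  odd := by
    rintro _ _ m ⟨v, w, h, rfl, rfl⟩
    exact d.isDiagram.odd_of_pair_mem d.planar h
  balanced := d.isDiagram.lt_of_vertical

/-- The length `arcLength` of the arc of an edge, as a function of the multiset of its ends. -/
def strandLength (e : Strand (Node k)) : ℕ :=
  if e.2 = 0 then 2 * (e.1.map fun v => column k (nodePos v)).sup -
    (e.1.map fun v => column k (nodePos v)).sum
  else (e.1.map fun v => column k (nodePos v)).sum + 1

theorem strandLength_pair (v w : Node k) (m : ℕ) :
    strandLength (({v, w} : Multiset (Node k)), m) = arcLength k (nodePos v) (nodePos w) m := by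
  simp only [strandLength, arcLength, Multiset.insert_eq_cons, Multiset.map_cons,
    Multiset.map_singleton, Multiset.sup_cons, Multiset.sup_singleton, Multiset.sum_cons,
    Multiset.sum_singleton]
  split_ifs <;> omega

theorem eq_of_le_of_ends_eq {M N : Multiset (Strand (Node k))} (hle : N ≤ M)
    (hends : ends N = ends M) (hM : ∀ e ∈ M, e.1 ≠ 0) : N = M := by
  obtain ⟨L, rfl⟩ := Multiset.le_iff_exists_add.1 hle
  rw [ends_add, left_eq_add] at hends
  suffices L = 0 by rw [this, add_zero]
  refine Multiset.eq_zero_of_forall_notMem fun e he => ?_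
  obtain ⟨v, hv⟩ := Multiset.exists_mem_of_ne_zero (hM e (Multiset.mem_add.2 (Or.inr he)))
  have hvL : v ∈ ends L := mem_ends.2 ⟨e, he, hv⟩
  simp [hends] at hvL

theorem eq_one_of_vertical {d : LDiagram k} (hd : ∀ e ∈ d.strands, e.1 ≠ 0)
    (h : ∀ j < k, ∃ m, Arc d.strands j (2 * k - 1 - j) m) : d = 1 := by
  have hvert : ∀ j : Fin k, ∃ m, (({Sum.inl j, Sum.inr j} : Multiset (Node k)), m) ∈ d.strands := by
    intro j
    obtain ⟨m, v, w, hvw, hv, hw⟩ := h j j.2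
    obtain rfl : v = Sum.inl j := nodePos_injective hv
    obtain rfl : w = Sum.inr j := nodePos_injective hw
    exact ⟨m, hvw⟩
  have hsouth : ∀ e ∈ d.strands, e.1 ≠ 0 → ∃ v ∈ e.1, v.isLeft = false := by
    intro e he he0
    obtain ⟨j | j, hj⟩ := Multiset.exists_mem_of_ne_zero he0
    · obtain ⟨m, hm⟩ := hvert j
      rw [d.isDiagram.eq_of_mem he hm hj (by simp)]
      exact ⟨Sum.inr j, by simp, rfl⟩
    · exact ⟨Sum.inr j, hj, rfl⟩
  have hbare := d.bare (aValue_eq_zero.2 hsouth)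
  have hle : idStrands k ≤ d.strands := by
    rw [Multiset.le_iff_subset]
    · intro e he
      obtain ⟨j, -, rfl⟩ := mem_straight.1 he
      obtain ⟨m, hm⟩ := hvert j
      obtain rfl : m = 0 := hbare _ hm
      exact hm
    · refine Multiset.coe_nodup.2 ((List.nodup_finRange k).map_on fun i _ j _ hij => ?_)
      have hi : (Sum.inl i : Node k) ∈ ({Sum.inl j, Sum.inr j} : Multiset (Node k)) := by
        rw [← (Prod.mk.inj hij).1]; simp
      simpa using hi
  refine LDiagram.ext (eq_of_le_of_ends_eq hle ?_ hd).symm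
  rw [ends_eq_univ isDiagram_id, ends_eq_univ d.isDiagram]

end ArcsOfDiagram

section Relations

variable {k : ℕ}

/-- The map `diagramClass` as a homomorphism of monoids. -/
noncomputable def diagramClassHom (k : ℕ) : LDiagram k →* HatAlgebra k :=
  ((RingQuot.mkAlgHom ℤ[X] (AlgebraRel k) : _ →* HatAlgebra k)).comp
    (MonoidAlgebra.of ℤ[X] (LDiagram k))

theorem diagramClass_mul (d d' : LDiagram k) :
    diagramClass (d * d') = diagramClass d * diagramClass d' :=
  map_mul (diagramClassHom k) d d'

theorem diagramClass_one : diagramClass (1 : LDiagram k) = 1 :=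
  map_one (diagramClassHom k)

theorem diagramClass_cancel {d d' : LDiagram k} {e : Multiset (Node k)} {m : ℕ}
    {R : Multiset (Strand (Node k))} (h : d.strands = (e, m + 2) ::ₘ R)
    (h' : d'.strands = (e, m) ::ₘ R) : diagramClass d = diagramClass d' :=
  RingQuot.mkAlgHom_rel _ ⟨d, rfl, DiagramRel.cancel d d' e m R h h'⟩

theorem diagramClass_loop {d d' : LDiagram k} (h : d.strands = (0, 0) ::ₘ d'.strands) :
    diagramClass d = (X : ℤ[X]) • diagramClass d' := by
  rw [diagramClass, diagramClass, ← map_smul]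
  exact RingQuot.mkAlgHom_rel _ ⟨d, rfl, DiagramRel.loop d d' h⟩

theorem LDiagram.exists_cancel (d : LDiagram k) {e : Multiset (Node k)} {m : ℕ}
    {R : Multiset (Strand (Node k))} (h : d.strands = (e, m + 2) ::ₘ R) :
    ∃ d' : LDiagram k, d'.strands = (e, m) ::ₘ R := by
  refine ⟨d.simplify ((e, m) ::ₘ R) (fun f hf => ?_) (by rw [h, ends_cons, ends_cons]), rfl⟩
  rcases Multiset.mem_cons.1 hf with rfl | hf
  · exact ⟨(e, m + 2), by simp [h], rfl, by simp⟩
  · exact ⟨f, by simp [h, hf], rfl, id⟩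

theorem LDiagram.exists_removeLoop (d : LDiagram k) {m : ℕ} {R : Multiset (Strand (Node k))}
    (h : d.strands = (0, m) ::ₘ R) : ∃ d' : LDiagram k, d'.strands = R :=
  ⟨d.simplify R (fun f hf => ⟨f, by simp [h, hf], rfl, id⟩) (by rw [h, ends_cons, zero_add]), rfl⟩

theorem IsTypeII.of_isReduced {d : LDiagram k} (h : IsReduced d.strands)
    (heven : Even d.strands.sum.2) : IsTypeII d := by
  refine ⟨fun y hy => ?_, fun e he => (h e he).1, snd_sum d.strands ▸ heven⟩
  cases hy with
  | loop d' h' => exact (h (0, 0) (by simp [h'])).1 rfl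
  | cancel d' e m R h' _ => exact absurd (h (e, m + 2) (by simp [h'])).2 (by simp)
  | absorb d' e m R h' _ => exact (h (0, 1) (by simp [h'])).1 rfl

theorem IsTypeII.isReduced {d : LDiagram k} (h : IsTypeII d) : IsReduced d.strands := by
  rintro ⟨e, m⟩ he
  refine ⟨h.loopless _ he, not_le.1 fun (hm : 2 ≤ m) => ?_⟩
  obtain ⟨m, rfl⟩ := Nat.exists_eq_add_of_le' hm
  obtain ⟨R, hR⟩ := Multiset.exists_cons_of_mem he
  obtain ⟨d', hd'⟩ := d.exists_cancel hR
  exact h.irreducible _ (DiagramRel.cancel d d' e m R hR hd')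

end Relations

section AddEdge

variable {V : Type*} {pos : V → ℕ} {M : Multiset (Strand V)} {p q : V} {m : ℕ}

theorem planar_cons_pair (hM : Planar pos M)
    (h : ∀ e ∈ M, ∀ v ∈ e.1, ∀ w ∈ e.1,
      Between (pos p) (pos q) (pos v) → Between (pos p) (pos q) (pos w)) :
    Planar pos (({p, q}, m) ::ₘ M) := by
  have hpair : ∀ {a}, a ∈ ({p, q} : Multiset V) → pos a = pos p ∨ pos a = pos q := by
    simp only [Multiset.insert_eq_cons, Multiset.mem_cons, Multiset.mem_singleton]
    rintro a (rfl | rfl) <;> simp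
  unfold Between at h
  intro e he f hf a ha b hb c hc x hx
  rcases Multiset.mem_cons.1 he with rfl | he <;> rcases Multiset.mem_cons.1 hf with rfl | hf
  · have := hpair ha; have := hpair hb; have := hpair hc; have := hpair hx
    omega
  · have := hpair ha; have := hpair hc; have := h f hf b hb x hx
    omega
  · have := hpair hb; have := hpair hx; have := h e he c hc a ha
    omega
  · exact hM e he f hf a ha b hb c hc x hx

theorem leftExposed_cons_pair (hM : LeftExposed pos M)
    (hcover : ∀ e ∈ M, e.2 ≠ 0 → ∀ v ∈ e.1, ¬ Between (pos p) (pos q) (pos v))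
    (hcovered : m ≠ 0 → ∀ e ∈ M, ∀ v ∈ e.1, ∀ w ∈ e.1,
      ¬ Between (pos v) (pos w) (pos p) ∧ ¬ Between (pos v) (pos w) (pos q)) :
    LeftExposed pos (({p, q}, m) ::ₘ M) := by
  have hpair : ∀ {a}, a ∈ ({p, q} : Multiset V) → pos a = pos p ∨ pos a = pos q := by
    simp only [Multiset.insert_eq_cons, Multiset.mem_cons, Multiset.mem_singleton]
    rintro a (rfl | rfl) <;> simp
  unfold Between at hcover hcovered
  intro e he hdec f hf a ha b hb c hc
  rcases Multiset.mem_cons.1 he with rfl | he <;> rcases Multiset.mem_cons.1 hf with rfl | hf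
  · have := hpair ha; have := hpair hb; have := hpair hc
    omega
  · have := hpair hb; have := hcovered hdec f hf a ha c hc
    omega
  · have := hpair ha; have := hpair hc; have := hcover e he hdec b hb
    omega
  · exact hM e he hdec f hf a ha b hb c hc

end AddEdge

section Exchange

variable {k : ℕ}

theorem isDiagram_exchange {a b c d : Node k} {m₁ m₂ m₃ m₄ : ℕ} {R : Multiset (Strand (Node k))}
    (h : IsDiagram (({a, b}, m₁) ::ₘ ({c, d}, m₂) ::ₘ R)) :
    IsDiagram (({a, c}, m₃) ::ₘ ({b, d}, m₄) ::ₘ R) := by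
  have hends : ends (({a, c}, m₃) ::ₘ ({b, d}, m₄) ::ₘ R) =
      ends (({a, b}, m₁) ::ₘ ({c, d}, m₂) ::ₘ R) := by
    simp only [ends_cons, Multiset.insert_eq_cons, Multiset.cons_add, Multiset.singleton_add]
    rw [Multiset.cons_swap c b]
  refine ⟨?_, fun v => hends ▸ h.2 v⟩
  simp only [Multiset.mem_cons, forall_eq_or_imp]
  exact ⟨Or.inr rfl, Or.inr rfl, fun e he => h.1 e (by simp [he])⟩

namespace IsDiagram

variable {M : Multiset (Strand (Node k))} {e f : Strand (Node k)}

theorem nodePos_ne (hM : IsDiagram (f ::ₘ M)) (he : e ∈ M) {v w : Node k} (hv : v ∈ e.1)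
    (hw : w ∈ f.1) : nodePos v ≠ nodePos w := fun h =>
  hM.notMem_ends_of_mem hw (nodePos_injective h ▸ mem_ends.2 ⟨e, he, hv⟩)

theorem eq_or_arc (hM : IsDiagram M) (he : e ∈ M) {v w : Node k} (hv : v ∈ e.1) (hw : w ∈ e.1) :
    v = w ∨ Arc M (nodePos v) (nodePos w) e.2 := by
  obtain ⟨u, hu⟩ := hM.exists_pair_of_mem he hv
  rw [hu] at hw
  rcases Multiset.mem_cons.1 hw with rfl | hw
  · exact Or.inl rfl
  · obtain rfl := Multiset.mem_singleton.1 hw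
    exact Or.inr ⟨v, w, hu ▸ he, rfl, rfl⟩

end IsDiagram

namespace IsMove

variable {I J x y : Node k} {m m' : ℕ} {R : Multiset (Strand (Node k))}

theorem nodePos_ne (hM : IsDiagram (({I, J}, m) ::ₘ ({x, y}, m') ::ₘ R))
    (hJ : nodePos J = nodePos I + 1) {e : Strand (Node k)} (he : e ∈ R) {v : Node k}
    (hv : v ∈ e.1) :
    nodePos v ≠ nodePos I ∧ nodePos v ≠ nodePos I + 1 ∧
      nodePos v ≠ nodePos x ∧ nodePos v ≠ nodePos y := by
  have hM' := Multiset.cons_swap _ _ R ▸ hM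
  rw [← hJ]
  exact ⟨hM.nodePos_ne (Multiset.mem_cons_of_mem he) hv (by simp),
    hM.nodePos_ne (Multiset.mem_cons_of_mem he) hv (by simp),
    hM'.nodePos_ne (Multiset.mem_cons_of_mem he) hv (by simp),
    hM'.nodePos_ne (Multiset.mem_cons_of_mem he) hv (by simp)⟩

theorem planar_exchange
    (h : IsMove k (Arc (({I, J}, m) ::ₘ ({x, y}, m') ::ₘ R)) (nodePos I) (nodePos x) (nodePos y)
      m m')
    (hM : IsDiagram (({I, J}, m) ::ₘ ({x, y}, m') ::ₘ R)) (hJ : nodePos J = nodePos I + 1)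
    (hP : Planar nodePos (({I, J}, m) ::ₘ ({x, y}, m') ::ₘ R)) (l l' : ℕ) :
    Planar nodePos (({I, x}, l) ::ₘ ({J, y}, l') ::ₘ R) := by
  have hR : Planar nodePos R := fun e he f hf => hP e (by simp [he]) f (by simp [hf])
  have hold : ∀ e ∈ R, ∀ v ∈ e.1, ∀ w ∈ e.1,
      (Between (nodePos I) (nodePos x) (nodePos v) → Between (nodePos I) (nodePos x) (nodePos w)) ∧
      (Between (nodePos J) (nodePos y) (nodePos v) →
        Between (nodePos J) (nodePos y) (nodePos w)) := by
    intro e he v hv w hw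
    rcases hM.eq_or_arc (by simp [he]) hv hw with rfl | harc
    · exact ⟨id, id⟩
    · obtain ⟨hI, hI', hx, hy⟩ := nodePos_ne hM hJ he hv
      exact hJ ▸ h.planar harc hI hI' hx hy
  refine planar_cons_pair (planar_cons_pair hR fun e he v hv w hw => (hold e he v hv w hw).2) ?_
  have hself := h.planar_self
  rw [← hJ] at hself
  simp only [Multiset.mem_cons, forall_eq_or_imp, Multiset.insert_eq_cons, Multiset.mem_singleton,
    forall_eq]
  exact ⟨⟨⟨id, hself.1⟩, hself.2, id⟩, fun e he v hv w hw => (hold e he v hv w hw).1⟩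

theorem leftExposed_exchange
    (h : IsMove k (Arc (({I, J}, m) ::ₘ ({x, y}, m') ::ₘ R)) (nodePos I) (nodePos x) (nodePos y)
      m m')
    (hM : IsDiagram (({I, J}, m) ::ₘ ({x, y}, m') ::ₘ R)) (hJ : nodePos J = nodePos I + 1)
    (hE : LeftExposed nodePos (({I, J}, m) ::ₘ ({x, y}, m') ::ₘ R)) :
    LeftExposed nodePos (({I, x}, (m + m') % 2) ::ₘ ({J, y}, 0) ::ₘ R) := by
  have hR : LeftExposed nodePos R := fun e he hdec f hf => hE e (by simp [he]) hdec f (by simp [hf])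
  have hcover : ∀ e ∈ R, e.2 ≠ 0 → ∀ v ∈ e.1, ¬ Between (nodePos I) (nodePos x) (nodePos v) ∧
      ¬ Between (nodePos J) (nodePos y) (nodePos v) := by
    intro e he hdec v hv
    have heM : e ∈ ({I, J}, m) ::ₘ ({x, y}, m') ::ₘ R := by simp [he]
    obtain ⟨w, hw⟩ := hM.exists_pair_of_mem heM hv
    obtain ⟨hI, hI', hx, hy⟩ := nodePos_ne hM hJ he hv
    exact hJ ▸ h.exposed ⟨v, w, hw ▸ heM, rfl, rfl⟩ hdec hI hI' hx hy
  have hcovered : (m + m') % 2 ≠ 0 → ∀ e ∈ R, ∀ v ∈ e.1, ∀ w ∈ e.1,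
      ¬ Between (nodePos v) (nodePos w) (nodePos I) ∧
      ¬ Between (nodePos v) (nodePos w) (nodePos x) := by
    intro hodd e he v hv w hw
    rcases hM.eq_or_arc (by simp [he]) hv hw with rfl | harc
    · unfold Between
      omega
    · obtain ⟨hI, hI', hx, hy⟩ := nodePos_ne hM hJ he hv
      exact h.exposed_new hodd harc hI hI' hx hy
  refine leftExposed_cons_pair (leftExposed_cons_pair hR
    (fun e he hdec v hv => (hcover e he hdec v hv).2) (absurd rfl)) ?_ fun hodd => ?_
  · simp only [Multiset.mem_cons, forall_eq_or_imp]
    exact ⟨fun hdec => absurd rfl hdec, fun e he hdec v hv => (hcover e he hdec v hv).1⟩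
  · have hself := h.exposed_self hodd
    rw [← hJ] at hself
    simp only [Multiset.mem_cons, forall_eq_or_imp, Multiset.insert_eq_cons,
      Multiset.mem_singleton, forall_eq]
    refine ⟨⟨⟨?_, hself⟩, ?_, ?_⟩, hcovered hodd⟩
    all_goals
      unfold Between at hself ⊢
      omega

end IsMove

/-- The total horizontal length of the edges, which decreases when a simple diagram is split
off. -/
def LDiagram.length (d : LDiagram k) : ℕ := (d.strands.map strandLength).sum

theorem exists_isMove {d : LDiagram k} (hd : IsReduced d.strands) (h1 : d ≠ 1) :
    ∃ (i : ℕ) (hi : i + 1 < k) (x y : Node k) (m m' : ℕ) (R : Multiset (Strand (Node k))),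
      IsMove k (Arc d.strands) i (nodePos x) (nodePos y) m m' ∧
      d.strands = (({Sum.inl ⟨i, by omega⟩, Sum.inl ⟨i + 1, hi⟩} : Multiset (Node k)), m) ::ₘ
        ({x, y}, m') ::ₘ R := by
  obtain ⟨i, _, _, m, m', hmove⟩ := (isArcSystem d fun e he => (hd e he).2).exists_isMove
    fun hvert => h1 (eq_one_of_vertical (fun e he => (hd e he).1) hvert)
  have hi := hmove.top
  obtain ⟨x, y, hxy, rfl, rfl⟩ := hmove.arc
  obtain ⟨I, J, hIJ, hI, hJ⟩ := hmove.cup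
  obtain rfl : I = Sum.inl ⟨i, Nat.lt_of_succ_lt hi⟩ := nodePos_injective hI
  obtain rfl : J = Sum.inl ⟨i + 1, hi⟩ := nodePos_injective hJ
  obtain ⟨R, hR⟩ := Multiset.exists_cons_of_mem hIJ
  rw [hR, Multiset.mem_cons] at hxy
  rcases hxy with heq | hxy
  · have hx : x ∈ ({Sum.inl ⟨i, by omega⟩, Sum.inl ⟨i + 1, hi⟩} : Multiset (Node k)) := by
      rw [← (Prod.mk.inj heq).1]
      simp
    simp only [Multiset.insert_eq_cons, Multiset.mem_cons, Multiset.mem_singleton] at hx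
    rcases hx with rfl | rfl
    · exact absurd rfl hmove.ne.1
    · exact absurd rfl hmove.ne.2
  · obtain ⟨R', rfl⟩ := Multiset.exists_cons_of_mem hxy
    exact ⟨i, hi, x, y, m, m', R', hmove, hR⟩

theorem IsTypeII.exists_exchange {d : LDiagram k} (hd : IsTypeII d) {I J x y : Node k} {m m' : ℕ}
    {R : Multiset (Strand (Node k))} (hJ : nodePos J = nodePos I + 1)
    (hmove : IsMove k (Arc d.strands) (nodePos I) (nodePos x) (nodePos y) m m')
    (hs : d.strands = ({I, J}, m) ::ₘ ({x, y}, m') ::ₘ R) :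
    ∃ d' : LDiagram k, IsTypeII d' ∧ d'.length < d.length ∧
      d'.strands = ({I, x}, (m + m') % 2) ::ₘ ({J, y}, 0) ::ₘ R := by
  have hM := d.isDiagram
  have hP := d.planar
  have hE := d.leftExposed
  have hreduced := hd.isReduced
  have heven := hd.even
  have hlt := hmove.length_lt
  rw [← snd_sum] at heven
  rw [hs] at hmove hM hP hE hreduced heven
  have hM' : IsDiagram (({I, x}, (m + m') % 2) ::ₘ ({J, y}, 0) ::ₘ R) := isDiagram_exchange hM
  have hE' := hmove.leftExposed_exchange hM hJ hE
  have hreduced' : IsReduced (({I, x}, (m + m') % 2) ::ₘ ({J, y}, 0) ::ₘ R) := by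
    simp only [IsReduced, Multiset.mem_cons, forall_eq_or_imp]
    exact ⟨⟨by simp, Nat.mod_lt _ two_pos⟩, ⟨by simp, two_pos⟩,
      fun e he => hreduced e (by simp [he])⟩
  have heven' : Even ((({I, x}, (m + m') % 2) ::ₘ ({J, y}, 0) ::ₘ R).sum.2) := by
    simp only [Multiset.sum_cons, Prod.snd_add, Nat.even_iff] at heven ⊢
    omega
  refine ⟨⟨_, hM', hmove.planar_exchange hM hJ hP _ _, hM'.bare_of_even hE' hreduced' heven', hE'⟩,
    IsTypeII.of_isReduced hreduced' heven', ?_, rfl⟩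
  rw [LDiagram.length, LDiagram.length, hs]
  simp only [Multiset.map_cons, Multiset.sum_cons, strandLength_pair, hJ]
  omega

theorem IsTypeII.exists_factorization {d : LDiagram k} (hd : IsTypeII d) (h1 : d ≠ 1) :
    ∃ (i : ℕ) (hi : i + 1 < k) (m : ℕ) (hm : m = 0 ∨ i = 0) (d' : LDiagram k), m < 2 ∧
      IsTypeII d' ∧ d'.length < d.length ∧
      diagramClass d = diagramClass (simpleDiagram i hi m hm * d') := by
  obtain ⟨i, hi, x, y, m, m', R, hmove, hs⟩ := exists_isMove hd.isReduced h1
  obtain ⟨d', hd', hlt, hs'⟩ := hd.exists_exchange (I := Sum.inl ⟨i, by omega⟩) rfl hmove hs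
  have hm : m < 2 := (hd.isReduced (_, m) (hs ▸ Multiset.mem_cons_self _ _)).2
  have hm' : m' < 2 := (hd.isReduced ({x, y}, m') (by simp [hs])).2
  refine ⟨i, hi, m, hmove.bare, d', hm, hd', hlt, ?_⟩
  have hprod : (simpleDiagram i hi m hmove.bare * d').strands =
      (({Sum.inl ⟨i, by omega⟩, Sum.inl ⟨i + 1, hi⟩} : Multiset (Node k)), m) ::ₘ
        ({x, y}, m + (m + m') % 2 + 0) ::ₘ R := by
    change concat (simpleStrands _ _ _) d'.strands = _
    rw [hs']
    exact concat_simpleStrands (by simp) m _ 0 (hs' ▸ d'.isDiagram.2)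
  obtain hsum | hsum : m + (m + m') % 2 + 0 = m' ∨ m + (m + m') % 2 + 0 = m' + 2 := by omega
  · rw [hsum, ← hs] at hprod
    rw [LDiagram.ext hprod]
  · rw [hsum, Multiset.cons_swap] at hprod
    rw [Multiset.cons_swap] at hs
    exact (diagramClass_cancel hprod hs).symm

theorem simpleDiagram_mem_DTL (i : ℕ) (hi : i + 1 < k) (m : ℕ) (hm : m = 0 ∨ i = 0)
    (hm2 : m < 2) : diagramClass (simpleDiagram i hi m hm) ∈ DTL k := by
  refine Algebra.subset_adjoin ?_
  obtain rfl | rfl : m = 0 ∨ m = 1 := by omega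
  · exact Or.inl ⟨i, hi, rfl⟩
  · obtain rfl : i = 0 := by omega
    exact Or.inr ⟨hi, rfl⟩

theorem IsTypeII.diagramClass_mem_DTL {d : LDiagram k} (hd : IsTypeII d) :
    diagramClass d ∈ DTL k := by
  induction hN : d.length using Nat.strong_induction_on generalizing d with
  | h N ih =>
    by_cases h1 : d = 1
    · rw [h1, diagramClass_one]
      exact (DTL k).one_mem
    · obtain ⟨i, hi, m, hm, d', hm2, hd', hlt, hclass⟩ := hd.exists_factorization h1
      rw [hclass, diagramClass_mul]
      exact (DTL k).mul_mem (simpleDiagram_mem_DTL i hi m hm hm2) (ih _ (hN ▸ hlt) hd' rfl)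

end Exchange

section Spanning

variable {k : ℕ}

theorem exists_diagramClass_eq_parity (d : LDiagram k) :
    ∃ d' : LDiagram k, d'.strands = parity d.strands ∧ diagramClass d = diagramClass d' := by
  induction hN : d.strands.sum.2 using Nat.strong_induction_on generalizing d with
  | h N ih =>
    by_cases hlt : ∀ e ∈ d.strands, e.2 < 2
    · exact ⟨d, (parity_eq_self hlt).symm, rfl⟩
    · push Not at hlt
      obtain ⟨⟨e, m⟩, hm, hm2 : 2 ≤ m⟩ := hlt
      obtain ⟨m, rfl⟩ := Nat.exists_eq_add_of_le' hm2
      obtain ⟨R, hR⟩ := Multiset.exists_cons_of_mem hm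
      obtain ⟨d₁, hd₁⟩ := d.exists_cancel hR
      have hsum : d.strands.sum.2 = d₁.strands.sum.2 + 2 := by
        rw [hR, hd₁]
        simp only [Multiset.sum_cons, Prod.snd_add]
        omega
      obtain ⟨d', hd', hclass⟩ := ih _ (by omega) d₁ rfl
      refine ⟨d', ?_, (diagramClass_cancel hR hd₁).trans hclass⟩
      simp [hd', hR, hd₁, parity]

theorem exists_diagramClass_eq_smul {d : LDiagram k}
    (hd : ∀ e ∈ d.strands, e.2 < 2 ∧ (e.1 = 0 → e.2 = 0)) :
    ∃ (c : ℤ[X]) (d' : LDiagram k), IsReduced d'.strands ∧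
      d'.strands.sum.2 = d.strands.sum.2 ∧ diagramClass d = c • diagramClass d' := by
  induction hN : d.strands.card using Nat.strong_induction_on generalizing d with
  | h N ih =>
    by_cases hloop : ∃ e ∈ d.strands, e.1 = 0
    · obtain ⟨⟨e, m⟩, hm, rfl : e = 0⟩ := hloop
      obtain rfl : m = 0 := (hd _ hm).2 rfl
      obtain ⟨R, hR⟩ := Multiset.exists_cons_of_mem hm
      obtain ⟨d₁, rfl⟩ := d.exists_removeLoop hR
      obtain ⟨c, d', hd', hsum, hclass⟩ :=
        ih _ (by simp [← hN, hR]) (d := d₁) (fun e he => hd e (by simp [hR, he])) rfl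
      refine ⟨X * c, d', hd', by simp [hsum, hR], ?_⟩
      rw [diagramClass_loop hR, hclass, mul_smul]
    · push Not at hloop
      exact ⟨1, d, fun e he => ⟨hloop e he, (hd e he).1⟩, rfl, (one_smul _ _).symm⟩

theorem exists_isTypeII_of_even {d : LDiagram k} (heven : Even d.strands.sum.2) :
    (∃ (c : ℤ[X]) (d' : LDiagram k), IsTypeII d' ∧ diagramClass d = c • diagramClass d') ∨
      ∃ d' : LDiagram k, (0, 1) ∈ d'.strands ∧ diagramClass d = diagramClass d' := by
  obtain ⟨d₁, hd₁, hclass₁⟩ := exists_diagramClass_eq_parity d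
  by_cases hloop : (0, 1) ∈ d₁.strands
  · exact Or.inr ⟨d₁, hloop, hclass₁⟩
  · have hlt : ∀ e ∈ d₁.strands, e.2 < 2 := by
      rw [hd₁]
      intro e he
      obtain ⟨e', -, rfl⟩ := Multiset.mem_map.1 he
      exact Nat.mod_lt _ two_pos
    have hbare : ∀ e ∈ d₁.strands, e.1 = 0 → e.2 = 0 := by
      rintro ⟨e, m⟩ he (rfl : e = 0)
      have hm := hlt _ he
      interval_cases m
      · rfl
      · exact absurd he hloop
    obtain ⟨c, d', hred, hsum, hclass⟩ :=
      exists_diagramClass_eq_smul fun e he => ⟨hlt e he, hbare e he⟩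
    refine Or.inl ⟨c, d', .of_isReduced hred ?_, hclass₁.trans hclass⟩
    rwa [hsum, hd₁, Nat.even_iff, snd_sum_parity_mod_two, ← Nat.even_iff]

theorem snd_sum_straight (l : List (Fin k)) : (straight l).sum.2 = 0 := by
  rw [snd_sum]
  refine Multiset.sum_eq_zero fun m hm => ?_
  obtain ⟨e, he, rfl⟩ := Multiset.mem_map.1 hm
  obtain ⟨i, -, rfl⟩ := mem_straight.1 he
  rfl

/-- The diagrams with an even total number of decorations; they contain the generators of `DTL`. -/
def evenDiagrams (k : ℕ) : Submonoid (LDiagram k) where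
  carrier := {d | Even d.strands.sum.2}
  mul_mem' {d d'} (hd : Even _) (hd' : Even _) := by
    change Even (concat d.strands d'.strands).sum.2
    rw [snd_sum_concat]
    exact hd.add hd'
  one_mem' := by
    change Even (straight (List.finRange k)).sum.2
    rw [snd_sum_straight]
    exact Even.zero

theorem simpleDiagram_mem_evenDiagrams (i : ℕ) (hi : i + 1 < k) (m : ℕ) (hm : m = 0 ∨ i = 0) :
    simpleDiagram i hi m hm ∈ evenDiagrams k :=
  ⟨m, by simp [simpleDiagram, simpleStrands, snd_sum_straight]⟩

theorem exists_even_of_mem_closure {x : HatAlgebra k}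
    (hx : x ∈ Submonoid.closure
      {x | (∃ (i : ℕ) (hi : i + 1 < k), x = diagramClass (simpleDiagram i hi 0 (Or.inl rfl))) ∨
        ∃ h : 0 + 1 < k, x = diagramClass (simpleDiagram 0 h 1 (Or.inr rfl))}) :
    ∃ d : LDiagram k, Even d.strands.sum.2 ∧ diagramClass d = x := by
  refine Submonoid.closure_le (S := (evenDiagrams k).map (diagramClassHom k)).2 ?_ hx
  rintro _ (⟨i, hi, rfl⟩ | ⟨hi, rfl⟩)
  · exact ⟨_, simpleDiagram_mem_evenDiagrams i hi 0 (Or.inl rfl), rfl⟩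
  · exact ⟨_, simpleDiagram_mem_evenDiagrams 0 hi 1 (Or.inr rfl), rfl⟩

/-- The image in `LFD(D_k)` of a diagram of type II. -/
noncomputable def typeIIClass (d : {d : LDiagram k // IsTypeII d}) : LFD k :=
  toLFD k ⟨diagramClass d.1, d.2.diagramClass_mem_DTL⟩

theorem toLFD_eq_zero {d : LDiagram k} (hd : (0, 1) ∈ d.strands) {x : DTL k}
    (hx : (x : HatAlgebra k) = diagramClass d) : toLFD k x = 0 := by
  have hrel : LoopRel k x 0 := ⟨rfl, d, hd, hx⟩
  rw [toLFD, RingQuot.mkAlgHom_rel ℤ[X] hrel, map_zero]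

theorem toLFD_mem_span {d : LDiagram k} (heven : Even d.strands.sum.2) {x : DTL k}
    (hx : (x : HatAlgebra k) = diagramClass d) :
    toLFD k x ∈ Submodule.span ℤ[X] (Set.range (typeIIClass (k := k))) := by
  obtain ⟨c, d', hd', hclass⟩ | ⟨d', hd', hclass⟩ := exists_isTypeII_of_even heven
  · obtain rfl : x = c • ⟨diagramClass d', hd'.diagramClass_mem_DTL⟩ :=
      Subtype.ext (hx.trans hclass)
    rw [map_smul]
    exact Submodule.smul_mem _ _ (Submodule.subset_span ⟨⟨d', hd'⟩, rfl⟩)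
  · rw [toLFD_eq_zero hd' (hx.trans hclass)]
    exact Submodule.zero_mem _

theorem span_range_typeIIClass :
    Submodule.span ℤ[X] (Set.range (typeIIClass (k := k))) = ⊤ := by
  set S := Submodule.span ℤ[X] (Set.range (typeIIClass (k := k)))
  have hDTL : Subalgebra.toSubmodule (DTL k) ≤
      (S.comap (toLFD k).toLinearMap).map (DTL k).val.toLinearMap := by
    conv_lhs => rw [DTL, Algebra.adjoin_eq_span]
    refine Submodule.span_le.2 fun x hx => ?_
    have hx' : x ∈ DTL k := by
      rw [← Subalgebra.mem_toSubmodule, DTL, Algebra.adjoin_eq_span]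
      exact Submodule.subset_span hx
    obtain ⟨d, heven, hd⟩ := exists_even_of_mem_closure hx
    exact ⟨⟨x, hx'⟩, toLFD_mem_span heven hd.symm, rfl⟩
  refine Submodule.eq_top_iff'.2 fun y => ?_
  obtain ⟨x, rfl⟩ := RingQuot.mkAlgHom_surjective ℤ[X] (LoopRel k) y
  obtain ⟨x', hx', hxx'⟩ := hDTL x.2
  rwa [← Subtype.ext hxx']

theorem linearIndependent_typeIIClass : LinearIndependent ℤ[X] (typeIIClass (k := k)) := by
  let toReduced (d : {d : LDiagram k // IsTypeII d}) : ReducedDiagram k := ⟨d.1, d.2.isReduced⟩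
  have hinj : Function.Injective toReduced := fun _ _ h =>
    Subtype.ext (Subtype.mk.inj h)
  refine .of_comp (coordinates k) ?_
  convert (Finsupp.linearIndependent_single_one ℤ[X] (ReducedDiagram k)).comp _ hinj using 1
  funext d
  rw [Function.comp_apply, typeIIClass, coordinates_toLFD_diagramClass,
    normalForm_of_isReduced d.2.isReduced, Function.comp_apply]

end Spanning

end DecTL

theorem mainTheorem6_general (n : ℕ) :
    ∃ b : Module.Basis {d : DecTL.LDiagram n // DecTL.IsTypeII d} ℤ[X] (DecTL.LFD n),
      ∀ d : {d : DecTL.LDiagram n // DecTL.IsTypeII d},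
        ∃ h : DecTL.diagramClass d.1 ∈ DecTL.DTL n,
          b d = RingQuot.mkAlgHom ℤ[X] (DecTL.LoopRel n) ⟨DecTL.diagramClass d.1, h⟩ :=
  ⟨.mk DecTL.linearIndependent_typeIIClass DecTL.span_range_typeIIClass.ge,
    fun d => ⟨d.2.diagramClass_mem_DTL, Module.Basis.mk_apply _ _ _⟩⟩

theorem mainTheorem6 (n : ℕ) (hn : 4 ≤ n) :
    ∃ b : Module.Basis {d : DecTL.LDiagram n // DecTL.IsTypeII d} ℤ[X] (DecTL.LFD n),
      ∀ d : {d : DecTL.LDiagram n // DecTL.IsTypeII d},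
        ∃ h : DecTL.diagramClass d.1 ∈ DecTL.DTL n,
          b d = RingQuot.mkAlgHom ℤ[X] (DecTL.LoopRel n) ⟨DecTL.diagramClass d.1, h⟩ :=
  mainTheorem6_general n
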